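/- Let $M$ be a real-analytic manifold (Hausdorff, second countable, without boundary) of finite dimension $n\ge 2$, $G$ a compact connected Lie group and $B\to M$ a smooth principal $G$-bundle; let $\mathcal A$ be the set of smooth connections on $B$. *Edges.* A parametrized edge is a real-analytic immersion $c:[0,1]\to M$ (self-intersections are allowed; analytic and immersive up to the end points). An oriented edge $e$, with initial point $e_-$ and final point $e_+$, is a class of parametrized edges modulo orientation-preserving analytic diffeomorphisms of $[0,1]$; an unoriented edge is a class modulo all analytic diffeomorphisms of $[0,1]$. Write $e^{-1}$ for the reversed edge and, if $e_{1+}=e_{2-}$ and the glued path has a parametrization as an edge, $e_2\circ e_1$ for the edge obtained by gluing. *Graphs.* A graph $\gamma$ is a finite set of unoriented edges such that: each is embedded (diffeomorphic to $[0,1]$); two different edges meet only in common end points; each end point of an edge $e\in\gamma$ is also an end point of another edge of $\gamma$. Say that $\gamma$ contains the oriented edge $e$ if $e$ is a finite product of edges of $\gamma$, taken with suitable orientations. Put $\gamma'\ge\gamma$ if $\gamma'$ contains every edge of $\gamma$ and every vertex of $\gamma$ is a vertex of $\gamma'$. *The projective limit.* For an embedded edge $e$ let $\mathcal A_e$ be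 the set of restrictions to $B|_e$ of connections in $\mathcal A$, modulo the smooth vertical automorphisms of $B$ which are the identity on the fibres over the end points of $e$. Let $\mathcal A_\gamma=\prod_{e\in\gamma}\mathcal A_e$, let $\pi_\gamma:\mathcal A\to\mathcal A_\gamma$ be the natural map, and for $\gamma'\ge\gamma$ let $p_{\gamma\gamma'}:\mathcal A_{\gamma'}\to\mathcal A_\gamma$ be the map with $\pi_\gamma=p_{\gamma\gamma'}\circ\pi_{\gamma'}$. Let $\overline{\mathcal A}$ be the set of families $\bar A=(A_\gamma)_\gamma$, $A_\gamma\in\mathcal A_\gamma$, with $p_{\gamma\gamma'}A_{\gamma'}=A_\gamma$ whenever $\gamma'\ge\gamma$. *Generalized parallel transports.* $\mathcal P(B)$ is the set of maps $I$ which assign to each oriented edge $e$ a $G$-equivariant bijection $I(e):B_{e_-}\to B_{e_+}$ of fibres such that $I(e^{-1})=I(e)^{-1}$, and $I(e_2\circ e_1)=I(e_2)\circ I(e_1)$ whenever $e_2\circ e_1$ is an edge. **Proposition.** The maps $p_{\gamma\gamma'}$ exist and are unique, and every oriented edge is contained in some graph. For $\bar A=(A_\gamma)\in\overline{\mathcal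 A}$ and an oriented edge $e$ let $I_{\bar A}(e):=H(A_\gamma,e)$, where $\gamma$ is any graph containing $e$ and $H(A_\gamma,e)$ is the parallel transport along $e$ of any connection $A\in\mathcal A$ with $\pi_\gamma(A)=A_\gamma$. Such connections exist, $I_{\bar A}(e)$ depends neither on $\gamma$ nor on $A$, $I_{\bar A}\in\mathcal P(B)$, and $\bar A\mapsto I_{\bar A}$ is a bijection from $\overline{\mathcal A}$ onto $\mathcal P(B)$. -/

import Mathlib

open Set
open scoped Manifold ContDiff

/-! ## Analytic edges -/

section Edges

variable (EM : Type*) [NormedAddCommGroup EM] [NormedSpace ℝ EM]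
  (M : Type*) [TopologicalSpace M] [ChartedSpace EM M]

/-- A parametrised analytic edge: a map `[0,1] → M` which is real analytic (up to and including
the end points, i.e. near every point of `[0,1]`) and regular, i.e. an immersion. It is allowed to
intersect itself. The values outside `[0,1]` are irrelevant; they are forgotten in `OEdge`. -/
structure AnalyticPath where
  /-- the underlying map -/
  toFun : ℝ → M
  analytic' : ∀ t ∈ Icc (0 : ℝ) 1, ContMDiffAt 𝓘(ℝ, ℝ) 𝓘(ℝ, EM) ω toFun t
  immersion' : ∀ t ∈ Icc (0 : ℝ) 1, mfderiv 𝓘(ℝ, ℝ) 𝓘(ℝ, EM) toFun t (1 : ℝ) ≠ 0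

variable {EM M}

namespace AnalyticPath

instance : CoeFun (AnalyticPath EM M) (fun _ => ℝ → M) := ⟨AnalyticPath.toFun⟩

/-- The velocity vector of a path. -/
noncomputable def velocity (c : AnalyticPath EM M) (t : ℝ) : TangentSpace 𝓘(ℝ, EM) (c t) :=
  mfderiv 𝓘(ℝ, ℝ) 𝓘(ℝ, EM) c t (1 : ℝ)

/-- The image of a path. -/
def image (c : AnalyticPath EM M) : Set M := c '' Icc 0 1

/-- The set of the two end points of a path. -/
def ends (c : AnalyticPath EM M) : Set M := {c 0, c 1}

/-- Precomposition with an affine map `t ↦ a + b t` with `b ≠ 0` which maps `[0,1]` to itself. -/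
noncomputable def affine (c : AnalyticPath EM M) (a b : ℝ) (hb : b ≠ 0)
    (h : ∀ t ∈ Icc (0 : ℝ) 1, a + b * t ∈ Icc (0 : ℝ) 1) : AnalyticPath EM M where
  toFun t := c (a + b * t)
  analytic' t ht := by
    have h1 : ContMDiffAt 𝓘(ℝ, ℝ) 𝓘(ℝ, ℝ) ω (fun t : ℝ => a + b * t) t := by
      apply ContDiffAt.contMDiffAt
      fun_prop
    exact (c.analytic' _ (h t ht)).comp t h1
  immersion' t ht := by
    have h1 : HasMFDerivAt 𝓘(ℝ, ℝ) 𝓘(ℝ, EM) c.toFun (a + b * t) _ :=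
      ((c.analytic' _ (h t ht)).mdifferentiableAt (by simp)).hasMFDerivAt
    have h2 : HasFDerivAt (fun t : ℝ => a + b * t)
        (ContinuousLinearMap.toSpanSingleton ℝ b : ℝ →L[ℝ] ℝ) t := by
      have := ((hasDerivAt_id t).const_mul b).const_add a
      simpa using this.hasFDerivAt
    have h3 := HasMFDerivAt.comp t h1 h2.hasMFDerivAt
    have h4 := h3.mfderiv
    intro h0
    have h5 : mfderiv 𝓘(ℝ, ℝ) 𝓘(ℝ, EM) (c.toFun ∘ fun t : ℝ => a + b * t) t (1 : ℝ) = 0 := h0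
    rw [h4] at h5
    have h7 : mfderiv 𝓘(ℝ, ℝ) 𝓘(ℝ, EM) c.toFun (a + b * t) (b • (1 : ℝ)) = 0 := by
      have h6 : (ContinuousLinearMap.toSpanSingleton ℝ b : ℝ →L[ℝ] ℝ) 1 = b • (1 : ℝ) := by simp
      rw [← h6]
      exact h5
    have h8 := ContinuousLinearMap.map_smul
      (mfderiv 𝓘(ℝ, ℝ) 𝓘(ℝ, EM) c.toFun (a + b * t) : ℝ →L[ℝ] EM) b (1 : ℝ)
    have h9 : b • (mfderiv 𝓘(ℝ, ℝ) 𝓘(ℝ, EM) c.toFun (a + b * t) : ℝ →L[ℝ] EM) (1 : ℝ) = 0 :=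
      h8.symm.trans h7
    exact c.immersion' _ (h t ht) ((smul_eq_zero.mp h9).resolve_left hb)

/-- The path traversed backwards. -/
noncomputable def reverse (c : AnalyticPath EM M) : AnalyticPath EM M :=
  c.affine 1 (-1) (by norm_num) (fun t ht => ⟨by linarith [ht.2], by linarith [ht.1]⟩)

/-- The initial part `c|[0,s]`, rescaled to `[0,1]`. -/
noncomputable def initialPart (c : AnalyticPath EM M) (s : ℝ) (hs : s ∈ Ioo (0 : ℝ) 1) :
    AnalyticPath EM M :=
  c.affine 0 s hs.1.ne' (fun t ht => ⟨by nlinarith [ht.1, hs.1], by nlinarith [ht.2, hs.1, hs.2]⟩)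

/-- The final part `c|[s,1]`, rescaled to `[0,1]`. -/
noncomputable def finalPart (c : AnalyticPath EM M) (s : ℝ) (hs : s ∈ Ioo (0 : ℝ) 1) :
    AnalyticPath EM M :=
  c.affine s (1 - s) (by linarith [hs.2]) (fun t ht =>
    ⟨by nlinarith [ht.1, hs.1, hs.2], by nlinarith [ht.2, hs.1, hs.2]⟩)

end AnalyticPath

/-- `f` is an analytic diffeomorphism of `[0,1]`, with inverse `g`. -/
structure IsReparam (f g : ℝ → ℝ) : Prop where
  analytic_fun : AnalyticOnNhd ℝ f (Icc 0 1)
  analytic_inv : AnalyticOnNhd ℝ g (Icc 0 1)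
  mapsTo_fun : MapsTo f (Icc 0 1) (Icc 0 1)
  mapsTo_inv : MapsTo g (Icc 0 1) (Icc 0 1)
  left_inv : ∀ t ∈ Icc (0 : ℝ) 1, g (f t) = t
  right_inv : ∀ t ∈ Icc (0 : ℝ) 1, f (g t) = t

theorem IsReparam.id : IsReparam id id :=
  ⟨analyticOnNhd_id, analyticOnNhd_id, mapsTo_id _, mapsTo_id _, fun _ _ => rfl, fun _ _ => rfl⟩

theorem IsReparam.symm {f g : ℝ → ℝ} (h : IsReparam f g) : IsReparam g f :=
  ⟨h.analytic_inv, h.analytic_fun, h.mapsTo_inv, h.mapsTo_fun, h.right_inv, h.left_inv⟩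

theorem IsReparam.comp {f g f' g' : ℝ → ℝ} (h : IsReparam f g) (h' : IsReparam f' g') :
    IsReparam (f ∘ f') (g' ∘ g) where
  analytic_fun := h.analytic_fun.comp h'.analytic_fun h'.mapsTo_fun
  analytic_inv := h'.analytic_inv.comp h.analytic_inv h.mapsTo_inv
  mapsTo_fun := h.mapsTo_fun.comp h'.mapsTo_fun
  mapsTo_inv := h'.mapsTo_inv.comp h.mapsTo_inv
  left_inv t ht := by simp [h.left_inv _ (h'.mapsTo_fun ht), h'.left_inv t ht]
  right_inv t ht := by simp [h'.right_inv _ (h.mapsTo_inv ht), h.right_inv t ht]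

theorem IsReparam.monotoneOn_symm {f g : ℝ → ℝ} (h : IsReparam f g)
    (hf : MonotoneOn f (Icc 0 1)) : MonotoneOn g (Icc 0 1) := by
  intro s hs t ht hst
  by_contra! hlt
  have h1 := hf (h.mapsTo_inv ht) (h.mapsTo_inv hs) hlt.le
  rw [h.right_inv t ht, h.right_inv s hs] at h1
  have h2 : s = t := le_antisymm hst h1
  rw [h2] at hlt
  exact lt_irrefl _ hlt

theorem IsReparam.map_zero {f g : ℝ → ℝ} (h : IsReparam f g) (hf : MonotoneOn f (Icc 0 1)) :
    f 0 = 0 := by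
  have h0 : (0 : ℝ) ∈ Icc (0 : ℝ) 1 := by simp
  have h1 := hf h0 (h.mapsTo_inv h0) (h.mapsTo_inv h0).1
  rw [h.right_inv 0 h0] at h1
  exact le_antisymm h1 (h.mapsTo_fun h0).1

theorem IsReparam.map_one {f g : ℝ → ℝ} (h : IsReparam f g) (hf : MonotoneOn f (Icc 0 1)) :
    f 1 = 1 := by
  have h0 : (1 : ℝ) ∈ Icc (0 : ℝ) 1 := by simp
  have h1 := hf (h.mapsTo_inv h0) h0 (h.mapsTo_inv h0).2
  rw [h.right_inv 1 h0] at h1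
  exact le_antisymm (h.mapsTo_fun h0).2 h1

variable (EM M)

/-- Two parametrised edges are equivalent as oriented edges if they differ by an orientation
preserving analytic reparametrisation of `[0,1]`. -/
def orientedSetoid : Setoid (AnalyticPath EM M) where
  r c c' := ∃ f g : ℝ → ℝ, IsReparam f g ∧ MonotoneOn f (Icc 0 1) ∧
    ∀ t ∈ Icc (0 : ℝ) 1, c' t = c (f t)
  iseqv :=
    { refl := fun c => ⟨id, id, IsReparam.id, monotone_id.monotoneOn _, fun _ _ => rfl⟩
      symm := by
        rintro c c' ⟨f, g, h, hf, hc⟩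
        exact ⟨g, f, h.symm, h.monotoneOn_symm hf, fun t ht => by
          rw [hc _ (h.mapsTo_inv ht), h.right_inv t ht]⟩
      trans := by
        rintro c c' c'' ⟨f, g, h, hf, hc⟩ ⟨f', g', h', hf', hc'⟩
        exact ⟨f ∘ f', g' ∘ g, h.comp h', hf.comp hf' h'.mapsTo_fun, fun t ht => by
          rw [hc' t ht, hc _ (h'.mapsTo_fun ht)]; rfl⟩ }

/-- Two parametrised edges are equivalent as unoriented edges if they differ by an arbitrary
analytic reparametrisation of `[0,1]`. -/
def unorientedSetoid : Setoid (AnalyticPath EM M) where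
  r c c' := ∃ f g : ℝ → ℝ, IsReparam f g ∧ ∀ t ∈ Icc (0 : ℝ) 1, c' t = c (f t)
  iseqv :=
    { refl := fun c => ⟨id, id, IsReparam.id, fun _ _ => rfl⟩
      symm := by
        rintro c c' ⟨f, g, h, hc⟩
        exact ⟨g, f, h.symm, fun t ht => by
          rw [hc _ (h.mapsTo_inv ht), h.right_inv t ht]⟩
      trans := by
        rintro c c' c'' ⟨f, g, h, hc⟩ ⟨f', g', h', hc'⟩
        exact ⟨f ∘ f', g' ∘ g, h.comp h', fun t ht => by
          rw [hc' t ht, hc _ (h'.mapsTo_fun ht)]; rfl⟩ }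

/-- Unparametrised oriented analytic edges in `M`. -/
def OEdge : Type _ := Quotient (orientedSetoid EM M)

/-- Unparametrised unoriented analytic edges in `M`. -/
def UEdge : Type _ := Quotient (unorientedSetoid EM M)

variable {EM M}

/-- The oriented edge of a path. -/
def AnalyticPath.toOEdge (c : AnalyticPath EM M) : OEdge EM M :=
  Quotient.mk (orientedSetoid EM M) c

/-- The unoriented edge of a path. -/
def AnalyticPath.toUEdge (c : AnalyticPath EM M) : UEdge EM M :=
  Quotient.mk (unorientedSetoid EM M) c

namespace OEdge

/-- The initial point `e₋` of an oriented edge. -/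
def source (e : OEdge EM M) : M :=
  Quotient.lift (s := orientedSetoid EM M) (fun c : AnalyticPath EM M => c 0) (by
    rintro c c' ⟨f, g, h, hf, hc⟩
    have := hc 0 (by simp)
    rw [h.map_zero hf] at this
    exact this.symm) e

/-- The final point `e₊` of an oriented edge. -/
def target (e : OEdge EM M) : M :=
  Quotient.lift (s := orientedSetoid EM M) (fun c : AnalyticPath EM M => c 1) (by
    rintro c c' ⟨f, g, h, hf, hc⟩
    have := hc 1 (by simp)
    rw [h.map_one hf] at this
    exact this.symm) e

/-- `e'` is the edge `e⁻¹` obtained from `e` by inverting the orientation. -/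
def IsInverse (e e' : OEdge EM M) : Prop :=
  ∃ c : AnalyticPath EM M, e = c.toOEdge ∧ e' = c.reverse.toOEdge

/-- `e` is the analytic edge `e₂ ∘ e₁` obtained by gluing `e₁` and (then) `e₂`. -/
def IsComposition (e₁ e₂ e : OEdge EM M) : Prop :=
  ∃ (c : AnalyticPath EM M) (s : ℝ) (hs : s ∈ Ioo (0 : ℝ) 1),
    e = c.toOEdge ∧ e₁ = (c.initialPart s hs).toOEdge ∧ e₂ = (c.finalPart s hs).toOEdge

/-- The edges which are finite products `e_k ∘ ⋯ ∘ e_1`, `k ≥ 1`, of oriented edges in `S`. -/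
inductive IsProduct (S : Set (OEdge EM M)) : OEdge EM M → Prop
  | of_mem (e : OEdge EM M) (he : e ∈ S) : IsProduct S e
  | comp (e₁ e₂ e : OEdge EM M) (h₁ : IsProduct S e₁) (h₂ : IsProduct S e₂)
      (h : IsComposition e₁ e₂ e) : IsProduct S e

end OEdge

variable (EM M)

/-- A (closed, unoriented) graph in `M`: a finite set of unparametrised analytic edges. -/
structure AnalyticGraph where
  /-- the edges -/
  edges : Set (UEdge EM M)
  finite : edges.Finite
  /-- every edge is an embedded copy of `[0,1]` -/
  embedded : ∀ c : AnalyticPath EM M, c.toUEdge ∈ edges → InjOn c (Icc 0 1)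
  /-- different edges meet only in common end points -/
  inter_subset : ∀ c c' : AnalyticPath EM M, c.toUEdge ∈ edges → c'.toUEdge ∈ edges →
    c.toUEdge ≠ c'.toUEdge → c.image ∩ c'.image ⊆ c.ends ∩ c'.ends
  /-- every edge is at both ends connected with another edge -/
  closed : ∀ c : AnalyticPath EM M, c.toUEdge ∈ edges → ∀ v ∈ c.ends,
    ∃ c' : AnalyticPath EM M, c'.toUEdge ∈ edges ∧ c'.toUEdge ≠ c.toUEdge ∧ v ∈ c'.ends

variable {EM M}

namespace AnalyticGraph

/-- The edges of a graph with all their orientations. -/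
def orientedEdges (γ : AnalyticGraph EM M) : Set (OEdge EM M) :=
  {e | ∃ c : AnalyticPath EM M, c.toUEdge ∈ γ.edges ∧ e = c.toOEdge}

/-- The vertices of a graph. -/
def vertices (γ : AnalyticGraph EM M) : Set M :=
  {v | ∃ c : AnalyticPath EM M, c.toUEdge ∈ γ.edges ∧ v ∈ c.ends}

/-- The graph `γ` contains the oriented edge `e` as a product of its edges, for some choice of
their orientations. -/
def Contains (γ : AnalyticGraph EM M) (e : OEdge EM M) : Prop :=
  OEdge.IsProduct γ.orientedEdges e

/-- `γ ≤ γ'` if each edge of `γ` is a composition of edges of `γ'` and each vertex of `γ` is a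
vertex of `γ'`. -/
instance : LE (AnalyticGraph EM M) where
  le γ γ' := (∀ e ∈ γ.orientedEdges, γ'.Contains e) ∧ γ.vertices ⊆ γ'.vertices

end AnalyticGraph

end Edges

/-! ## Principal bundles, connections, gauge transformations -/

section Bundles

variable (EM : Type*) [NormedAddCommGroup EM] [NormedSpace ℝ EM]
  (EG : Type*) [NormedAddCommGroup EG] [NormedSpace ℝ EG]
  (EP : Type*) [NormedAddCommGroup EP] [NormedSpace ℝ EP]
  (M : Type*) [TopologicalSpace M] [ChartedSpace EM M]
  (G : Type*) [TopologicalSpace G] [ChartedSpace EG G] [Group G]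
  (P : Type*) [TopologicalSpace P] [ChartedSpace EP P]

/-- A smooth principal fibre bundle with base `M`, structure group `G` and total space `P`. -/
structure PrincipalBundle where
  /-- the projection -/
  proj : P → M
  /-- the right action of the structure group -/
  act : P → G → P
  act_one : ∀ p, act p 1 = p
  act_mul : ∀ p g h, act p (g * h) = act (act p g) h
  proj_act : ∀ p g, proj (act p g) = proj p
  contMDiff_proj : ContMDiff 𝓘(ℝ, EP) 𝓘(ℝ, EM) ∞ proj
  contMDiff_act : ContMDiff (𝓘(ℝ, EP).prod 𝓘(ℝ, EG)) 𝓘(ℝ, EP) ∞ (fun x : P × G => act x.1 x.2)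
  /-- near every point of the base there is an equivariant smooth trivialisation -/
  locally_trivial : ∀ x : M, ∃ τ : Bundle.Trivialization G proj, x ∈ τ.baseSet ∧
    ContMDiffOn 𝓘(ℝ, EP) (𝓘(ℝ, EM).prod 𝓘(ℝ, EG)) ∞ τ τ.source ∧
    ContMDiffOn (𝓘(ℝ, EM).prod 𝓘(ℝ, EG)) 𝓘(ℝ, EP) ∞ τ.toOpenPartialHomeomorph.symm τ.target ∧
    ∀ p ∈ τ.source, ∀ g : G, (τ (act p g)).2 = (τ p).2 * g

variable {EM EG EP M G P} [IsManifold 𝓘(ℝ, EP) ∞ P]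

namespace PrincipalBundle

/-- The fibre of the bundle over a point. -/
def Fibre (B : PrincipalBundle EM EG EP M G P) (x : M) : Type _ := {p : P // B.proj p = x}

/-- The structure group acts on each fibre. -/
def fibreAct (B : PrincipalBundle EM EG EP M G P) {x : M} (p : B.Fibre x) (g : G) : B.Fibre x :=
  ⟨B.act p.1 g, (B.proj_act p.1 g).trans p.2⟩

/-- An isomorphism between two fibres: an equivariant bijection. -/
structure FibreIso (B : PrincipalBundle EM EG EP M G P) (x y : M) where
  /-- the underlying bijection -/
  toEquiv : B.Fibre x ≃ B.Fibre y
  equivariant : ∀ p g, toEquiv (B.fibreAct p g) = B.fibreAct (toEquiv p) g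

/-- A smooth (principal) connection, given by its horizontal projection: a smooth,
`G`-equivariant field of endomorphisms of the tangent spaces of the total space, each of which has
the vertical space as its kernel and projects onto a complement of it. -/
structure Connection (B : PrincipalBundle EM EG EP M G P) where
  /-- the horizontal projection -/
  hor : ∀ p : P, TangentSpace 𝓘(ℝ, EP) p →L[ℝ] TangentSpace 𝓘(ℝ, EP) p
  contMDiff_hor : ContMDiff 𝓘(ℝ, EP).tangent 𝓘(ℝ, EP).tangent ∞
    (fun v : TangentBundle 𝓘(ℝ, EP) P => (⟨v.1, hor v.1 v.2⟩ : TangentBundle 𝓘(ℝ, EP) P))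
  mfderiv_proj_hor : ∀ p v, mfderiv 𝓘(ℝ, EP) 𝓘(ℝ, EM) B.proj p (hor p v) =
    mfderiv 𝓘(ℝ, EP) 𝓘(ℝ, EM) B.proj p v
  hor_vertical : ∀ p v, mfderiv 𝓘(ℝ, EP) 𝓘(ℝ, EM) B.proj p v = 0 → hor p v = 0
  hor_act : ∀ p g v, hor (B.act p g) (mfderiv 𝓘(ℝ, EP) 𝓘(ℝ, EP) (fun q => B.act q g) p v) =
    mfderiv 𝓘(ℝ, EP) 𝓘(ℝ, EP) (fun q => B.act q g) p (hor p v)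

/-- A smooth vertical automorphism (gauge transformation) of the bundle. -/
structure Gauge (B : PrincipalBundle EM EG EP M G P) where
  /-- the underlying diffeomorphism of the total space -/
  toDiffeo : P ≃ₘ^∞⟮𝓘(ℝ, EP), 𝓘(ℝ, EP)⟯ P
  proj_eq : ∀ p, B.proj (toDiffeo p) = B.proj p
  equivariant : ∀ p g, toDiffeo (B.act p g) = B.act (toDiffeo p) g

/-- `u : [0,1] → P` is a horizontal lift of the path `c`. -/
structure IsHorizontalLift {B : PrincipalBundle EM EG EP M G P} (A : B.Connection)
    (c : AnalyticPath EM M) (u : ℝ → P) : Prop where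
  contMDiffOn : ContMDiffOn 𝓘(ℝ, ℝ) 𝓘(ℝ, EP) 1 u (Icc 0 1)
  proj_eq : ∀ t ∈ Icc (0 : ℝ) 1, B.proj (u t) = c t
  horizontal : ∀ t ∈ Icc (0 : ℝ) 1,
    A.hor (u t) (mfderivWithin 𝓘(ℝ, ℝ) 𝓘(ℝ, EP) u (Icc 0 1) t (1 : ℝ)) =
      mfderivWithin 𝓘(ℝ, ℝ) 𝓘(ℝ, EP) u (Icc 0 1) t (1 : ℝ)

/-- The parallel transport of `A` along the oriented edge `e` carries `p` to `q`. -/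
def Transports {B : PrincipalBundle EM EG EP M G P} (A : B.Connection) (e : OEdge EM M)
    (p q : P) : Prop :=
  ∃ (c : AnalyticPath EM M) (u : ℝ → P), c.toOEdge = e ∧ IsHorizontalLift A c u ∧
    u 0 = p ∧ u 1 = q

/-! ### The projective family -/

/-- The restrictions of `A` and `A'` to the bundle `B_e` over the unoriented edge `e` are related
by a gauge transformation `g` which is the identity in the fibres over the end points of `e`: the
transform of `A` by `g` and `A'` agree on all vectors tangent to `B_e`. -/
def EdgeEquiv (B : PrincipalBundle EM EG EP M G P) (e : UEdge EM M) (A A' : B.Connection) : Prop :=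
  ∃ g : B.Gauge, ∀ c : AnalyticPath EM M, c.toUEdge = e →
    (∀ p, B.proj p ∈ c.ends → g.toDiffeo p = p) ∧
    ∀ t ∈ Icc (0 : ℝ) 1, ∀ p : P, B.proj p = c t → ∀ v : TangentSpace 𝓘(ℝ, EP) p,
      (∃ r : ℝ, (mfderiv 𝓘(ℝ, EP) 𝓘(ℝ, EM) B.proj p v : EM) = r • (c.velocity t : EM)) →
      A'.hor (g.toDiffeo p) (mfderiv 𝓘(ℝ, EP) 𝓘(ℝ, EP) g.toDiffeo p v) =
        mfderiv 𝓘(ℝ, EP) 𝓘(ℝ, EP) g.toDiffeo p (A.hor p v)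

/-- The space `𝒜_e` of connections restricted to `e`, up to gauge transformations which are the
identity over the end points of `e`. -/
def EdgeConn (B : PrincipalBundle EM EG EP M G P) (e : UEdge EM M) : Type _ :=
  Quot (B.EdgeEquiv e)

/-- The space `𝒜_γ`, the product of the spaces `𝒜_e` over the edges `e` of `γ`. -/
def GraphConn (B : PrincipalBundle EM EG EP M G P) (γ : AnalyticGraph EM M) : Type _ :=
  ∀ e : γ.edges, B.EdgeConn e.1

/-- The natural map `π_γ : 𝒜 → 𝒜_γ`. -/
def toGraphConn (B : PrincipalBundle EM EG EP M G P) (γ : AnalyticGraph EM M)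
    (A : B.Connection) : B.GraphConn γ :=
  fun e => Quot.mk (B.EdgeEquiv e.1) A

/-- `p : 𝒜_γ' → 𝒜_γ` is the projection of the projective family: `π_γ = p ∘ π_γ'`. -/
def IsProjection (B : PrincipalBundle EM EG EP M G P) (γ γ' : AnalyticGraph EM M)
    (p : B.GraphConn γ' → B.GraphConn γ) : Prop :=
  ∀ A : B.Connection, B.toGraphConn γ A = p (B.toGraphConn γ' A)

/-- The projective limit of the spaces `𝒜_γ`. -/
def ProjLimit (B : PrincipalBundle EM EG EP M G P) : Type _ :=
  {x : ∀ γ : AnalyticGraph EM M, B.GraphConn γ //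
    ∀ γ γ' : AnalyticGraph EM M, γ ≤ γ' → ∃ p, B.IsProjection γ γ' p ∧ p (x γ') = x γ}

/-- The isomorphism `F` is the parallel transport `H(x, e)` along `e` defined by the point `x` of
`𝒜_γ`, i.e. the parallel transport of any connection which represents `x`. -/
def IsGraphTransport (B : PrincipalBundle EM EG EP M G P) {γ : AnalyticGraph EM M}
    (x : B.GraphConn γ) (e : OEdge EM M) (F : B.FibreIso e.source e.target) : Prop :=
  (∃ A : B.Connection, B.toGraphConn γ A = x) ∧
    ∀ A : B.Connection, B.toGraphConn γ A = x →
      ∀ p : B.Fibre e.source, Transports A e p.1 (F.toEquiv p).1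

/-! ### Generalised parallel transports -/

/-- A generalised parallel transport: an isomorphism `I(e)` from the fibre over the initial point
to the fibre over the final point of each oriented edge `e`, with `I(e⁻¹) = I(e)⁻¹` and
`I(e₂ ∘ e₁) = I(e₂) ∘ I(e₁)` whenever `e₂ ∘ e₁` is again an analytic edge. -/
structure GenTransport (B : PrincipalBundle EM EG EP M G P) where
  /-- the isomorphism assigned to an edge -/
  iso : ∀ e : OEdge EM M, B.FibreIso e.source e.target
  iso_inverse : ∀ e e' : OEdge EM M, e.IsInverse e' →
    ∀ (p : B.Fibre e.source) (q : B.Fibre e'.source),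
      q.1 = ((iso e).toEquiv p).1 → ((iso e').toEquiv q).1 = p.1
  iso_comp : ∀ e₁ e₂ e : OEdge EM M, OEdge.IsComposition e₁ e₂ e →
    ∀ (p₁ : B.Fibre e₁.source) (p₂ : B.Fibre e₂.source) (p : B.Fibre e.source),
      p.1 = p₁.1 → p₂.1 = ((iso e₁).toEquiv p₁).1 →
        ((iso e).toEquiv p).1 = ((iso e₂).toEquiv p₂).1

end PrincipalBundle

end Bundles

/-! The proof identifies every `GraphConn γ` with a space of parallel transports along the edges of
`γ`, and then uses that graphs form a directed system in which every edge occurs.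

On one embedded edge, the class of a connection is the same datum as its parallel transport
(`quot_mk_eq_iff`). A gauge transformation which is trivial over the end points carries horizontal
lifts to horizontal lifts with the same ends. Conversely, let two connections have equal transport,
and let `u`, `v` be horizontal lifts of the edge for them with a common starting point. Gauge
transformations supported in trivialisations, composed along a subdivision of the edge, carry `u` to
`v`. Since the final points agree too, equivariance makes the result the identity over both end
points, and it matches the horizontal spaces because these are spanned, modulo the vertical
directions of no interest here, by translates of the velocities of `u` and `v`.

The transports along the edges of a graph can be prescribed independently
(`exists_connection_transport_rep`). The connection is changed only near the middle of one edge,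
away from the edges already treated: there it is made flat, and its horizontal section is twisted by
a smooth path in `G` from 1 to the required element. Such a path exists because `G` is connected.
Hence connections map onto every `GraphConn γ`. As transport along a product is the composite of the
transports, the projections exist, and surjectivity makes them unique.

Every finite set of edges is contained in one graph (`exists_graph_contains`). An analytic immersed
path is a finite product of embedded ones. By analyticity, the times at which one path runs inside
an embedded edge form a set with finitely many frontier points (`AnalyticPath.finite_frontier`);
cutting at these and at all end points leaves pieces which coincide or meet only in end points. A
vertex lying on one edge only is repaired by attaching two arcs with common ends, in a direction
tangent to no edge there; this needs dimension at least 2 (`IsPregraph.exists_bigon`).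

Consequently any two graphs have an upper bound, so a point of the projective limit assigns to an
edge a transport independent of the graph. The laws for inverses and compositions hold because each
involves finitely many edges, hence one graph and one genuine connection. Injectivity holds since
transports along the edges of `γ` determine the point of `GraphConn γ`. For surjectivity, a
generalised transport is realised on each graph by a connection, and the resulting classes are
compatible. -/

open Filter Topology

/-! ## Velocities of curves in manifolds -/

section Velocity

variable {E : Type*} [NormedAddCommGroup E] [NormedSpace ℝ E]
  {N : Type*} [TopologicalSpace N] [ChartedSpace E N]
  {E' : Type*} [NormedAddCommGroup E'] [NormedSpace ℝ E']
  {N' : Type*} [TopologicalSpace N'] [ChartedSpace E' N']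
  {E'' : Type*} [NormedAddCommGroup E''] [NormedSpace ℝ E'']
  {N'' : Type*} [TopologicalSpace N''] [ChartedSpace E'' N'']

variable (E E') in
/-- The differential of a map of manifolds, as a map of the model spaces. -/
noncomputable def modelDeriv (F : N → N') (x : N) : E →L[ℝ] E' := mfderiv 𝓘(ℝ, E) 𝓘(ℝ, E') F x

variable (E) in
/-- The velocity of a curve, as a vector of the model space. -/
noncomputable def velWithin (u : ℝ → N) (S : Set ℝ) (t : ℝ) : E :=
  (mfderivWithin 𝓘(ℝ, ℝ) 𝓘(ℝ, E) u S t : ℝ →L[ℝ] E) 1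

/-- The curve `u` has the velocity vector `w` at time `t`, within the set of times `S`. -/
def HasVelWithinAt (u : ℝ → N) (w : E) (S : Set ℝ) (t : ℝ) : Prop :=
  HasMFDerivWithinAt 𝓘(ℝ, ℝ) 𝓘(ℝ, E) u S t (ContinuousLinearMap.toSpanSingleton ℝ w : ℝ →L[ℝ] E)

namespace HasVelWithinAt

variable {u v : ℝ → N} {w w' : E} {S S' : Set ℝ} {t : ℝ}

theorem mono (h : HasVelWithinAt u w S t) (hS : S' ⊆ S) : HasVelWithinAt u w S' t :=
  HasMFDerivWithinAt.mono h hS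

theorem mono_of_mem (h : HasVelWithinAt u w S t) (hS : S ∈ 𝓝[S'] t) : HasVelWithinAt u w S' t :=
  HasMFDerivWithinAt.mono_of_mem_nhdsWithin h hS

theorem congr (h : HasVelWithinAt u w S t) (huv : v =ᶠ[𝓝[S] t] u) (ht : v t = u t) :
    HasVelWithinAt v w S t :=
  HasMFDerivWithinAt.congr_of_eventuallyEq h huv ht

theorem continuousWithinAt (h : HasVelWithinAt u w S t) : ContinuousWithinAt u S t :=
  HasMFDerivWithinAt.continuousWithinAt h

theorem of_hasMFDerivWithinAt {L : ℝ →L[ℝ] E}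
    (h : HasMFDerivWithinAt 𝓘(ℝ, ℝ) 𝓘(ℝ, E) u S t L) : HasVelWithinAt u (L 1) S t := by
  have : L = ContinuousLinearMap.toSpanSingleton ℝ (L 1) := by
    ext; simp
  unfold HasVelWithinAt
  rw [← this]
  exact h

theorem unique (h : HasVelWithinAt u w S t) (h' : HasVelWithinAt u w' S t)
    (hS : UniqueDiffWithinAt ℝ S t) : w = w' := by
  have h1 : (ContinuousLinearMap.toSpanSingleton ℝ w : ℝ →L[ℝ] E) =
      ContinuousLinearMap.toSpanSingleton ℝ w' := hS.uniqueMDiffWithinAt.eq h h'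
  have := DFunLike.congr_fun h1 (1 : ℝ)
  simpa using this

theorem velWithin_eq (h : HasVelWithinAt u w S t) (hS : UniqueDiffWithinAt ℝ S t) :
    velWithin E u S t = w := by
  have h1 : (mfderivWithin 𝓘(ℝ, ℝ) 𝓘(ℝ, E) u S t : ℝ →L[ℝ] E) =
      ContinuousLinearMap.toSpanSingleton ℝ w :=
    HasMFDerivWithinAt.mfderivWithin h hS.uniqueMDiffWithinAt
  have h2 : (ContinuousLinearMap.toSpanSingleton ℝ w : ℝ →L[ℝ] E) 1 = w := by simp
  exact (DFunLike.congr_fun h1 (1 : ℝ)).trans h2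

theorem of_mdifferentiableWithinAt (h : MDifferentiableWithinAt 𝓘(ℝ, ℝ) 𝓘(ℝ, E) u S t) :
    HasVelWithinAt u (velWithin E u S t) S t :=
  of_hasMFDerivWithinAt h.hasMFDerivWithinAt

theorem of_mdifferentiableAt (h : MDifferentiableAt 𝓘(ℝ, ℝ) 𝓘(ℝ, E) u t) :
    HasVelWithinAt u (modelDeriv ℝ E u t 1) S t :=
  of_hasMFDerivWithinAt h.hasMFDerivAt.hasMFDerivWithinAt

theorem comp_hasMFDerivAt {F : N → N'} {L : E →L[ℝ] E'} (h : HasVelWithinAt u w S t)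
    (hF : HasMFDerivAt 𝓘(ℝ, E) 𝓘(ℝ, E') F (u t) L) :
    HasVelWithinAt (fun r => F (u r)) (L w) S t := by
  have h1 := of_hasMFDerivWithinAt
    (L := L.comp (ContinuousLinearMap.toSpanSingleton ℝ w : ℝ →L[ℝ] E))
    (HasMFDerivAt.comp_hasMFDerivWithinAt t hF h)
  rw [ContinuousLinearMap.comp_apply, ContinuousLinearMap.toSpanSingleton_apply, one_smul] at h1
  exact h1

theorem comp {F : N → N'} (h : HasVelWithinAt u w S t)
    (hF : MDifferentiableAt 𝓘(ℝ, E) 𝓘(ℝ, E') F (u t)) :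
    HasVelWithinAt (fun r => F (u r)) (modelDeriv E E' F (u t) w) S t :=
  h.comp_hasMFDerivAt hF.hasMFDerivAt

theorem comp₂_hasMFDerivAt {F : N × N' → N''} {u' : ℝ → N'} {w' : E'} {L : E × E' →L[ℝ] E''}
    (h : HasVelWithinAt u w S t) (h' : HasVelWithinAt u' w' S t)
    (hF : HasMFDerivAt (𝓘(ℝ, E).prod 𝓘(ℝ, E')) 𝓘(ℝ, E'') F (u t, u' t) L) :
    HasVelWithinAt (fun r => F (u r, u' r)) (L (w, w')) S t := by
  have h1 := of_hasMFDerivWithinAt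
    (L := L.comp
      ((ContinuousLinearMap.toSpanSingleton ℝ w : ℝ →L[ℝ] E).prod
        (ContinuousLinearMap.toSpanSingleton ℝ w' : ℝ →L[ℝ] E')))
    (HasMFDerivAt.comp_hasMFDerivWithinAt t hF (HasMFDerivWithinAt.prodMk h h'))
  rw [ContinuousLinearMap.comp_apply, ContinuousLinearMap.prod_apply,
    ContinuousLinearMap.toSpanSingleton_apply, ContinuousLinearMap.toSpanSingleton_apply,
    one_smul, one_smul] at h1
  exact h1

/-- One linear map serves all pairs of curves through the given point. Two pairs with the same
velocities therefore have images with the same velocity, which permits comparing them without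
computing the derivative of `F`. -/
theorem exists_comp₂ {F : N × N' → N''} {x : N} {y : N'}
    (hF : MDifferentiableAt (𝓘(ℝ, E).prod 𝓘(ℝ, E')) 𝓘(ℝ, E'') F (x, y)) :
    ∃ L : E × E' →L[ℝ] E'', ∀ (u : ℝ → N) (u' : ℝ → N') (w : E) (w' : E') (S : Set ℝ) (t : ℝ),
      u t = x → u' t = y → HasVelWithinAt u w S t → HasVelWithinAt u' w' S t →
      HasVelWithinAt (fun r => F (u r, u' r)) (L (w, w')) S t := by
  refine ⟨mfderiv (𝓘(ℝ, E).prod 𝓘(ℝ, E')) 𝓘(ℝ, E'') F (x, y), ?_⟩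
  rintro u u' w w' S t rfl rfl h h'
  exact h.comp₂_hasMFDerivAt h' hF.hasMFDerivAt

theorem precomp {f : ℝ → ℝ} {r : ℝ} (h : HasVelWithinAt u w S (f t))
    (hf : HasDerivWithinAt f r S' t) (hS : MapsTo f S' S) :
    HasVelWithinAt (fun r => u (f r)) (r • w) S' t := by
  have h1 := of_hasMFDerivWithinAt
    (L := (ContinuousLinearMap.toSpanSingleton ℝ w : ℝ →L[ℝ] E).comp
      (ContinuousLinearMap.toSpanSingleton ℝ r : ℝ →L[ℝ] ℝ))
    (HasMFDerivWithinAt.comp t h hf.hasFDerivWithinAt.hasMFDerivWithinAt hS)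
  rw [ContinuousLinearMap.comp_apply, ContinuousLinearMap.toSpanSingleton_apply,
    ContinuousLinearMap.toSpanSingleton_apply, one_smul] at h1
  exact h1

theorem const (x : N) : HasVelWithinAt (fun _ => x) (0 : E) S t :=
  of_hasMFDerivWithinAt (L := 0) (hasMFDerivWithinAt_const (I := 𝓘(ℝ, ℝ)) (I' := 𝓘(ℝ, E)) x S t)

theorem iff_hasDerivWithinAt {u : ℝ → E} : HasVelWithinAt u w S t ↔ HasDerivWithinAt u w S t :=
  hasMFDerivWithinAt_iff_hasFDerivWithinAt

end HasVelWithinAt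

/-- A curve in a manifold whose velocity vanishes on a convex set of times is constant there. -/
theorem eqOn_of_hasVelWithinAt_zero [IsManifold 𝓘(ℝ, E) 1 N] {u : ℝ → N} {S : Set ℝ}
    (hS : Convex ℝ S) (h : ∀ t ∈ S, HasVelWithinAt u (0 : E) S t) {s t : ℝ} (hs : s ∈ S)
    (ht : t ∈ S) : u s = u t := by
  have hpre : IsPreconnected S := hS.isPreconnected
  -- Local constancy comes from the mean value inequality with bound 0, applied in a chart on a
  -- convex neighbourhood within `S`; connectedness of `S` then finishes the proof.
  have hloc : ∀ r ∈ S, ∀ᶠ r' in 𝓝[S] r, u r' = u r := by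
    intro r hr
    have hc : ∀ᶠ r' in 𝓝[S] r, u r' ∈ (chartAt E (u r)).source :=
      (h r hr).continuousWithinAt ((chartAt E (u r)).open_source.mem_nhds (mem_chart_source E _))
    obtain ⟨δ, hδ, hsub⟩ := Metric.mem_nhdsWithin_iff.1 hc
    have hconv : Convex ℝ (Metric.ball r δ ∩ S) := (convex_ball r δ).inter hS
    have hmem : Metric.ball r δ ∩ S ∈ 𝓝[S] r :=
      inter_mem (mem_nhdsWithin_of_mem_nhds (Metric.ball_mem_nhds r hδ)) self_mem_nhdsWithin
    filter_upwards [hmem] with r' hr'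
    have hr0 : r ∈ Metric.ball r δ ∩ S := ⟨Metric.mem_ball_self hδ, hr⟩
    have hd : ∀ x ∈ Metric.ball r δ ∩ S, HasFDerivWithinAt
        (fun x => extChartAt 𝓘(ℝ, E) (u r) (u x)) (0 : ℝ →L[ℝ] E) (Metric.ball r δ ∩ S) x := by
      intro x hx
      have h1 := ((h x hx.2).mono (inter_subset_right (s := Metric.ball r δ))).comp
        (mdifferentiableAt_extChartAt (I := 𝓘(ℝ, E)) (x := u r) (hsub hx))
      have h2 := (HasVelWithinAt.iff_hasDerivWithinAt.1 h1).hasFDerivWithinAt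
      rw [map_zero, ContinuousLinearMap.toSpanSingleton_zero] at h2
      exact h2
    have h3 := hconv.norm_image_sub_le_of_norm_hasFDerivWithin_le (C := 0) hd (by simp) hr0 hr'
    have h4 : extChartAt 𝓘(ℝ, E) (u r) (u r') = extChartAt 𝓘(ℝ, E) (u r) (u r) := by
      rw [← sub_eq_zero, ← norm_le_zero_iff]
      simpa using h3
    exact (extChartAt 𝓘(ℝ, E) (u r)).injOn (by rw [extChartAt_source]; exact hsub hr')
      (by rw [extChartAt_source]; exact hsub hr0) h4
  have : PreconnectedSpace S := isPreconnected_iff_preconnectedSpace.1 hpre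
  have hlc : IsLocallyConstant (fun x : S => u x) := by
    rw [IsLocallyConstant.iff_eventually_eq]
    intro x
    have := hloc x.1 x.2
    rw [← map_nhds_subtype_val x] at this
    exact this
  exact hlc.apply_eq_of_preconnectedSpace ⟨s, hs⟩ ⟨t, ht⟩

end Velocity

section ModelDeriv

variable {E : Type*} [NormedAddCommGroup E] [NormedSpace ℝ E]
  {N : Type*} [TopologicalSpace N] [ChartedSpace E N]
  {E' : Type*} [NormedAddCommGroup E'] [NormedSpace ℝ E']
  {N' : Type*} [TopologicalSpace N'] [ChartedSpace E' N']
  {E'' : Type*} [NormedAddCommGroup E''] [NormedSpace ℝ E'']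
  {N'' : Type*} [TopologicalSpace N''] [ChartedSpace E'' N'']

theorem modelDeriv_comp {F : N' → N''} {f : N → N'} {x : N}
    (hF : MDifferentiableAt 𝓘(ℝ, E') 𝓘(ℝ, E'') F (f x))
    (hf : MDifferentiableAt 𝓘(ℝ, E) 𝓘(ℝ, E') f x) (v : E) :
    modelDeriv E E'' (fun y => F (f y)) x v = modelDeriv E' E'' F (f x) (modelDeriv E E' f x v) := by
  have h : (mfderiv 𝓘(ℝ, E) 𝓘(ℝ, E'') (fun y => F (f y)) x : E →L[ℝ] E'') =
      (mfderiv 𝓘(ℝ, E') 𝓘(ℝ, E'') F (f x) : E' →L[ℝ] E'').comp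
        (mfderiv 𝓘(ℝ, E) 𝓘(ℝ, E') f x : E →L[ℝ] E') := mfderiv_comp x hF hf
  exact DFunLike.congr_fun h v

theorem modelDeriv_congr {F F' : N → N'} {x : N} (h : F =ᶠ[𝓝 x] F') :
    modelDeriv E E' F x = modelDeriv E E' F' x :=
  h.mfderiv_eq

theorem modelDeriv_id (x : N) (v : E) : modelDeriv E E (fun y : N => y) x v = v := by
  have h : (mfderiv 𝓘(ℝ, E) 𝓘(ℝ, E) (fun y : N => y) x : E →L[ℝ] E) =
      ContinuousLinearMap.id ℝ E := mfderiv_id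
  exact DFunLike.congr_fun h v

end ModelDeriv

/-! ### Smooth trivialisations, horizontal projections, and uniqueness of horizontal lifts. -/

namespace PrincipalBundle

variable {EM : Type*} [NormedAddCommGroup EM] [NormedSpace ℝ EM]
    {EG : Type*} [NormedAddCommGroup EG] [NormedSpace ℝ EG]
    {EP : Type*} [NormedAddCommGroup EP] [NormedSpace ℝ EP]
    {M : Type*} [TopologicalSpace M] [ChartedSpace EM M]
    {G : Type*} [TopologicalSpace G] [ChartedSpace EG G] [Group G]
    {P : Type*} [TopologicalSpace P] [ChartedSpace EP P]
    (B : PrincipalBundle EM EG EP M G P)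

/-- A local trivialisation of a principal bundle which is smooth and equivariant. -/
structure IsSmoothTriv (τ : Bundle.Trivialization G B.proj) : Prop where
  contMDiffOn : ContMDiffOn 𝓘(ℝ, EP) (𝓘(ℝ, EM).prod 𝓘(ℝ, EG)) ∞ τ τ.source
  contMDiffOn_symm : ContMDiffOn (𝓘(ℝ, EM).prod 𝓘(ℝ, EG)) 𝓘(ℝ, EP) ∞
    τ.toOpenPartialHomeomorph.symm τ.target
  map_act : ∀ p ∈ τ.source, ∀ g : G, (τ (B.act p g)).2 = (τ p).2 * g

theorem exists_smoothTriv (x : M) :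
    ∃ τ : Bundle.Trivialization G B.proj, x ∈ τ.baseSet ∧ B.IsSmoothTriv τ := by
  obtain ⟨τ, hx, h1, h2, h3⟩ := B.locally_trivial x
  exact ⟨τ, hx, h1, h2, h3⟩

variable {B}

namespace IsSmoothTriv

variable {τ : Bundle.Trivialization G B.proj}

theorem contMDiffAt_snd (hτ : B.IsSmoothTriv τ) {p : P} (hp : B.proj p ∈ τ.baseSet) :
    ContMDiffAt 𝓘(ℝ, EP) 𝓘(ℝ, EG) ∞ (fun q => (τ q).2) p :=
  _root_.contMDiffAt_snd.comp p (hτ.contMDiffOn.contMDiffAt (τ.open_source.mem_nhds (τ.mem_source.2 hp)))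

theorem contMDiffAt_symm (hτ : B.IsSmoothTriv τ) {x : M} (hx : x ∈ τ.baseSet) (g : G) :
    ContMDiffAt (𝓘(ℝ, EM).prod 𝓘(ℝ, EG)) 𝓘(ℝ, EP) ∞ τ.toOpenPartialHomeomorph.symm (x, g) :=
  hτ.contMDiffOn_symm.contMDiffAt (τ.open_target.mem_nhds (τ.mem_target.2 hx))

theorem eq_of_snd_eq {p q : P} (hp : B.proj p ∈ τ.baseSet) (h : B.proj p = B.proj q)
    (h2 : (τ p).2 = (τ q).2) : p = q := by
  have hq : B.proj q ∈ τ.baseSet := h ▸ hp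
  refine τ.injOn (τ.mem_source.2 hp) (τ.mem_source.2 hq) (Prod.ext ?_ h2)
  exact (τ.coe_fst (τ.mem_source.2 hp)).trans (h.trans (τ.coe_fst (τ.mem_source.2 hq)).symm)

end IsSmoothTriv

theorem exists_act_eq {p q : P} (h : B.proj p = B.proj q) : ∃ g, B.act p g = q := by
  obtain ⟨τ, hx, hτ⟩ := B.exists_smoothTriv (B.proj p)
  refine ⟨(τ p).2⁻¹ * (τ q).2, IsSmoothTriv.eq_of_snd_eq (τ := τ) ?_ ?_ ?_⟩
  · rwa [B.proj_act]
  · rw [B.proj_act, h]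
  · rw [hτ.map_act _ (τ.mem_source.2 hx)]; group

theorem act_right_cancel {p : P} {g h : G} (hgh : B.act p g = B.act p h) : g = h := by
  obtain ⟨τ, hx, hτ⟩ := B.exists_smoothTriv (B.proj p)
  have := congrArg (fun q => (τ q).2) hgh
  simpa [hτ.map_act _ (τ.mem_source.2 hx)] using this

theorem contMDiff_act_right (g : G) :
    ContMDiff 𝓘(ℝ, EP) 𝓘(ℝ, EP) ∞ (fun p => B.act p g) :=
  B.contMDiff_act.comp (contMDiff_id.prodMk contMDiff_const)

theorem mdifferentiableAt_act_right (g : G) (p : P) :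
    MDifferentiableAt 𝓘(ℝ, EP) 𝓘(ℝ, EP) (fun p => B.act p g) p :=
  (contMDiff_act_right g).mdifferentiable (by simp) p

theorem mdifferentiableAt_proj (p : P) : MDifferentiableAt 𝓘(ℝ, EP) 𝓘(ℝ, EM) B.proj p :=
  B.contMDiff_proj.mdifferentiable (by simp) p

theorem modelDeriv_proj_act (p : P) (g : G) (v : EP) :
    modelDeriv EP EM B.proj (B.act p g) (modelDeriv EP EP (fun q => B.act q g) p v) =
      modelDeriv EP EM B.proj p v := by
  rw [← modelDeriv_comp (mdifferentiableAt_proj _) (mdifferentiableAt_act_right g p)]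
  congr 2
  funext q
  exact B.proj_act q g

variable [IsManifold 𝓘(ℝ, EP) ∞ P]

namespace Connection

/-- The horizontal projection, as an endomorphism of the model space. -/
noncomputable def horL (A : B.Connection) (p : P) : EP →L[ℝ] EP := A.hor p

variable (A : B.Connection)

theorem modelDeriv_proj_horL (p : P) (v : EP) :
    modelDeriv EP EM B.proj p (A.horL p v) = modelDeriv EP EM B.proj p v :=
  A.mfderiv_proj_hor p v

theorem horL_vertical {p : P} {v : EP} (h : modelDeriv EP EM B.proj p v = 0) :
    A.horL p v = 0 :=
  A.hor_vertical p v h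

theorem horL_act (p : P) (g : G) (v : EP) :
    A.horL (B.act p g) (modelDeriv EP EP (fun q => B.act q g) p v) =
      modelDeriv EP EP (fun q => B.act q g) p (A.horL p v) :=
  A.hor_act p g v

/-- The difference of the vectors is vertical, hence killed. Horizontal vectors are thus compared
through their projections to the base, which is how all identities between horizontal velocities are
obtained. -/
theorem horL_eq_of_proj_eq {p : P} {v w : EP}
    (h : modelDeriv EP EM B.proj p v = modelDeriv EP EM B.proj p w) :
    A.horL p v = A.horL p w := by
  rw [← sub_eq_zero, ← map_sub]
  exact A.horL_vertical (by rw [map_sub, h, sub_self])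

end Connection

/-- `u` is a horizontal lift of the curve `c` over the set of times `S`. -/
structure IsLiftOn (A : B.Connection) (c : ℝ → M) (u : ℝ → P) (S : Set ℝ) : Prop where
  proj_eq : ∀ t ∈ S, B.proj (u t) = c t
  exists_vel : ∀ t ∈ S, ∃ w : EP, HasVelWithinAt u w S t ∧ A.horL (u t) w = w

namespace IsLiftOn

variable {A : B.Connection} {c : ℝ → M} {u v : ℝ → P} {S S' : Set ℝ}

theorem mono (h : IsLiftOn A c u S) (hS : S' ⊆ S) : IsLiftOn A c u S' where
  proj_eq t ht := h.proj_eq t (hS ht)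
  exists_vel t ht := by
    obtain ⟨w, h1, h2⟩ := h.exists_vel t (hS ht)
    exact ⟨w, h1.mono hS, h2⟩

theorem act (h : IsLiftOn A c u S) (g : G) : IsLiftOn A c (fun t => B.act (u t) g) S where
  proj_eq t ht := (B.proj_act _ _).trans (h.proj_eq t ht)
  exists_vel t ht := by
    obtain ⟨w, h1, h2⟩ := h.exists_vel t ht
    exact ⟨_, h1.comp (mdifferentiableAt_act_right g _), by rw [A.horL_act, h2]⟩

theorem congr (h : IsLiftOn A c u S) (huv : EqOn v u S) : IsLiftOn A c v S where
  proj_eq t ht := by rw [huv ht, h.proj_eq t ht]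
  exists_vel t ht := by
    obtain ⟨w, h1, h2⟩ := h.exists_vel t ht
    exact ⟨w, h1.congr (eventually_mem_nhdsWithin.mono huv) (huv ht), by rw [huv ht]; exact h2⟩

theorem precomp (h : IsLiftOn A c u S) {f : ℝ → ℝ} {c' : ℝ → M} (hf : MapsTo f S' S)
    (hd : DifferentiableOn ℝ f S') (hc : ∀ t ∈ S', c' t = c (f t)) :
    IsLiftOn A c' (fun t => u (f t)) S' where
  proj_eq t ht := by rw [h.proj_eq _ (hf ht), hc t ht]
  exists_vel t ht := by
    obtain ⟨w, h1, h2⟩ := h.exists_vel _ (hf ht)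
    exact ⟨_, h1.precomp (hd t ht).hasDerivWithinAt hf, by rw [map_smul, h2]⟩

variable [LieGroup 𝓘(ℝ, EG) ∞ G]

/-- Translate `u` by the element `g` with `u t * g = v t`. The translated lift and `v` pass through
the same point with horizontal velocities over the same base velocity, so these velocities agree.
The quotient of `u` and `v` then has the same velocity at `t` as the quotient of `u` and its
translate, which is the constant `g`. -/
theorem hasVelWithinAt_div {τ : Bundle.Trivialization G B.proj} (hτ : B.IsSmoothTriv τ)
    (hu : IsLiftOn A c u S) (hv : IsLiftOn A c v S) {t : ℝ} (ht : t ∈ S)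
    (hS : UniqueDiffWithinAt ℝ S t) (hct : c t ∈ τ.baseSet) :
    HasVelWithinAt (fun r => (τ (u r)).2⁻¹ * (τ (v r)).2) (0 : EG) S t := by
  obtain ⟨g, hg⟩ : ∃ g, B.act (u t) g = v t :=
    exists_act_eq ((hu.proj_eq t ht).trans (hv.proj_eq t ht).symm)
  obtain ⟨α, hα, hαh⟩ := hu.exists_vel t ht
  obtain ⟨β, hβ, hβh⟩ := hv.exists_vel t ht
  have hα' := hα.comp (mdifferentiableAt_act_right (B := B) g (u t))
  have hαβ : modelDeriv EP EP (fun q => B.act q g) (u t) α = β := by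
    rw [← hαh, ← A.horL_act, ← hβh, hg]
    apply A.horL_eq_of_proj_eq
    have h1 := hα.comp (mdifferentiableAt_proj (B := B) (u t))
    have h2 := hβ.comp (mdifferentiableAt_proj (B := B) (v t))
    rw [← hg, modelDeriv_proj_act, hg]
    refine (h1.congr ?_ ?_).unique h2 hS
    · filter_upwards [eventually_mem_nhdsWithin] with r hr
      rw [hu.proj_eq r hr, hv.proj_eq r hr]
    · rw [hu.proj_eq t ht, hv.proj_eq t ht]
  rw [hαβ] at hα'
  have hut : B.proj (u t) ∈ τ.baseSet := by rwa [hu.proj_eq t ht]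
  have hvt : B.proj (v t) ∈ τ.baseSet := by rwa [hv.proj_eq t ht]
  have hF : MDifferentiableAt (𝓘(ℝ, EP).prod 𝓘(ℝ, EP)) 𝓘(ℝ, EG)
      (fun x : P × P => (τ x.1).2⁻¹ * (τ x.2).2) (u t, v t) := by
    refine ContMDiffAt.mdifferentiableAt (n := ∞) ?_ (by simp)
    refine ContMDiffAt.mul (ContMDiffAt.inv ?_) ?_
    · exact ContMDiffAt.comp (g := fun q => (τ q).2) (u t, v t) (hτ.contMDiffAt_snd hut)
        contMDiffAt_fst
    · exact ContMDiffAt.comp (g := fun q => (τ q).2) (u t, v t) (hτ.contMDiffAt_snd hvt)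
        contMDiffAt_snd
  obtain ⟨L, hL⟩ := HasVelWithinAt.exists_comp₂ hF
  have h1 := hL _ _ _ _ S t rfl rfl hα hβ
  have h2 := hL _ _ _ _ S t rfl hg hα hα'
  have h3 : HasVelWithinAt (fun r => (τ (u r)).2⁻¹ * (τ (B.act (u r) g)).2) (0 : EG) S t := by
    have hmem : ∀ᶠ r in 𝓝[S] t, u r ∈ τ.source :=
      hα.continuousWithinAt (τ.open_source.mem_nhds (τ.mem_source.2 hut))
    refine (HasVelWithinAt.const g).congr ?_ ?_
    · filter_upwards [hmem] with r hr
      rw [hτ.map_act _ hr]; group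
    · rw [hτ.map_act _ (τ.mem_source.2 hut)]; group
  have h4 : L (α, β) = 0 := h2.unique h3 hS
  rwa [h4] at h1

/-- Two horizontal lifts of the same curve differ by a constant element of the structure group. -/
theorem exists_act (hS : Convex ℝ S) (hS' : UniqueDiffOn ℝ S) (hu : IsLiftOn A c u S)
    (hv : IsLiftOn A c v S) : ∃ g : G, ∀ t ∈ S, v t = B.act (u t) g := by
  have hex : ∀ t, ∃ g : G, t ∈ S → B.act (u t) g = v t := by
    intro t
    by_cases ht : t ∈ S
    · obtain ⟨g, hg⟩ := exists_act_eq ((hu.proj_eq t ht).trans (hv.proj_eq t ht).symm)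
      exact ⟨g, fun _ => hg⟩
    · exact ⟨1, fun h => absurd h ht⟩
  choose D hD using hex
  -- The displacement `D` is defined without a trivialisation, but in each one it is locally the
  -- quotient of the group coordinates.
  have hvel : ∀ t ∈ S, HasVelWithinAt D (0 : EG) S t := by
    intro t ht
    obtain ⟨τ, hx, hτ⟩ := B.exists_smoothTriv (c t)
    have hut : B.proj (u t) ∈ τ.baseSet := by rwa [hu.proj_eq t ht]
    have hDeq : ∀ r ∈ S, u r ∈ τ.source → D r = (τ (u r)).2⁻¹ * (τ (v r)).2 := by
      intro r hr hur
      rw [← hD r hr, hτ.map_act _ hur]; group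
    obtain ⟨α, hα, -⟩ := hu.exists_vel t ht
    have hmem : ∀ᶠ r in 𝓝[S] t, u r ∈ τ.source :=
      hα.continuousWithinAt (τ.open_source.mem_nhds (τ.mem_source.2 hut))
    refine (hasVelWithinAt_div hτ hu hv ht (hS' t ht) hx).congr ?_ ?_
    · filter_upwards [hmem, eventually_mem_nhdsWithin] with r hr hr'
      exact hDeq r hr' hr
    · exact hDeq t ht (τ.mem_source.2 hut)
  have : IsManifold 𝓘(ℝ, EG) 1 G := by
    have : IsManifold 𝓘(ℝ, EG) ∞ G := LieGroup.toContMDiffMul.toIsManifold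
    infer_instance
  rcases S.eq_empty_or_nonempty with rfl | ⟨s, hs⟩
  · exact ⟨1, by simp⟩
  · refine ⟨D s, fun t ht => ?_⟩
    rw [← hD t ht, eqOn_of_hasVelWithinAt_zero hS hvel hs ht]

theorem eqOn (hS : Convex ℝ S) (hS' : UniqueDiffOn ℝ S) (hu : IsLiftOn A c u S)
    (hv : IsLiftOn A c v S) {t : ℝ} (ht : t ∈ S) (h : u t = v t) : EqOn u v S := by
  obtain ⟨g, hg⟩ := exists_act hS hS' hu hv
  have h1 : g = 1 := act_right_cancel (B := B) (p := u t) (by rw [← hg t ht, B.act_one, h])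
  intro s hs
  rw [hg s hs, h1, B.act_one]

end IsLiftOn

end PrincipalBundle

/-! ## Local existence of horizontal lifts -/

/-- The solutions of a smooth autonomous differential equation are smooth. -/
theorem contDiffOn_of_hasDerivAt_of_contDiffOn {E : Type*} [NormedAddCommGroup E]
    [NormedSpace ℝ E] {X : E → E} {Ω : Set E} (hX : ContDiffOn ℝ ∞ X Ω) {α : ℝ → E} {J : Set ℝ}
    (hJ : IsOpen J) (hα : MapsTo α J Ω) (h : ∀ t ∈ J, HasDerivAt α (X (α t)) t) :
    ContDiffOn ℝ ∞ α J := by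
  -- Bootstrapping: if `α` is of class `n`, so is its derivative `X ∘ α`, and `α` is of class `n +
  -- 1`.
  have key : ∀ n : ℕ, ContDiffOn ℝ n α J := by
    intro n
    induction n with
    | zero =>
      exact contDiffOn_zero.2 fun t ht => (h t ht).continuousAt.continuousWithinAt
    | succ n ih =>
      have h1 : ContDiffOn ℝ ((n : WithTop ℕ∞) + 1) α J := by
        rw [contDiffOn_succ_iff_deriv_of_isOpen hJ]
        refine ⟨fun t ht => (h t ht).differentiableAt.differentiableWithinAt, by simp, ?_⟩
        have h2 : ContDiffOn ℝ n (fun t => X (α t)) J :=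
          (hX.of_le (by exact_mod_cast le_top)).comp ih hα
        exact h2.congr fun t ht => (h t ht).deriv
      exact_mod_cast h1
  exact contDiffOn_infty.2 key

/-- Passes from pairs of vectors to the tangent bundle of the model space, so that smoothness of a
bundle map such as `hor` can be read as smoothness of a function on a normed space. -/
theorem contMDiff_tangentBundle_mk {E : Type*} [NormedAddCommGroup E] [NormedSpace ℝ E] :
    ContMDiff 𝓘(ℝ, E × E) 𝓘(ℝ, E).tangent ∞
      (fun x : E × E => (⟨x.1, x.2⟩ : TangentBundle 𝓘(ℝ, E) E)) := by
  intro x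
  rw [Bundle.contMDiffAt_totalSpace]
  refine ⟨contDiff_fst.contMDiff.contMDiffAt, ?_⟩
  have h := (contDiff_snd (𝕜 := ℝ) (E := E) (F := E) (n := ∞)).contMDiff.contMDiffAt (x := x)
  convert! h with y
  exact Prod.ext rfl (by simp)

section ModelDerivSmooth

variable {E : Type*} [NormedAddCommGroup E] [NormedSpace ℝ E]
  {N : Type*} [TopologicalSpace N] [ChartedSpace E N]
  {E' : Type*} [NormedAddCommGroup E'] [NormedSpace ℝ E']
  {N' : Type*} [TopologicalSpace N'] [ChartedSpace E' N']
  [IsManifold 𝓘(ℝ, E) ∞ N] [IsManifold 𝓘(ℝ, E') ∞ N']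

theorem ContMDiffOn.contMDiffOn_modelDeriv {f : N → N'} {O : Set N} (hO : IsOpen O)
    (hf : ContMDiffOn 𝓘(ℝ, E) 𝓘(ℝ, E') ∞ f O) :
    ContMDiffOn 𝓘(ℝ, E).tangent 𝓘(ℝ, E').tangent ∞
      (fun v : TangentBundle 𝓘(ℝ, E) N =>
        (⟨f v.1, modelDeriv E E' f v.1 v.2⟩ : TangentBundle 𝓘(ℝ, E') N'))
      (Bundle.TotalSpace.proj ⁻¹' O) := by
  have h := hf.contMDiffOn_tangentMapWithin (m := ∞) (by simp) hO.uniqueMDiffOn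
  refine h.congr fun v hv => ?_
  rw [tangentMapWithin_eq_tangentMap (hO.uniqueMDiffOn _ hv)
    ((hf.contMDiffAt (hO.mem_nhds hv)).mdifferentiableAt (by simp))]
  rfl

end ModelDerivSmooth

namespace PrincipalBundle

variable {EM : Type*} [NormedAddCommGroup EM] [NormedSpace ℝ EM]
    {EG : Type*} [NormedAddCommGroup EG] [NormedSpace ℝ EG]
    {EP : Type*} [NormedAddCommGroup EP] [NormedSpace ℝ EP]
    {M : Type*} [TopologicalSpace M] [ChartedSpace EM M]
    {G : Type*} [TopologicalSpace G] [ChartedSpace EG G] [Group G]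
    {P : Type*} [TopologicalSpace P] [ChartedSpace EP P]
    {B : PrincipalBundle EM EG EP M G P}

/-! ### The horizontal projection in coordinates, and the differential equation of horizontal lifts.
-/

section Coordinates

variable (τ : Bundle.Trivialization G B.proj) (x₀ : M) (g₀ : G)

/-- The coordinates on the total space given by a trivialisation and charts of the base and of
the structure group. -/
noncomputable def coord (p : P) : EM × EG :=
  (extChartAt 𝓘(ℝ, EM) x₀ (B.proj p), extChartAt 𝓘(ℝ, EG) g₀ (τ p).2)

/-- The inverse of `coord`. -/
noncomputable def coordSymm (z : EM × EG) : P :=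
  τ.toOpenPartialHomeomorph.symm
    ((extChartAt 𝓘(ℝ, EM) x₀).symm z.1, (extChartAt 𝓘(ℝ, EG) g₀).symm z.2)

/-- The domain of `coord`. -/
def coordSource : Set P :=
  {p | B.proj p ∈ τ.baseSet ∩ (chartAt EM x₀).source ∧ (τ p).2 ∈ (chartAt EG g₀).source}

/-- The range of `coord`. -/
def coordTarget : Set (EM × EG) :=
  ((extChartAt 𝓘(ℝ, EM) x₀).target ∩ (extChartAt 𝓘(ℝ, EM) x₀).symm ⁻¹' τ.baseSet) ×ˢ
    (extChartAt 𝓘(ℝ, EG) g₀).target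

theorem isOpen_coordTarget : IsOpen (coordTarget τ x₀ g₀) :=
  ((continuousOn_extChartAt_symm x₀).isOpen_inter_preimage (isOpen_extChartAt_target x₀)
    τ.open_baseSet).prod (isOpen_extChartAt_target g₀)

variable {τ x₀ g₀}

theorem isOpen_coordSource : IsOpen (coordSource τ x₀ g₀) := by
  have h1 : coordSource τ x₀ g₀ =
      τ.source ∩ τ ⁻¹' ((chartAt EM x₀).source ×ˢ (chartAt EG g₀).source) := by
    ext p
    simp only [coordSource, mem_inter_iff, mem_preimage, mem_prod, τ.mem_source, mem_ofPred_eq]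
    constructor
    · rintro ⟨⟨h1, h2⟩, h3⟩
      have := τ.coe_fst (τ.mem_source.2 h1)
      exact ⟨h1, by rwa [this], h3⟩
    · rintro ⟨h1, h2, h3⟩
      have := τ.coe_fst (τ.mem_source.2 h1)
      exact ⟨⟨h1, by rwa [this] at h2⟩, h3⟩
  rw [h1]
  exact τ.toOpenPartialHomeomorph.continuousOn.isOpen_inter_preimage τ.open_source
    ((chartAt EM x₀).open_source.prod (chartAt EG g₀).open_source)

theorem coordSymm_mem {z : EM × EG} (hz : z ∈ coordTarget τ x₀ g₀) :
    coordSymm τ x₀ g₀ z ∈ coordSource τ x₀ g₀ ∧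
      B.proj (coordSymm τ x₀ g₀ z) = (extChartAt 𝓘(ℝ, EM) x₀).symm z.1 ∧
      (τ (coordSymm τ x₀ g₀ z)).2 = (extChartAt 𝓘(ℝ, EG) g₀).symm z.2 := by
  obtain ⟨⟨h1, h2⟩, h3⟩ := hz
  have h4 : ((extChartAt 𝓘(ℝ, EM) x₀).symm z.1, (extChartAt 𝓘(ℝ, EG) g₀).symm z.2) ∈ τ.target :=
    τ.mem_target.2 h2
  have h5 : B.proj (coordSymm τ x₀ g₀ z) = (extChartAt 𝓘(ℝ, EM) x₀).symm z.1 :=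
    τ.proj_symm_apply h4
  have h6 : (τ (coordSymm τ x₀ g₀ z)).2 = (extChartAt 𝓘(ℝ, EG) g₀).symm z.2 :=
    congrArg Prod.snd (τ.apply_symm_apply h4)
  refine ⟨⟨?_, ?_⟩, h5, h6⟩
  · rw [h5]
    refine ⟨h2, ?_⟩
    rw [← extChartAt_source 𝓘(ℝ, EM)]
    exact (extChartAt 𝓘(ℝ, EM) x₀).map_target h1
  · rw [h6, ← extChartAt_source 𝓘(ℝ, EG)]
    exact (extChartAt 𝓘(ℝ, EG) g₀).map_target h3

theorem coord_coordSymm {z : EM × EG} (hz : z ∈ coordTarget τ x₀ g₀) :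
    coord τ x₀ g₀ (coordSymm τ x₀ g₀ z) = z := by
  obtain ⟨h1, h2, h3⟩ := coordSymm_mem hz
  unfold coord
  rw [h2, h3, (extChartAt 𝓘(ℝ, EM) x₀).right_inv hz.1.1, (extChartAt 𝓘(ℝ, EG) g₀).right_inv hz.2]

theorem coordSymm_coord {p : P} (hp : p ∈ coordSource τ x₀ g₀) :
    coordSymm τ x₀ g₀ (coord τ x₀ g₀ p) = p := by
  unfold coordSymm coord
  dsimp only
  rw [(extChartAt 𝓘(ℝ, EM) x₀).left_inv (by rw [extChartAt_source]; exact hp.1.2),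
    (extChartAt 𝓘(ℝ, EG) g₀).left_inv (by rw [extChartAt_source]; exact hp.2)]
  exact τ.symm_apply_mk_proj (τ.mem_source.2 hp.1.1)

variable [IsManifold 𝓘(ℝ, EM) ∞ M] [IsManifold 𝓘(ℝ, EG) ∞ G]

theorem contMDiffOn_coord (hτ : B.IsSmoothTriv τ) :
    ContMDiffOn 𝓘(ℝ, EP) 𝓘(ℝ, EM × EG) ∞ (coord τ x₀ g₀) (coordSource τ x₀ g₀) := by
  intro p hp
  apply ContMDiffAt.contMDiffWithinAt
  refine ContMDiffAt.prodMk_space ?_ ?_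
  · exact ContMDiffAt.comp (g := extChartAt 𝓘(ℝ, EM) x₀) p (contMDiffAt_extChartAt' hp.1.2)
      B.contMDiff_proj.contMDiffAt
  · exact ContMDiffAt.comp (g := extChartAt 𝓘(ℝ, EG) g₀) p (contMDiffAt_extChartAt' hp.2)
      (hτ.contMDiffAt_snd hp.1.1)

theorem contMDiffOn_coordSymm (hτ : B.IsSmoothTriv τ) :
    ContMDiffOn 𝓘(ℝ, EM × EG) 𝓘(ℝ, EP) ∞ (coordSymm τ x₀ g₀) (coordTarget τ x₀ g₀) := by
  have h1 : ContMDiffOn 𝓘(ℝ, EM × EG) 𝓘(ℝ, EM) ∞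
      (fun z : EM × EG => (extChartAt 𝓘(ℝ, EM) x₀).symm z.1) (coordTarget τ x₀ g₀) :=
    (contMDiffOn_extChartAt_symm x₀).comp contDiff_fst.contMDiff.contMDiffOn fun z hz => hz.1.1
  have h2 : ContMDiffOn 𝓘(ℝ, EM × EG) 𝓘(ℝ, EG) ∞
      (fun z : EM × EG => (extChartAt 𝓘(ℝ, EG) g₀).symm z.2) (coordTarget τ x₀ g₀) :=
    (contMDiffOn_extChartAt_symm g₀).comp contDiff_snd.contMDiff.contMDiffOn fun z hz => hz.2
  exact hτ.contMDiffOn_symm.comp (h1.prodMk h2) fun z hz => τ.mem_target.2 hz.1.2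

variable [IsManifold 𝓘(ℝ, EP) ∞ P]

variable (τ x₀ g₀) in
/-- The horizontal projection in coordinates. -/
noncomputable def coordHor (A : B.Connection) (z ζ : EM × EG) : EM × EG :=
  modelDeriv EP (EM × EG) (coord τ x₀ g₀) (coordSymm τ x₀ g₀ z)
    (A.horL (coordSymm τ x₀ g₀ z) (modelDeriv (EM × EG) EP (coordSymm τ x₀ g₀) z ζ))

theorem contDiffOn_coordHor (hτ : B.IsSmoothTriv τ) (A : B.Connection) :
    ContDiffOn ℝ ∞ (fun x : (EM × EG) × (EM × EG) => coordHor τ x₀ g₀ A x.1 x.2)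
      (coordTarget τ x₀ g₀ ×ˢ univ) := by
  rw [← contMDiffOn_iff_contDiffOn]
  have h1 := (contMDiffOn_coordSymm (x₀ := x₀) (g₀ := g₀) hτ).contMDiffOn_modelDeriv
    (isOpen_coordTarget τ x₀ g₀)
  have h2 := (contMDiffOn_coord (x₀ := x₀) (g₀ := g₀) hτ).contMDiffOn_modelDeriv
    (isOpen_coordSource (τ := τ) (x₀ := x₀) (g₀ := g₀))
  have h3 := h1.comp (contMDiff_tangentBundle_mk (E := EM × EG)).contMDiffOn
    (s := coordTarget τ x₀ g₀ ×ˢ univ) (fun x hx => hx.1)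
  have h4 := A.contMDiff_hor.comp_contMDiffOn h3
  have h5 := h2.comp h4 (fun x hx => (coordSymm_mem hx.1).1)
  exact (contMDiff_snd_tangentBundle_modelSpace (EM × EG) 𝓘(ℝ, EM × EG)).comp_contMDiffOn h5

/-- The differentials `D` and `K` of the coordinate maps are inverse to each other, and `D (0, η)`
is vertical. Hence the horizontal part of `D (ξ, η)` depends on `ξ` only; in coordinates it has
first component `ξ` and second component `η` by `hη`. Horizontality thus becomes a differential
equation for the group coordinate alone. -/
theorem hasVel_coordSymm_horizontal (hτ : B.IsSmoothTriv τ) (A : B.Connection) {z : ℝ → EM × EG}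
    {S : Set ℝ} {t : ℝ} {ξ : EM} {η : EG} (hz : z t ∈ coordTarget τ x₀ g₀)
    (h : HasVelWithinAt z (ξ, η) S t) (hη : (coordHor τ x₀ g₀ A (z t) (ξ, 0)).2 = η) :
    ∃ w : EP, HasVelWithinAt (fun r => coordSymm τ x₀ g₀ (z r)) w S t ∧
      A.horL (coordSymm τ x₀ g₀ (z t)) w = w := by
  obtain ⟨hs, hp1, hp2⟩ := coordSymm_mem hz
  have dΨ : MDifferentiableAt 𝓘(ℝ, EM × EG) 𝓘(ℝ, EP) (coordSymm τ x₀ g₀) (z t) :=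
    ((contMDiffOn_coordSymm hτ).contMDiffAt
      ((isOpen_coordTarget τ x₀ g₀).mem_nhds hz)).mdifferentiableAt (by simp)
  have dκ : MDifferentiableAt 𝓘(ℝ, EP) 𝓘(ℝ, EM × EG) (coord τ x₀ g₀)
      (coordSymm τ x₀ g₀ (z t)) :=
    ((contMDiffOn_coord hτ).contMDiffAt
      (isOpen_coordSource.mem_nhds hs)).mdifferentiableAt (by simp)
  set p := coordSymm τ x₀ g₀ (z t) with hp
  set D := modelDeriv (EM × EG) EP (coordSymm τ x₀ g₀) (z t) with hD
  set K := modelDeriv EP (EM × EG) (coord τ x₀ g₀) p with hK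
  have hKD : ∀ ζ, K (D ζ) = ζ := by
    intro ζ
    rw [hK, hD, hp, ← modelDeriv_comp (f := coordSymm τ x₀ g₀) dκ dΨ]
    rw [modelDeriv_congr (F' := fun y => y), modelDeriv_id]
    filter_upwards [(isOpen_coordTarget τ x₀ g₀).mem_nhds hz] with y hy
    exact coord_coordSymm hy
  have hDK : ∀ v, D (K v) = v := by
    intro v
    have e : coord τ x₀ g₀ p = z t := coord_coordSymm hz
    have := modelDeriv_comp (f := coord τ x₀ g₀) (F := coordSymm τ x₀ g₀) (x := p)
      (by rw [e]; exact dΨ) dκ v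
    rw [e, ← hD] at this
    rw [hK, ← this, modelDeriv_congr (F' := fun y => y), modelDeriv_id]
    filter_upwards [isOpen_coordSource.mem_nhds hs] with y hy
    exact coordSymm_coord hy
  have hKfst : ∀ v, (K v).1 = modelDeriv EM EM (extChartAt 𝓘(ℝ, EM) x₀) (B.proj p)
      (modelDeriv EP EM B.proj p v) := by
    intro v
    have dφ : MDifferentiableAt 𝓘(ℝ, EM) 𝓘(ℝ, EM) (extChartAt 𝓘(ℝ, EM) x₀) (B.proj p) :=
      mdifferentiableAt_extChartAt hs.1.2
    rw [← modelDeriv_comp dφ (mdifferentiableAt_proj p)]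
    have dfst : MDifferentiableAt 𝓘(ℝ, EM × EG) 𝓘(ℝ, EM) (Prod.fst : EM × EG → EM)
        (coord τ x₀ g₀ p) := differentiableAt_fst.mdifferentiableAt
    have := modelDeriv_comp dfst dκ v
    rw [show (fun y => extChartAt 𝓘(ℝ, EM) x₀ (B.proj y)) =
      fun y => (coord τ x₀ g₀ y).1 from rfl, this]
    have h2 : modelDeriv (EM × EG) EM (Prod.fst : EM × EG → EM) (coord τ x₀ g₀ p) =
        ContinuousLinearMap.fst ℝ EM EG :=
      (hasMFDerivAt_iff_hasFDerivAt.2 hasFDerivAt_fst).mfderiv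
    rw [h2]
    rfl
  have hvert : ∀ η : EG, modelDeriv EP EM B.proj p (D (0, η)) = 0 := by
    intro η
    rw [hD, hp, ← modelDeriv_comp (mdifferentiableAt_proj _) dΨ]
    rw [modelDeriv_congr (F' := fun y : EM × EG => (extChartAt 𝓘(ℝ, EM) x₀).symm y.1)]
    · have dφ : MDifferentiableAt 𝓘(ℝ, EM) 𝓘(ℝ, EM) (extChartAt 𝓘(ℝ, EM) x₀).symm (z t).1 :=
        ((contMDiffOn_extChartAt_symm (n := ∞) x₀).contMDiffAt
          ((isOpen_extChartAt_target x₀).mem_nhds hz.1.1)).mdifferentiableAt (by simp)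
      have dfst : MDifferentiableAt 𝓘(ℝ, EM × EG) 𝓘(ℝ, EM) (Prod.fst : EM × EG → EM)
          (z t) := differentiableAt_fst.mdifferentiableAt
      rw [modelDeriv_comp dφ dfst]
      have h2 : modelDeriv (EM × EG) EM (Prod.fst : EM × EG → EM) (z t) =
          ContinuousLinearMap.fst ℝ EM EG :=
        (hasMFDerivAt_iff_hasFDerivAt.2 hasFDerivAt_fst).mfderiv
      rw [h2]
      exact map_zero _
    · filter_upwards [(isOpen_coordTarget τ x₀ g₀).mem_nhds hz] with y hy
      exact (coordSymm_mem hy).2.1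
  refine ⟨D (ξ, η), h.comp dΨ, ?_⟩
  have h1 : A.horL p (D (ξ, η)) = A.horL p (D (ξ, 0)) := by
    apply A.horL_eq_of_proj_eq
    have : ((ξ, η) : EM × EG) = (ξ, 0) + (0, η) := by simp
    rw [this, map_add, map_add, hvert, add_zero]
  have h2 : K (A.horL p (D (ξ, 0))) = (ξ, η) := by
    refine Prod.ext ?_ hη
    rw [hKfst, A.modelDeriv_proj_horL, ← hKfst, hKD]
  rw [h1, ← hDK (A.horL p (D (ξ, 0))), h2]

end Coordinates

variable [IsManifold 𝓘(ℝ, EP) ∞ P] [IsManifold 𝓘(ℝ, EM) ∞ M] [IsManifold 𝓘(ℝ, EG) ∞ G]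

/-- Local existence of smooth horizontal lifts. -/
theorem exists_isLiftOn_nhds [CompleteSpace EG] (A : B.Connection) {c : ℝ → M} {t₀ : ℝ}
    (hc : ∀ᶠ t in 𝓝 t₀, ContMDiffAt 𝓘(ℝ, ℝ) 𝓘(ℝ, EM) ∞ c t) :
    ∃ δ > 0, ∃ u : ℝ → P, ContMDiffOn 𝓘(ℝ, ℝ) 𝓘(ℝ, EP) ∞ u (Ioo (t₀ - δ) (t₀ + δ)) ∧
      IsLiftOn A c u (Ioo (t₀ - δ) (t₀ + δ)) := by
  obtain ⟨τ, hx, hτ⟩ := B.exists_smoothTriv (c t₀)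
  set x₀ := c t₀ with hx₀
  have hcont : ContinuousAt c t₀ := hc.self_of_nhds.continuousAt
  have hnear : ∀ᶠ t in 𝓝 t₀, ContMDiffAt 𝓘(ℝ, ℝ) 𝓘(ℝ, EM) ∞ c t ∧
      c t ∈ τ.baseSet ∩ (chartAt EM x₀).source :=
    hc.and (hcont ((τ.open_baseSet.inter (chartAt EM x₀).open_source).mem_nhds
      ⟨hx, mem_chart_source EM _⟩))
  obtain ⟨ρ, hρ, hT⟩ := Metric.eventually_nhds_iff_ball.1 hnear
  set T := Metric.ball t₀ ρ with hTdef
  have hTo : IsOpen T := Metric.isOpen_ball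
  set x : ℝ → EM := fun t => extChartAt 𝓘(ℝ, EM) x₀ (c t) with hxdef
  have hxs : ContDiffOn ℝ ∞ x T := by
    intro t ht
    apply ContDiffAt.contDiffWithinAt
    rw [← contMDiffAt_iff_contDiffAt]
    exact ContMDiffAt.comp (g := extChartAt 𝓘(ℝ, EM) x₀) t (contMDiffAt_extChartAt' (hT t ht).2.2)
      (hT t ht).1
  have hξs : ContDiffOn ℝ ∞ (deriv x) T := hxs.deriv_of_isOpen hTo (by simp)
  set Ω : Set (ℝ × EG) := T ×ˢ (extChartAt 𝓘(ℝ, EG) (1 : G)).target with hΩ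
  have hΩo : IsOpen Ω := hTo.prod (isOpen_extChartAt_target _)
  have hmem : ∀ q ∈ Ω, (x q.1, q.2) ∈ coordTarget τ x₀ (1 : G) := by
    intro q hq
    refine ⟨⟨(extChartAt 𝓘(ℝ, EM) x₀).map_source ?_, ?_⟩, hq.2⟩
    · rw [extChartAt_source]; exact (hT _ hq.1).2.2
    · rw [mem_preimage, (extChartAt 𝓘(ℝ, EM) x₀).left_inv]
      · exact (hT _ hq.1).2.1
      · rw [extChartAt_source]; exact (hT _ hq.1).2.2
  -- Time is adjoined as a first coordinate to make the equation autonomous. The second component is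
  -- the velocity which the group coordinate must have over the base velocity `deriv x`.
  set X : ℝ × EG → ℝ × EG := fun q =>
    (1, (coordHor τ x₀ (1 : G) A (x q.1, q.2) (deriv x q.1, 0)).2) with hX
  have hXs : ContDiffOn ℝ ∞ X Ω := by
    refine contDiffOn_const.prodMk (contDiff_snd.comp_contDiffOn ?_)
    refine (contDiffOn_coordHor (x₀ := x₀) (g₀ := (1 : G)) hτ A).comp
      (f := fun q : ℝ × EG => ((x q.1, q.2), (deriv x q.1, (0 : EG)))) ?_
      (fun q hq => ⟨hmem q hq, trivial⟩)
    have e1 : ContDiffOn ℝ ∞ (fun q : ℝ × EG => x q.1) Ω :=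
      hxs.comp contDiff_fst.contDiffOn fun q hq => hq.1
    have e2 : ContDiffOn ℝ ∞ (fun q : ℝ × EG => deriv x q.1) Ω :=
      hξs.comp contDiff_fst.contDiffOn fun q hq => hq.1
    exact (e1.prodMk contDiff_snd.contDiffOn).prodMk (e2.prodMk contDiffOn_const)
  have hq₀ : (t₀, extChartAt 𝓘(ℝ, EG) (1 : G) 1) ∈ Ω :=
    ⟨Metric.mem_ball_self hρ, mem_extChartAt_target _⟩
  obtain ⟨α, hα0, ε, hε, hα⟩ :=
    ((hXs.contDiffAt (hΩo.mem_nhds hq₀)).of_le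
      (by exact_mod_cast le_top)).exists_forall_mem_closedBall_exists_eq_forall_mem_Ioo_hasDerivAt₀ t₀
  have hαc : ContinuousAt α t₀ := (hα t₀ ⟨by linarith, by linarith⟩).continuousAt
  have hαΩ : ∀ᶠ t in 𝓝 t₀, α t ∈ Ω := hαc (by rw [hα0]; exact hΩo.mem_nhds hq₀)
  obtain ⟨δ', hδ', hball⟩ := Metric.eventually_nhds_iff_ball.1 hαΩ
  set δ := min δ' ε with hδdef
  have hδ : 0 < δ := lt_min hδ' hε
  set J := Ioo (t₀ - δ) (t₀ + δ) with hJ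
  have hJε : ∀ t ∈ J, t ∈ Ioo (t₀ - ε) (t₀ + ε) := fun t ht =>
    ⟨by linarith [ht.1, min_le_right δ' ε], by linarith [ht.2, min_le_right δ' ε]⟩
  have hJΩ : MapsTo α J Ω := by
    intro t ht
    refine hball t ?_
    rw [Real.ball_eq_Ioo]
    exact ⟨by linarith [ht.1, min_le_left δ' ε], by linarith [ht.2, min_le_left δ' ε]⟩
  have hder : ∀ t ∈ J, HasDerivAt α (X (α t)) t := fun t ht => hα t (hJε t ht)
  have hαs : ContDiffOn ℝ ∞ α J := contDiffOn_of_hasDerivAt_of_contDiffOn hXs isOpen_Ioo hJΩ hder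
  have ht₀J : t₀ ∈ J := ⟨by linarith, by linarith⟩
  -- The adjoined coordinate has derivative 1 and starts at `t₀`, so it is the time.
  have hfst : ∀ t ∈ J, (α t).1 = t := by
    intro t ht
    have hz : ∀ r ∈ J, HasVelWithinAt (fun r => (α r).1 - r) (0 : ℝ) J r := by
      intro r hr
      rw [HasVelWithinAt.iff_hasDerivWithinAt]
      have h1 := (hasFDerivAt_fst (p := α r)).comp_hasDerivAt r (hder r hr)
      have h2 : HasDerivWithinAt (fun r => (α r).1 - r) ((1 : ℝ) - 1) J r :=
        (h1.sub (hasDerivAt_id r)).hasDerivWithinAt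
      rwa [sub_self] at h2
    have := eqOn_of_hasVelWithinAt_zero (convex_Ioo _ _) hz ht ht₀J
    simp only [hα0, sub_self] at this
    linarith
  refine ⟨δ, hδ, fun t => coordSymm τ x₀ (1 : G) (x t, (α t).2), ?_, ?_, ?_⟩
  · have hz : ContDiffOn ℝ ∞ (fun t => (x t, (α t).2)) J := by
      refine ContDiffOn.prodMk (hxs.mono ?_) (contDiff_snd.comp_contDiffOn hαs)
      intro t ht
      rw [← hfst t ht]
      exact (hJΩ ht).1
    refine (contMDiffOn_coordSymm (x₀ := x₀) (g₀ := (1 : G)) hτ).comp hz.contMDiffOn ?_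
    intro t ht
    have := hmem _ (hJΩ ht)
    rwa [hfst t ht] at this
  · intro t ht
    have h1 := hmem _ (hJΩ ht)
    rw [hfst t ht] at h1
    have hTt : t ∈ T := by rw [← hfst t ht]; exact (hJΩ ht).1
    rw [(coordSymm_mem h1).2.1]
    exact (extChartAt 𝓘(ℝ, EM) x₀).left_inv (by rw [extChartAt_source]; exact (hT t hTt).2.2)
  · intro t ht
    have h1 := hmem _ (hJΩ ht)
    rw [hfst t ht] at h1
    have hTt : t ∈ T := by rw [← hfst t ht]; exact (hJΩ ht).1
    have hvel : HasVelWithinAt (fun t => (x t, (α t).2)) (deriv x t, (X (α t)).2) J t := by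
      rw [HasVelWithinAt.iff_hasDerivWithinAt]
      have e1 : HasDerivAt x (deriv x t) t :=
        ((hxs.contDiffAt (hTo.mem_nhds hTt)).differentiableAt (by simp)).hasDerivAt
      have e2 : HasDerivAt (fun t => (α t).2) (X (α t)).2 t :=
        (hasFDerivAt_snd (p := α t)).comp_hasDerivAt t (hder t ht)
      exact (e1.prodMk e2).hasDerivWithinAt
    refine hasVel_coordSymm_horizontal hτ A h1 hvel ?_
    simp only [hX, hfst t ht]

end PrincipalBundle

/-! ## Parallel transport -/

section Paths

variable {EM : Type*} [NormedAddCommGroup EM] [NormedSpace ℝ EM]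
  {M : Type*} [TopologicalSpace M] [ChartedSpace EM M]

theorem AnalyticPath.continuousAt (c : AnalyticPath EM M) {t : ℝ} (ht : t ∈ Icc (0 : ℝ) 1) :
    ContinuousAt c t :=
  (c.analytic' t ht).continuousAt

theorem AnalyticPath.continuousOn (c : AnalyticPath EM M) : ContinuousOn c (Icc 0 1) :=
  fun _ ht => (c.continuousAt ht).continuousWithinAt

theorem AnalyticPath.mdifferentiableAt (c : AnalyticPath EM M) {t : ℝ} (ht : t ∈ Icc (0 : ℝ) 1) :
    MDifferentiableAt 𝓘(ℝ, ℝ) 𝓘(ℝ, EM) c t :=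
  (c.analytic' t ht).mdifferentiableAt (by simp)

theorem AnalyticPath.eventually_contMDiffAt [IsManifold 𝓘(ℝ, EM) ω M] (c : AnalyticPath EM M)
    {t : ℝ} (ht : t ∈ Icc (0 : ℝ) 1) : ∀ᶠ s in 𝓝 t, ContMDiffAt 𝓘(ℝ, ℝ) 𝓘(ℝ, EM) ω c s :=
  (contMDiffAt_iff_contMDiffAt_nhds (by simp)).1 (c.analytic' t ht)

theorem AnalyticPath.exists_reparam {c c' : AnalyticPath EM M} (h : c.toOEdge = c'.toOEdge) :
    ∃ f g : ℝ → ℝ, IsReparam f g ∧ MonotoneOn f (Icc 0 1) ∧ ∀ t ∈ Icc (0 : ℝ) 1, c' t = c (f t) :=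
  Quotient.exact h

theorem OEdge.exists_isInverse (e : OEdge EM M) : ∃ e' : OEdge EM M, e.IsInverse e' := by
  obtain ⟨c, rfl⟩ : ∃ c : AnalyticPath EM M, c.toOEdge = e := Quotient.exists_rep e
  exact ⟨_, c, rfl, rfl⟩

end Paths

namespace PrincipalBundle

variable {EM : Type*} [NormedAddCommGroup EM] [NormedSpace ℝ EM]
    {EG : Type*} [NormedAddCommGroup EG] [NormedSpace ℝ EG]
    {EP : Type*} [NormedAddCommGroup EP] [NormedSpace ℝ EP]
    {M : Type*} [TopologicalSpace M] [ChartedSpace EM M]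
    {G : Type*} [TopologicalSpace G] [ChartedSpace EG G] [Group G]
    {P : Type*} [TopologicalSpace P] [ChartedSpace EP P]
    {B : PrincipalBundle EM EG EP M G P}

theorem FibreIso.ext' {x y : M} {F F' : B.FibreIso x y} (h : ∀ p, F.toEquiv p = F'.toEquiv p) :
    F = F' := by
  obtain ⟨f, hf⟩ := F
  obtain ⟨f', hf'⟩ := F'
  obtain rfl : f = f' := Equiv.ext h
  rfl

variable [IsManifold 𝓘(ℝ, EP) ∞ P] {A : B.Connection}

theorem IsLiftOn.union {c : ℝ → M} {u : ℝ → P} {S S' : Set ℝ} (h : IsLiftOn A c u S)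
    (h' : IsLiftOn A c u S') (hS : IsOpen S) (hS' : IsOpen S') : IsLiftOn A c u (S ∪ S') where
  proj_eq t ht := ht.elim (h.proj_eq t) (h'.proj_eq t)
  exists_vel t ht := by
    rcases ht with ht | ht
    · obtain ⟨w, h1, h2⟩ := h.exists_vel t ht
      exact ⟨w, h1.mono_of_mem (mem_nhdsWithin_of_mem_nhds (hS.mem_nhds ht)), h2⟩
    · obtain ⟨w, h1, h2⟩ := h'.exists_vel t ht
      exact ⟨w, h1.mono_of_mem (mem_nhdsWithin_of_mem_nhds (hS'.mem_nhds ht)), h2⟩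

/-- `u` is a smooth horizontal lift of the curve `c` over the set of times `S`. -/
def IsSmoothLiftOn (A : B.Connection) (c : ℝ → M) (u : ℝ → P) (S : Set ℝ) : Prop :=
  ContMDiffOn 𝓘(ℝ, ℝ) 𝓘(ℝ, EP) ∞ u S ∧ IsLiftOn A c u S

theorem IsSmoothLiftOn.act {c : ℝ → M} {u : ℝ → P} {S : Set ℝ} (h : IsSmoothLiftOn A c u S)
    (g : G) : IsSmoothLiftOn A c (fun t => B.act (u t) g) S :=
  ⟨(contMDiff_act_right g).comp_contMDiffOn h.1, h.2.act g⟩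

theorem IsSmoothLiftOn.congr {c : ℝ → M} {u v : ℝ → P} {S : Set ℝ} (h : IsSmoothLiftOn A c u S)
    (huv : EqOn v u S) : IsSmoothLiftOn A c v S :=
  ⟨h.1.congr huv, h.2.congr huv⟩

theorem IsSmoothLiftOn.mono {c : ℝ → M} {u : ℝ → P} {S S' : Set ℝ} (h : IsSmoothLiftOn A c u S)
    (hS : S' ⊆ S) : IsSmoothLiftOn A c u S' :=
  ⟨h.1.mono hS, h.2.mono hS⟩

theorem IsSmoothLiftOn.exists_act_eq {c : ℝ → M} {u : ℝ → P} {S : Set ℝ}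
    (h : IsSmoothLiftOn A c u S) {t : ℝ} (ht : t ∈ S) {p : P} (hp : B.proj p = c t) :
    ∃ v, IsSmoothLiftOn A c v S ∧ v t = p := by
  obtain ⟨g, hg⟩ := B.exists_act_eq (p := u t) (q := p) ((h.2.proj_eq t ht).trans hp.symm)
  exact ⟨_, h.act g, hg⟩

theorem IsLiftOn.of_isHorizontalLift {c : AnalyticPath EM M} {u : ℝ → P}
    (h : IsHorizontalLift A c u) : IsLiftOn A c u (Icc 0 1) where
  proj_eq := h.proj_eq
  exists_vel t ht := ⟨velWithin EP u (Icc 0 1) t,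
    HasVelWithinAt.of_mdifferentiableWithinAt (h.contMDiffOn.mdifferentiableOn (by simp) t ht),
    h.horizontal t ht⟩

theorem IsSmoothLiftOn.isHorizontalLift {c : AnalyticPath EM M} {u : ℝ → P}
    (h : IsSmoothLiftOn A c u (Icc 0 1)) : IsHorizontalLift A c u where
  contMDiffOn := h.1.of_le (by exact_mod_cast le_top)
  proj_eq := h.2.proj_eq
  horizontal t ht := by
    obtain ⟨w, h1, h2⟩ := h.2.exists_vel t ht
    have h3 := h1.velWithin_eq (uniqueDiffOn_Icc_zero_one t ht)
    rw [← h3] at h2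
    exact h2

namespace Transports

variable {e : OEdge EM M} {p q : P}

theorem proj_left (h : Transports A e p q) : B.proj p = e.source := by
  obtain ⟨c, u, rfl, hu, rfl, rfl⟩ := h
  exact hu.proj_eq 0 (by simp)

theorem proj_right (h : Transports A e p q) : B.proj q = e.target := by
  obtain ⟨c, u, rfl, hu, rfl, rfl⟩ := h
  exact hu.proj_eq 1 (by simp)

end Transports

variable [LieGroup 𝓘(ℝ, EG) ∞ G]

/-- By uniqueness the lifts agree on the overlap of the two open intervals. The function pieced
together at `t` therefore coincides with one of the two lifts on each of two open sets covering the
new interval. -/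
theorem IsSmoothLiftOn.glue {c : ℝ → M} {u v : ℝ → P} {a b a' b' t : ℝ}
    (hu : IsSmoothLiftOn A c u (Ioo a b)) (hv : IsSmoothLiftOn A c v (Ioo a' b'))
    (ht : t ∈ Ioo a b) (ht' : t ∈ Ioo a' b') (h : u t = v t) :
    ∃ w, IsSmoothLiftOn A c w (Ioo a b') ∧ EqOn w u (Ioo a t) ∧ w t = u t := by
  classical
  have heq : EqOn u v (Ioo a b ∩ Ioo a' b') :=
    IsLiftOn.eqOn ((convex_Ioo _ _).inter (convex_Ioo _ _))
      (isOpen_Ioo.inter isOpen_Ioo).uniqueDiffOn (hu.2.mono inter_subset_left)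
      (hv.2.mono inter_subset_right) ⟨ht, ht'⟩ h
  refine ⟨fun r => if r < t then u r else v r, ?_, fun r hr => if_pos hr.2, by simp [h]⟩
  have h1 : IsSmoothLiftOn A c (fun r => if r < t then u r else v r) (Ioo a (min b b')) := by
    refine (hu.mono (Ioo_subset_Ioo_right (min_le_left _ _))).congr fun r hr => ?_
    by_cases hrt : r < t
    · simp [hrt]
    · have hm := lt_min_iff.1 hr.2
      simp only [hrt, if_false]
      exact (heq ⟨⟨hr.1, hm.1⟩, ⟨ht'.1.trans_le (not_lt.1 hrt), hm.2⟩⟩).symm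
  have h2 : IsSmoothLiftOn A c (fun r => if r < t then u r else v r) (Ioo (max a a') b') := by
    refine (hv.mono (Ioo_subset_Ioo_left (le_max_right _ _))).congr fun r hr => ?_
    by_cases hrt : r < t
    · have hm := max_lt_iff.1 hr.1
      simp only [hrt, if_true]
      exact heq ⟨⟨hm.1, hrt.trans ht.2⟩, ⟨hm.2, hr.2⟩⟩
    · simp [hrt]
  have h3 : Ioo a b' ⊆ Ioo a (min b b') ∪ Ioo (max a a') b' := by
    intro r hr
    rcases lt_or_ge r (min b b') with hlt | hge
    · exact Or.inl ⟨hr.1, hlt⟩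
    · refine Or.inr ⟨?_, hr.2⟩
      refine lt_of_lt_of_le ?_ hge
      exact max_lt (lt_min (ht.1.trans ht.2) (ht.1.trans ht'.2))
        (lt_min (ht'.1.trans ht.2) (ht'.1.trans ht'.2))
  exact IsSmoothLiftOn.mono
    ⟨h1.1.union_of_isOpen h2.1 isOpen_Ioo isOpen_Ioo, h1.2.union h2.2 isOpen_Ioo isOpen_Ioo⟩ h3

variable [IsManifold 𝓘(ℝ, EM) ω M] [CompleteSpace EG]

theorem exists_isSmoothLiftOn_nhds (A : B.Connection) (c : AnalyticPath EM M) {t : ℝ}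
    (ht : t ∈ Icc (0 : ℝ) 1) : ∃ δ > 0, ∃ u : ℝ → P, IsSmoothLiftOn A c u (Ioo (t - δ) (t + δ)) := by
  have : IsManifold 𝓘(ℝ, EM) ∞ M := IsManifold.of_le (n := ω) le_top
  have : IsManifold 𝓘(ℝ, EG) ∞ G := LieGroup.toContMDiffMul.toIsManifold
  exact exists_isLiftOn_nhds A
    ((c.eventually_contMDiffAt ht).mono fun s hs => hs.of_le le_top)

/-- Existence of horizontal lifts of analytic paths. -/
theorem exists_isSmoothLiftOn (A : B.Connection) (c : AnalyticPath EM M) {p : P}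
    (hp : B.proj p = c 0) :
    ∃ ε > 0, ∃ u : ℝ → P, IsSmoothLiftOn A c u (Ioo (-ε) (1 + ε)) ∧ u 0 = p := by
  choose δ hδ w hw using fun t : Icc (0 : ℝ) 1 => exists_isSmoothLiftOn_nhds A c t.2
  obtain ⟨t, ht0, htm, ⟨m, hm⟩, hcov⟩ := exists_monotone_Icc_subset_open_cover_Icc
    (zero_le_one (α := ℝ)) (c := fun i : Icc (0 : ℝ) 1 =>
      {s : Icc (0 : ℝ) 1 | (s : ℝ) ∈ Ioo ((i : ℝ) - δ i) (i + δ i)})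
    (fun i => isOpen_Ioo.preimage continuous_subtype_val)
    (fun s _ => mem_iUnion.2 ⟨s, by
      have := hδ s
      exact ⟨by linarith, by linarith⟩⟩)
  -- The lift is continued along a subdivision whose pieces lie in the domains of local lifts. A
  -- margin `ε` on both sides is kept so that all domains stay open.
  have key : ∀ n, ∃ ε > 0, ∃ u : ℝ → P, IsSmoothLiftOn A c u (Ioo (-ε) (t n + ε)) ∧ u 0 = p := by
    intro n
    induction n with
    | zero =>
      have h0 : (0 : ℝ) ∈ Icc (0 : ℝ) 1 := by simp
      have hd := hδ ⟨0, h0⟩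
      have h1 := hw ⟨0, h0⟩
      simp only [zero_sub] at h1
      obtain ⟨v, hv, hv0⟩ := h1.exists_act_eq (t := 0) ⟨by linarith, by linarith⟩ hp
      exact ⟨_, hd, v, by rw [ht0]; exact hv, hv0⟩
    | succ n ih =>
      obtain ⟨ε, hε, u, hu, hu0⟩ := ih
      obtain ⟨i, hi⟩ := hcov n
      have hmono : (t n : ℝ) ≤ t (n + 1) := htm n.le_succ
      have h1 : (t n : ℝ) ∈ Ioo ((i : ℝ) - δ i) (i + δ i) := hi ⟨le_rfl, htm n.le_succ⟩
      have h2 : (t (n + 1) : ℝ) ∈ Ioo ((i : ℝ) - δ i) (i + δ i) := hi ⟨htm n.le_succ, le_rfl⟩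
      have hn0 : (0 : ℝ) ≤ t n := (t n).2.1
      have h3 : (t n : ℝ) ∈ Ioo (-ε) (t n + ε) := ⟨by linarith, by linarith⟩
      obtain ⟨v, hv, hv0⟩ := (hw i).exists_act_eq h1 (hu.2.proj_eq _ h3)
      obtain ⟨v', hv', hvu, hvt⟩ := hu.glue hv h3 h1 hv0.symm
      refine ⟨min ε (i + δ i - t (n + 1)), lt_min hε (by linarith [h2.2]), v', ?_, ?_⟩
      · refine hv'.mono fun r hr => ⟨?_, ?_⟩
        · linarith [hr.1, min_le_left ε (i + δ i - t (n + 1))]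
        · linarith [hr.2, min_le_right ε (i + δ i - t (n + 1))]
      · rcases hn0.eq_or_lt with h | h
        · rw [← h] at hvt
          rw [hvt, hu0]
        · rw [hvu ⟨by linarith, h⟩, hu0]
  obtain ⟨ε, hε, u, hu, hu0⟩ := key m
  rw [hm m le_rfl] at hu
  exact ⟨ε, hε, u, hu, hu0⟩

theorem exists_isHorizontalLift (A : B.Connection) (c : AnalyticPath EM M) {p : P}
    (hp : B.proj p = c 0) : ∃ u : ℝ → P, IsHorizontalLift A c u ∧ u 0 = p := by
  obtain ⟨ε, hε, u, hu, hu0⟩ := exists_isSmoothLiftOn A c hp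
  exact ⟨u, (hu.mono fun t ht => ⟨by linarith [ht.1], by linarith [ht.2]⟩).isHorizontalLift, hu0⟩

/-- `Transports` allows any representative of the edge, with a continuously differentiable lift. A
reparametrisation moves the lift to the given representative; conversely, a merely differentiable
lift equals the smooth one with the same starting point, by uniqueness. -/
theorem transports_toOEdge_iff (c : AnalyticPath EM M) {p q : P} :
    Transports A c.toOEdge p q ↔ ∃ u : ℝ → P, IsLiftOn A c u (Icc 0 1) ∧ u 0 = p ∧ u 1 = q := by
  constructor
  · rintro ⟨c', u, hc, hu, rfl, rfl⟩
    obtain ⟨f, g, hfg, hf, hcf⟩ := AnalyticPath.exists_reparam hc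
    refine ⟨fun t => u (f t), (IsLiftOn.of_isHorizontalLift hu).precomp hfg.mapsTo_fun
      (fun t ht => (hfg.analytic_fun t ht).differentiableAt.differentiableWithinAt) hcf, ?_, ?_⟩
    · simp only [hfg.map_zero hf]
    · simp only [hfg.map_one hf]
  · rintro ⟨u, hu, rfl, rfl⟩
    obtain ⟨v, hv, hv0⟩ := exists_isHorizontalLift A c (hu.proj_eq 0 (by simp))
    have h := (IsLiftOn.of_isHorizontalLift hv).eqOn (convex_Icc 0 1) uniqueDiffOn_Icc_zero_one hu
      (left_mem_Icc.2 zero_le_one) hv0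
    exact ⟨c, v, rfl, hv, hv0, h (right_mem_Icc.2 zero_le_one)⟩

namespace Transports

variable {e e₁ e₂ : OEdge EM M} {p q q' r : P}

theorem unique (h : Transports A e p q) (h' : Transports A e p q') : q = q' := by
  obtain ⟨c, rfl⟩ : ∃ c : AnalyticPath EM M, c.toOEdge = e := by
    obtain ⟨c, -, hc, -⟩ := h; exact ⟨c, hc⟩
  obtain ⟨u, hu, hu0, rfl⟩ := (transports_toOEdge_iff c).1 h
  obtain ⟨v, hv, rfl, rfl⟩ := (transports_toOEdge_iff c).1 h'
  exact hu.eqOn (convex_Icc 0 1) uniqueDiffOn_Icc_zero_one hv (left_mem_Icc.2 zero_le_one) hu0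
    (right_mem_Icc.2 zero_le_one)

theorem act (h : Transports A e p q) (g : G) : Transports A e (B.act p g) (B.act q g) := by
  obtain ⟨c, rfl⟩ : ∃ c : AnalyticPath EM M, c.toOEdge = e := by
    obtain ⟨c, -, hc, -⟩ := h; exact ⟨c, hc⟩
  rw [transports_toOEdge_iff] at h ⊢
  obtain ⟨u, hu, rfl, rfl⟩ := h
  exact ⟨_, hu.act g, rfl, rfl⟩

theorem inverse (h : Transports A e p q) {e' : OEdge EM M} (he : e.IsInverse e') :
    Transports A e' q p := by
  obtain ⟨c, rfl, rfl⟩ := he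
  rw [transports_toOEdge_iff] at h ⊢
  obtain ⟨u, hu, rfl, rfl⟩ := h
  refine ⟨fun t => u (1 + -1 * t), hu.precomp ?_ (by fun_prop) (fun t _ => rfl), by simp, by simp⟩
  exact fun t ht => ⟨by linarith [ht.2], by linarith [ht.1]⟩

end Transports

theorem exists_transports (A : B.Connection) (e : OEdge EM M) {p : P} (hp : B.proj p = e.source) :
    ∃ q, Transports A e p q := by
  obtain ⟨c, rfl⟩ : ∃ c : AnalyticPath EM M, c.toOEdge = e := Quotient.exists_rep e
  obtain ⟨u, hu, hu0⟩ := exists_isHorizontalLift A c hp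
  exact ⟨u 1, c, u, rfl, hu, hu0, rfl⟩

namespace Transports

variable {e e₁ e₂ : OEdge EM M} {p q q' r : P}

/-- A lift over the whole path restricts to lifts over the two parts, and uniqueness of transport
identifies these with the given ones. -/
theorem comp (h₁ : Transports A e₁ p q) (h₂ : Transports A e₂ q r)
    (h : OEdge.IsComposition e₁ e₂ e) : Transports A e p r := by
  obtain ⟨c, s, hs, rfl, rfl, rfl⟩ := h
  have hp : B.proj p = c 0 := by
    have := h₁.proj_left
    change B.proj p = c (0 + s * 0) at this
    simpa using this
  obtain ⟨u, hu, rfl⟩ := exists_isHorizontalLift A c hp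
  have hu' := IsLiftOn.of_isHorizontalLift hu
  have e1 : Transports A (c.initialPart s hs).toOEdge (u 0) (u s) := by
    rw [transports_toOEdge_iff]
    refine ⟨fun t => u (0 + s * t), hu'.precomp ?_ (by fun_prop) (fun t _ => rfl), by simp, by simp⟩
    exact fun t ht => ⟨by nlinarith [ht.1, hs.1], by nlinarith [ht.2, hs.1, hs.2]⟩
  have e2 : Transports A (c.finalPart s hs).toOEdge (u s) (u 1) := by
    rw [transports_toOEdge_iff]
    refine ⟨fun t => u (s + (1 - s) * t), hu'.precomp ?_ (by fun_prop) (fun t _ => rfl),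
      by simp, by simp⟩
    exact fun t ht => ⟨by nlinarith [ht.1, hs.1, hs.2], by nlinarith [ht.2, hs.1, hs.2]⟩
  obtain rfl := h₁.unique e1
  obtain rfl := h₂.unique e2
  exact ⟨c, u, rfl, hu, rfl, rfl⟩

end Transports

/-- Transport along the reversed edge is a two-sided inverse, and translates of horizontal lifts are
horizontal, which gives equivariance. -/
theorem exists_fibreIso (A : B.Connection) (e : OEdge EM M) :
    ∃ F : B.FibreIso e.source e.target, ∀ p : B.Fibre e.source,
      Transports A e p.1 (F.toEquiv p).1 := by
  choose f hf using fun p : B.Fibre e.source => exists_transports A e p.2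
  obtain ⟨e', he'⟩ := OEdge.exists_isInverse e
  have hsrc : e'.source = e.target := by
    obtain ⟨c, rfl, rfl⟩ := he'
    change c (1 + -1 * 0) = c 1
    simp
  have htgt : e'.target = e.source := by
    obtain ⟨c, rfl, rfl⟩ := he'
    change c (1 + -1 * 1) = c 0
    simp
  let F : B.Fibre e.source → B.Fibre e.target := fun p => ⟨f p, (hf p).proj_right⟩
  have hbij : Function.Bijective F := by
    constructor
    · intro p p' h
      have h1 : f p = f p' := congrArg Subtype.val h
      have h2 := (hf p).inverse he'
      have h3 := (hf p').inverse he'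
      rw [← h1] at h3
      exact Subtype.ext (h2.unique h3)
    · intro q
      obtain ⟨p, hp⟩ := exists_transports A e' (p := q.1) (q.2.trans hsrc.symm)
      have hp' : Transports A e p q.1 := by
        have hpp := hp.proj_right.trans htgt
        have h4 := hf ⟨p, hpp⟩
        have h5 := h4.inverse he'
        obtain ⟨c, rfl, rfl⟩ := he'
        have hrev : (c.reverse.toOEdge).IsInverse c.toOEdge := by
          refine ⟨c.reverse, rfl, congrArg AnalyticPath.toOEdge ?_⟩
          obtain ⟨c, h, h'⟩ := c
          change AnalyticPath.mk _ _ _ = AnalyticPath.mk _ _ _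
          congr 1
          funext t
          change c t = c (1 + -1 * (1 + -1 * t))
          ring_nf
        exact hp.inverse hrev
      exact ⟨⟨p, hp'.proj_left⟩, Subtype.ext ((hf _).unique hp')⟩
  refine ⟨⟨Equiv.ofBijective F hbij, fun p g => ?_⟩, hf⟩
  exact Subtype.ext ((hf _).unique ((hf p).act g))

/-- The parallel transport along an edge, as an isomorphism of fibres. -/
noncomputable def transport (A : B.Connection) (e : OEdge EM M) : B.FibreIso e.source e.target :=
  (exists_fibreIso A e).choose

theorem transports_transport (A : B.Connection) (e : OEdge EM M) (p : B.Fibre e.source) :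
    Transports A e p.1 ((transport A e).toEquiv p).1 :=
  (exists_fibreIso A e).choose_spec p

theorem transport_eq_of_forall {A : B.Connection} {e : OEdge EM M}
    {F : B.FibreIso e.source e.target} (h : ∀ p, Transports A e p.1 (F.toEquiv p).1) :
    transport A e = F :=
  FibreIso.ext' fun p => Subtype.ext ((transports_transport A e p).unique (h p))

theorem transports_iff_of_transport_eq {A A' : B.Connection} {e : OEdge EM M}
    (h : transport A e = transport A' e) {p q : P} :
    Transports A e p q ↔ Transports A' e p q := by
  constructor
  · intro hpq
    have h1 := transports_transport A e ⟨p, hpq.proj_left⟩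
    rw [hpq.unique h1, h]
    exact transports_transport A' e ⟨p, hpq.proj_left⟩
  · intro hpq
    have h1 := transports_transport A' e ⟨p, hpq.proj_left⟩
    rw [hpq.unique h1, ← h]
    exact transports_transport A e ⟨p, hpq.proj_left⟩

/-- The generalised parallel transport of a connection. -/
noncomputable def Connection.genTransport (A : B.Connection) : B.GenTransport where
  iso := transport A
  iso_inverse e e' he p q hq := by
    have h1 := (transports_transport A e p).inverse he
    rw [← hq] at h1
    exact (transports_transport A e' q).unique h1
  iso_comp e₁ e₂ e he p₁ p₂ p hp hp₂ := by
    have h1 := transports_transport A e₁ p₁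
    rw [← hp, ← hp₂] at h1
    exact (transports_transport A e p).unique (h1.comp (transports_transport A e₂ p₂) he)

end PrincipalBundle

/-! ## Analytic paths -/

section EventuallyConst

/-- Either the function vanishes near `s`, or `s` is at most an isolated zero and the intermediate
value theorem fixes the sign on each side. The dichotomies are one-sided because the sign may change
at `s`. -/
theorem AnalyticAt.eventually_nonneg_or_eventually_neg {f : ℝ → ℝ} {s : ℝ} (hf : AnalyticAt ℝ f s) :
    ((∀ᶠ t in 𝓝[>] s, 0 ≤ f t) ∨ ∀ᶠ t in 𝓝[>] s, ¬ 0 ≤ f t) ∧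
    ((∀ᶠ t in 𝓝[<] s, 0 ≤ f t) ∨ ∀ᶠ t in 𝓝[<] s, ¬ 0 ≤ f t) := by
  have sign : ∀ I : Set ℝ, IsPreconnected I → ContinuousOn f I → (∀ t ∈ I, f t ≠ 0) →
      (∀ t ∈ I, 0 ≤ f t) ∨ ∀ t ∈ I, ¬ 0 ≤ f t := by
    intro I hI hc hne
    by_contra! h
    obtain ⟨⟨a, ha, hfa⟩, ⟨b, hb, hfb⟩⟩ := h
    obtain ⟨x, hx, hx0⟩ := hI.intermediate_value ha hb hc ⟨hfa.le, hfb⟩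
    exact hne x hx hx0
  rcases hf.eventually_eq_zero_or_eventually_ne_zero with h | h
  · have h' : ∀ᶠ t in 𝓝 s, 0 ≤ f t := h.mono fun t ht => ht.ge
    exact ⟨Or.inl (nhdsWithin_le_nhds h'), Or.inl (nhdsWithin_le_nhds h')⟩
  · have h2 : ∀ᶠ t in 𝓝 s, ContinuousAt f t ∧ (t ≠ s → f t ≠ 0) :=
      (hf.eventually_analyticAt.mono fun t ht => ht.continuousAt).and
        (eventually_nhdsWithin_iff.1 h)
    obtain ⟨δ, hδ, hb⟩ := Metric.eventually_nhds_iff_ball.1 h2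
    rw [Real.ball_eq_Ioo] at hb
    have r1 : Ioo s (s + δ) ∈ 𝓝[>] s := Ioo_mem_nhdsGT (by linarith)
    have r2 : Ioo (s - δ) s ∈ 𝓝[<] s := Ioo_mem_nhdsLT (by linarith)
    have m1 : ∀ t ∈ Ioo s (s + δ), t ∈ Ioo (s - δ) (s + δ) := fun t ht =>
      ⟨by linarith [ht.1], ht.2⟩
    have m2 : ∀ t ∈ Ioo (s - δ) s, t ∈ Ioo (s - δ) (s + δ) := fun t ht =>
      ⟨ht.1, by linarith [ht.2]⟩
    exact ⟨(sign _ isPreconnected_Ioo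
        (fun t ht => (hb t (m1 t ht)).1.continuousWithinAt)
        (fun t ht => (hb t (m1 t ht)).2 ht.1.ne')).imp
          (fun h => mem_of_superset r1 h) (fun h => mem_of_superset r1 h),
      (sign _ isPreconnected_Ioo
        (fun t ht => (hb t (m2 t ht)).1.continuousWithinAt)
        (fun t ht => (hb t (m2 t ht)).2 ht.2.ne)).imp
          (fun h => mem_of_superset r2 h) (fun h => mem_of_superset r2 h)⟩

theorem eventually_or_eventually_not_and {l : Filter ℝ} {p q : ℝ → Prop}
    (hp : (∀ᶠ t in l, p t) ∨ ∀ᶠ t in l, ¬ p t) (hq : (∀ᶠ t in l, q t) ∨ ∀ᶠ t in l, ¬ q t) :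
    (∀ᶠ t in l, p t ∧ q t) ∨ ∀ᶠ t in l, ¬ (p t ∧ q t) := by
  rcases hp with hp | hp
  · rcases hq with hq | hq
    · exact Or.inl (hp.and hq)
    · exact Or.inr (hq.mono fun t ht h => ht h.2)
  · exact Or.inr (hp.mono fun t ht h => ht h.1)

/-- Points of the open set `U` near `s` have a whole neighbourhood inside `S` or inside its
complement. It is applied with `U` a half-line ending at `s`, or the whole line. -/
theorem eventually_notMem_frontier {S U : Set ℝ} (hU : IsOpen U) {s : ℝ}
    (h : (∀ᶠ t in 𝓝[U] s, t ∈ S) ∨ ∀ᶠ t in 𝓝[U] s, t ∉ S) : ∀ᶠ t in 𝓝[U] s, t ∉ frontier S := by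
  rcases h with h | h
  · rw [← eventually_eventually_nhdsWithin] at h
    filter_upwards [h, self_mem_nhdsWithin] with t ht htU hf
    rw [hU.nhdsWithin_eq htU] at ht
    exact hf.2 (mem_interior_iff_mem_nhds.2 ht)
  · rw [← eventually_eventually_nhdsWithin] at h
    filter_upwards [h, self_mem_nhdsWithin] with t ht htU hf
    rw [hU.nhdsWithin_eq htU] at ht
    rw [← frontier_compl] at hf
    exact hf.2 (mem_interior_iff_mem_nhds.2 ht)

/-- Each point of `K` has a neighbourhood meeting `F` at most in that point, and finitely many of
these neighbourhoods cover `K`. -/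
theorem IsCompact.finite_of_forall_nhdsNE {K F : Set ℝ} (hK : IsCompact K)
    (h : ∀ s ∈ K, ∀ᶠ t in 𝓝[≠] s, t ∉ F) : (F ∩ K).Finite := by
  have h' : ∀ s ∈ K, {t | t ≠ s → t ∉ F} ∈ 𝓝 s := fun s hs => eventually_nhdsWithin_iff.1 (h s hs)
  obtain ⟨T, hT, hcov⟩ := hK.elim_nhds_subcover _ h'
  refine T.finite_toSet.subset fun t ht => ?_
  obtain ⟨s, hs, hst⟩ := mem_iUnion₂.1 (hcov ht.2)
  by_contra hne
  exact hst (fun e => hne (e ▸ hs)) ht.1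

/-- A function on `[0,1]` which is locally the restriction of analytic functions extends to an
analytic function on a neighbourhood of `[0,1]`. -/
theorem exists_analyticOnNhd_Icc {f : ℝ → ℝ}
    (hf : ∀ t ∈ Icc (0 : ℝ) 1, ∃ g, AnalyticAt ℝ g t ∧ f =ᶠ[𝓝[Icc 0 1] t] g) :
    ∃ f', AnalyticOnNhd ℝ f' (Icc 0 1) ∧ EqOn f' f (Icc 0 1) := by
  obtain ⟨g₀, hg₀, he₀⟩ := hf 0 (by simp)
  obtain ⟨g₁, hg₁, he₁⟩ := hf 1 (by simp)
  -- Only the end points require an extension: beyond them the function is continued by the analytic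
  -- germs found there.
  refine ⟨fun t => if t < 0 then g₀ t else if 1 < t then g₁ t else f t, ?_, ?_⟩
  · intro t ht
    obtain ⟨g, hg, he⟩ := hf t ht
    rw [EventuallyEq, eventually_nhdsWithin_iff] at he he₀ he₁
    rcases ht.1.eq_or_lt with h0 | h0
    · subst h0
      refine hg₀.congr ?_
      filter_upwards [he₀, Iio_mem_nhds (zero_lt_one (α := ℝ))] with s hs hs1
      rcases lt_or_ge s 0 with h | h
      · simp [h]
      · have hs1' : ¬ 1 < s := not_lt.2 (le_of_lt hs1)
        simp [h.not_gt, hs1', hs ⟨h, le_of_lt hs1⟩]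
    rcases ht.2.eq_or_lt with h1 | h1
    · subst h1
      refine hg₁.congr ?_
      filter_upwards [he₁, Ioi_mem_nhds (zero_lt_one (α := ℝ))] with s hs hs1
      have hs0 : ¬ s < 0 := not_lt.2 (le_of_lt hs1)
      rcases lt_or_ge 1 s with h | h
      · simp [h, hs0]
      · simp [h.not_gt, hs0, hs ⟨le_of_lt hs1, h⟩]
    · refine hg.congr ?_
      filter_upwards [he, Ioo_mem_nhds h0 h1] with s hs hs1
      simp [hs1.1.not_gt, hs1.2.not_gt, hs ⟨hs1.1.le, hs1.2.le⟩]
  · intro t ht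
    simp [ht.1.not_gt, ht.2.not_gt]

end EventuallyConst

/-! ### Embedded analytic edges: local parameters and intersections. -/

namespace AnalyticPath

variable {EM : Type*} [NormedAddCommGroup EM] [NormedSpace ℝ EM]
  {M : Type*} [TopologicalSpace M] [ChartedSpace EM M]

theorem isCompact_image (c : AnalyticPath EM M) : IsCompact c.image :=
  isCompact_Icc.image_of_continuousOn c.continuousOn

theorem mem_image {c : AnalyticPath EM M} {t : ℝ} (ht : t ∈ Icc (0 : ℝ) 1) : c t ∈ c.image :=
  mem_image_of_mem _ ht

/-- The part of the edge with parameters away from `t` is compact and misses `c t`, so it also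
misses a neighbourhood of `c t`. -/
theorem eventually_mem_of_injOn [T2Space M] {c : AnalyticPath EM M} (hc : InjOn c (Icc 0 1)) {t : ℝ}
    (ht : t ∈ Icc (0 : ℝ) 1) {N : Set ℝ} (hN : N ∈ 𝓝 t) :
    ∀ᶠ x in 𝓝 (c t), ∀ s ∈ Icc (0 : ℝ) 1, c s = x → s ∈ N := by
  obtain ⟨O, hON, hO, htO⟩ := mem_nhds_iff.1 hN
  have hK : IsCompact (c '' (Icc 0 1 \ O)) :=
    (isCompact_Icc.diff hO).image_of_continuousOn (c.continuousOn.mono sdiff_subset)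
  have hmem : c t ∉ c '' (Icc 0 1 \ O) := by
    rintro ⟨s, hs, hst⟩
    exact hs.2 (hc hs.1 ht hst ▸ htO)
  filter_upwards [hK.isClosed.isOpen_compl.mem_nhds hmem] with x hx s hs hsx
  by_contra hsN
  exact hx ⟨s, ⟨hs, fun h => hsN (hON h)⟩, hsx⟩

variable [IsManifold 𝓘(ℝ, EM) ω M]

theorem analyticAt_chart (c : AnalyticPath EM M) (x : M) {t : ℝ} (ht : t ∈ Icc (0 : ℝ) 1)
    (hx : c t ∈ (chartAt EM x).source) :
    AnalyticAt ℝ (fun s => extChartAt 𝓘(ℝ, EM) x (c s)) t := by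
  have h : ContMDiffAt 𝓘(ℝ, ℝ) 𝓘(ℝ, EM) ω (fun s => extChartAt 𝓘(ℝ, EM) x (c s)) t :=
    ContMDiffAt.comp (g := extChartAt 𝓘(ℝ, EM) x) t (contMDiffAt_extChartAt' hx) (c.analytic' t ht)
  exact contMDiffAt_iff_contDiffAt.1 h |>.analyticAt

theorem exists_hasDerivAt_chart (c : AnalyticPath EM M) {t : ℝ} (ht : t ∈ Icc (0 : ℝ) 1) :
    ∃ ξ : EM, ξ ≠ 0 ∧ HasDerivAt (fun s => extChartAt 𝓘(ℝ, EM) (c t) (c s)) ξ t := by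
  have : IsManifold 𝓘(ℝ, EM) 1 M := IsManifold.of_le (n := ω) le_top
  have h1 := HasVelWithinAt.of_mdifferentiableAt (S := univ) (c.mdifferentiableAt ht)
  have h2 := h1.comp (mdifferentiableAt_extChartAt (I := 𝓘(ℝ, EM)) (mem_chart_source EM (c t)))
  rw [HasVelWithinAt.iff_hasDerivWithinAt, hasDerivWithinAt_univ] at h2
  refine ⟨_, ?_, h2⟩
  intro h0
  have hinj : Function.Injective
      (modelDeriv EM EM (extChartAt 𝓘(ℝ, EM) (c t)) (c t)) :=
    (isInvertible_mfderiv_extChartAt (I := 𝓘(ℝ, EM)) (mem_extChartAt_source (c t))).injective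
  exact c.immersion' t ht ((map_eq_zero_iff _ hinj).1 h0)

/-- An analytic path has local analytic left inverses. -/
theorem exists_leftInverse (c : AnalyticPath EM M) {t : ℝ} (ht : t ∈ Icc (0 : ℝ) 1) :
    ∃ θ : M → ℝ, ContMDiffAt 𝓘(ℝ, EM) 𝓘(ℝ, ℝ) ω θ (c t) ∧ ∀ᶠ s in 𝓝 t, θ (c s) = s := by
  obtain ⟨ξ, hξ, hd⟩ := c.exists_hasDerivAt_chart ht
  -- A functional `ℓ` not vanishing on the velocity turns the path, read in a chart, into a real
  -- analytic function with nonzero derivative. Its local inverse after `ℓ` and the chart is the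
  -- required `θ`.
  obtain ⟨ℓ, hℓ⟩ := SeparatingDual.exists_ne_zero (R := ℝ) hξ
  have ha : AnalyticAt ℝ (fun s => ℓ (extChartAt 𝓘(ℝ, EM) (c t) (c s))) t :=
    ℓ.analyticAt _ |>.comp (c.analyticAt_chart (c t) ht (mem_chart_source EM _))
  have hd' : HasDerivAt (fun s => ℓ (extChartAt 𝓘(ℝ, EM) (c t) (c s))) (ℓ ξ) t :=
    ℓ.hasFDerivAt.comp_hasDerivAt t hd
  have hne : deriv (fun s => ℓ (extChartAt 𝓘(ℝ, EM) (c t) (c s))) t ≠ 0 := by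
    rw [hd'.deriv]; exact hℓ
  refine ⟨fun x => ha.hasStrictDerivAt.localInverse _ _ _ hne
    (ℓ (extChartAt 𝓘(ℝ, EM) (c t) x)), ?_, ?_⟩
  · have h1 : ContMDiffAt 𝓘(ℝ, ℝ) 𝓘(ℝ, ℝ) ω (ha.hasStrictDerivAt.localInverse _ _ _ hne)
        (ℓ (extChartAt 𝓘(ℝ, EM) (c t) (c t))) :=
      (ha.analyticAt_localInverse hne).contDiffAt.contMDiffAt
    have h2 : ContMDiffAt 𝓘(ℝ, EM) 𝓘(ℝ, ℝ) ω
        (fun x => ℓ (extChartAt 𝓘(ℝ, EM) (c t) x)) (c t) :=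
      ContMDiffAt.comp (g := ℓ) (c t) ℓ.contDiff.contMDiff.contMDiffAt contMDiffAt_extChartAt
    exact h1.comp (c t) h2
  · exact HasStrictDerivAt.eventually_left_inverse ha.hasStrictDerivAt hne

/-- Injectivity excludes other strands of the edge near `c t`. Thus `θ` is an analytic function on
the manifold which recovers the parameter of every nearby point of the edge. -/
theorem exists_leftInverse_of_injOn [T2Space M] {c : AnalyticPath EM M}
    (hc : InjOn c (Icc 0 1)) {t : ℝ} (ht : t ∈ Icc (0 : ℝ) 1) :
    ∃ θ : M → ℝ, ContMDiffAt 𝓘(ℝ, EM) 𝓘(ℝ, ℝ) ω θ (c t) ∧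
      ∀ᶠ x in 𝓝 (c t), ∀ s ∈ Icc (0 : ℝ) 1, c s = x → θ x = s := by
  obtain ⟨θ, hθ, h⟩ := c.exists_leftInverse ht
  refine ⟨θ, hθ, (eventually_mem_of_injOn hc ht h).mono ?_⟩
  rintro x hx s hs rfl
  exact hx s hs rfl

theorem exists_injOn_nhds (c : AnalyticPath EM M) {t : ℝ} (ht : t ∈ Icc (0 : ℝ) 1) :
    ∃ δ > 0, InjOn c (Metric.ball t δ) := by
  obtain ⟨θ, -, h⟩ := c.exists_leftInverse ht
  obtain ⟨δ, hδ, hb⟩ := Metric.eventually_nhds_iff_ball.1 h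
  refine ⟨δ, hδ, fun s hs r hr hsr => ?_⟩
  rw [← hb s hs, hsr, hb r hr]

/-- The parameter of `d t` on `c` is unique by injectivity. Locally it is `θ ∘ d` with an analytic
left inverse `θ` of `c`, hence it is analytic up to the end points. -/
theorem exists_analytic_lift [T2Space M] {c d : AnalyticPath EM M} (hc : InjOn c (Icc 0 1))
    (hdc : d.image ⊆ c.image) :
    ∃ f : ℝ → ℝ, AnalyticOnNhd ℝ f (Icc 0 1) ∧ MapsTo f (Icc 0 1) (Icc 0 1) ∧
      ∀ t ∈ Icc (0 : ℝ) 1, d t = c (f t) := by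
  have hex : ∀ t, ∃ s, t ∈ Icc (0 : ℝ) 1 → s ∈ Icc (0 : ℝ) 1 ∧ c s = d t := by
    intro t
    by_cases ht : t ∈ Icc (0 : ℝ) 1
    · obtain ⟨s, hs, h⟩ := hdc (mem_image ht)
      exact ⟨s, fun _ => ⟨hs, h⟩⟩
    · exact ⟨0, fun h => absurd h ht⟩
  choose f₀ hf₀ using hex
  obtain ⟨f, hf, he⟩ := exists_analyticOnNhd_Icc (f := f₀) (by
    intro t ht
    obtain ⟨hs, hcs⟩ := hf₀ t ht
    obtain ⟨θ, hθ, hev⟩ := exists_leftInverse_of_injOn hc hs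
    rw [hcs] at hθ hev
    refine ⟨fun r => θ (d r), ?_, ?_⟩
    · have : ContMDiffAt 𝓘(ℝ, ℝ) 𝓘(ℝ, ℝ) ω (fun r => θ (d r)) t :=
        ContMDiffAt.comp (g := θ) t hθ (d.analytic' t ht)
      exact (contMDiffAt_iff_contDiffAt.1 this).analyticAt
    · have h1 := nhdsWithin_le_nhds (s := Icc 0 1) ((d.continuousAt ht).eventually hev)
      filter_upwards [h1, self_mem_nhdsWithin] with r hr hrI
      exact (hr _ (hf₀ r hrI).1 (hf₀ r hrI).2).symm)
  refine ⟨f, hf, fun t ht => ?_, fun t ht => ?_⟩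
  · rw [he ht]; exact (hf₀ t ht).1
  · rw [he ht]; exact (hf₀ t ht).2.symm

/-- Two embedded edges with the same image agree as unoriented edges. -/
theorem toUEdge_eq_of_image_eq [T2Space M] {c d : AnalyticPath EM M} (hc : InjOn c (Icc 0 1))
    (hd : InjOn d (Icc 0 1)) (h : c.image = d.image) : c.toUEdge = d.toUEdge := by
  obtain ⟨f, hf, hfm, hfe⟩ := exists_analytic_lift hc h.ge
  obtain ⟨g, hg, hgm, hge⟩ := exists_analytic_lift hd h.le
  refine Quotient.sound ⟨f, g, ⟨hf, hg, hfm, hgm, fun t ht => ?_, fun t ht => ?_⟩, hfe⟩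
  · exact hd (hgm (hfm ht)) ht (by rw [← hge _ (hfm ht), ← hfe t ht])
  · exact hc (hfm (hgm ht)) ht (by rw [← hfe _ (hgm ht), ← hge t ht])

/-- The set of times at which a path runs in an embedded edge has only finitely many frontier
points. -/
theorem finite_frontier [T2Space M] (c : AnalyticPath EM M) {d : AnalyticPath EM M}
    (hd : InjOn d (Icc 0 1)) : (frontier {s | c s ∈ d.image} ∩ Icc 0 1).Finite := by
  refine isCompact_Icc.finite_of_forall_nhdsNE fun s hs => ?_
  by_cases hsd : c s ∈ d.image
  · obtain ⟨t, ht, hts⟩ := hsd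
    obtain ⟨θ, hθ, hev⟩ := exists_leftInverse_of_injOn hd ht
    have hev' := hev
    rw [hts] at hθ hev
    have hθs : θ (c s) = t := hev.self_of_nhds t ht hts
    have hm : AnalyticAt ℝ (fun r => θ (c r)) s := by
      have : ContMDiffAt 𝓘(ℝ, ℝ) 𝓘(ℝ, ℝ) ω (fun r => θ (c r)) s :=
        ContMDiffAt.comp (g := θ) s hθ (c.analytic' s hs)
      exact (contMDiffAt_iff_contDiffAt.1 this).analyticAt
    have hdm : AnalyticAt ℝ (fun r => extChartAt 𝓘(ℝ, EM) (c s) (d (θ (c r)))) s := by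
      have h1 := d.analyticAt_chart (c s) ht (by rw [hts]; exact mem_chart_source EM _)
      rw [← hθs] at h1
      exact AnalyticAt.fun_comp (g := fun q => extChartAt 𝓘(ℝ, EM) (c s) (d q)) h1 hm
    have hcm := c.analyticAt_chart (c s) hs (mem_chart_source EM _)
    have hcsrc : ∀ᶠ r in 𝓝 s, c r ∈ (extChartAt 𝓘(ℝ, EM) (c s)).source :=
      (c.continuousAt hs) (extChartAt_source_mem_nhds (I := 𝓘(ℝ, EM)) (c s))
    have hdsrc : ∀ᶠ r in 𝓝 s, d (θ (c r)) ∈ (extChartAt 𝓘(ℝ, EM) (c s)).source := by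
      have h1 : ContinuousAt (fun r => d (θ (c r))) s := by
        refine ContinuousAt.comp (g := d) ?_ hm.continuousAt
        rw [hθs]; exact d.continuousAt ht
      refine h1 ?_
      beta_reduce
      rw [hθs, hts]
      exact extChartAt_source_mem_nhds (I := 𝓘(ℝ, EM)) (c s)
    -- Near `s`, lying on `d` amounts to two analytic inequalities, saying that the candidate
    -- parameter `θ (c r)` is in `[0,1]`, and one analytic equation, saying that `d` takes the value
    -- `c r` there. Each of them is eventually constant in truth value on either side of `s`.
    have hiff : ∀ᶠ r in 𝓝 s, (c r ∈ d.image ↔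
        (0 ≤ θ (c r) ∧ 0 ≤ 1 - θ (c r)) ∧
          extChartAt 𝓘(ℝ, EM) (c s) (d (θ (c r))) = extChartAt 𝓘(ℝ, EM) (c s) (c r)) := by
      filter_upwards [hcsrc, hdsrc, (c.continuousAt hs).eventually hev] with r h1 h2 h3
      constructor
      · rintro ⟨q, hq, hqr⟩
        have h4 := h3 q hq hqr
        rw [h4, hqr]
        exact ⟨⟨hq.1, by linarith [hq.2]⟩, rfl⟩
      · rintro ⟨⟨h4, h5⟩, h6⟩
        exact ⟨θ (c r), ⟨h4, by linarith⟩, (extChartAt 𝓘(ℝ, EM) (c s)).injOn h2 h1 h6⟩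
    have c1 := hm.eventually_nonneg_or_eventually_neg
    have c2 := (analyticAt_const (v := (1 : ℝ)).sub hm).eventually_nonneg_or_eventually_neg
    have c3 := hdm.eventually_eq_or_eventually_ne hcm
    have c3' : ∀ l : Filter ℝ, l ≤ 𝓝[≠] s →
        (∀ᶠ r in l, extChartAt 𝓘(ℝ, EM) (c s) (d (θ (c r))) = extChartAt 𝓘(ℝ, EM) (c s) (c r)) ∨
        ∀ᶠ r in l,
          ¬ extChartAt 𝓘(ℝ, EM) (c s) (d (θ (c r))) = extChartAt 𝓘(ℝ, EM) (c s) (c r) := by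
      intro l hl
      exact c3.imp (fun h => (hl.trans nhdsWithin_le_nhds) h) (fun h => hl h)
    have conv : ∀ l : Filter ℝ, l ≤ 𝓝 s →
        ((∀ᶠ r in l, (0 ≤ θ (c r) ∧ 0 ≤ 1 - θ (c r)) ∧
          extChartAt 𝓘(ℝ, EM) (c s) (d (θ (c r))) = extChartAt 𝓘(ℝ, EM) (c s) (c r)) ∨
        ∀ᶠ r in l, ¬ ((0 ≤ θ (c r) ∧ 0 ≤ 1 - θ (c r)) ∧
          extChartAt 𝓘(ℝ, EM) (c s) (d (θ (c r))) = extChartAt 𝓘(ℝ, EM) (c s) (c r))) →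
        ((∀ᶠ r in l, r ∈ {s | c s ∈ d.image}) ∨ ∀ᶠ r in l, r ∉ {s | c s ∈ d.image}) := by
      intro l hl h
      refine h.imp (fun h => ?_) (fun h => ?_)
      · filter_upwards [h, hl hiff] with r h1 h2 using h2.2 h1
      · filter_upwards [h, hl hiff] with r h1 h2 h3 using h1 (h2.1 h3)
    rw [← Iio_union_Ioi, nhdsWithin_union, eventually_sup]
    refine ⟨eventually_notMem_frontier isOpen_Iio (conv _ nhdsWithin_le_nhds ?_),
      eventually_notMem_frontier isOpen_Ioi (conv _ nhdsWithin_le_nhds ?_)⟩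
    · exact eventually_or_eventually_not_and (eventually_or_eventually_not_and c1.2 c2.2)
        (c3' _ (nhdsWithin_mono s fun r hr => ne_of_lt hr))
    · exact eventually_or_eventually_not_and (eventually_or_eventually_not_and c1.1 c2.1)
        (c3' _ (nhdsWithin_mono s fun r hr => ne_of_gt hr))
  · have h1 : ∀ᶠ r in 𝓝 s, c r ∉ d.image :=
      (c.continuousAt hs) (d.isCompact_image.isClosed.isOpen_compl.mem_nhds hsd)
    have h2 := eventually_notMem_frontier (S := {s | c s ∈ d.image}) (s := s) isOpen_univ
      (Or.inr (by rw [nhdsWithin_univ]; exact h1))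
    rw [nhdsWithin_univ] at h2
    exact nhdsWithin_le_nhds h2

end AnalyticPath

/-! ## Gauge transformations and parallel transport along an edge -/

/-- The closed set `K` stays explicit so that objects defined only on `U` can be multiplied by the
cutoff and continued trivially outside `K`. -/
theorem exists_contMDiff_cutoff {EM : Type*} [NormedAddCommGroup EM] [NormedSpace ℝ EM]
    [FiniteDimensional ℝ EM] {M : Type*} [TopologicalSpace M] [ChartedSpace EM M]
    [IsManifold 𝓘(ℝ, EM) ∞ M] [T2Space M] [SecondCountableTopology M] {C U : Set M}
    (hC : IsClosed C) (hU : IsOpen U) (hCU : C ⊆ U) :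
    ∃ (χ : M → ℝ) (K : Set M), ContMDiff 𝓘(ℝ, EM) 𝓘(ℝ, ℝ) ∞ χ ∧ IsClosed K ∧ K ⊆ U ∧
      (∀ x ∈ C, χ x = 1) ∧ (∀ x ∉ K, χ x = 0) ∧ ∀ x, χ x ∈ Icc (0 : ℝ) 1 := by
  have : LocallyCompactSpace M := Manifold.locallyCompact_of_finiteDimensional 𝓘(ℝ, EM)
  obtain ⟨V, hV, hCV, hVU⟩ := normal_exists_closure_subset hC hU hCU
  obtain ⟨f, h1, h0, hf⟩ := exists_contMDiffMap_one_nhds_of_subset_interior (n := (⊤ : ℕ∞)) 𝓘(ℝ, EM) hC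
    (hCV.trans (hV.subset_interior_iff.2 subset_closure))
  exact ⟨f, closure V, f.contMDiff, isClosed_closure, hVU,
    fun x hx => (eventually_nhdsSet_iff_forall.1 h1 x hx).self_of_nhds, h0, hf⟩

theorem IsReparam.ends {f g : ℝ → ℝ} (h : IsReparam f g) :
    (f 0 = 0 ∧ f 1 = 1) ∨ (f 0 = 1 ∧ f 1 = 0) := by
  have hc : ContinuousOn f (Icc 0 1) := fun t ht =>
    (h.analytic_fun t ht).continuousAt.continuousWithinAt
  have hi : InjOn f (Icc 0 1) := fun s hs t ht hst => by
    rw [← h.left_inv s hs, hst, h.left_inv t ht]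
  have h0 : (0 : ℝ) ∈ Icc (0 : ℝ) 1 := by simp
  have h1 : (1 : ℝ) ∈ Icc (0 : ℝ) 1 := by simp
  rcases hc.strictMonoOn_of_injOn_Icc' zero_le_one hi with hm | hm
  · exact Or.inl ⟨h.map_zero hm.monotoneOn, h.map_one hm.monotoneOn⟩
  · refine Or.inr ⟨?_, ?_⟩
    · have := hm.antitoneOn h0 (h.mapsTo_inv h1) (h.mapsTo_inv h1).1
      rw [h.right_inv 1 h1] at this
      exact le_antisymm (h.mapsTo_fun h0).2 this
    · have := hm.antitoneOn (h.mapsTo_inv h0) h1 (h.mapsTo_inv h0).2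
      rw [h.right_inv 0 h0] at this
      exact le_antisymm this (h.mapsTo_fun h1).1

namespace AnalyticPath

variable {EM : Type*} [NormedAddCommGroup EM] [NormedSpace ℝ EM]
  {M : Type*} [TopologicalSpace M] [ChartedSpace EM M]

theorem exists_reparam_of_toUEdge_eq {c c' : AnalyticPath EM M} (h : c.toUEdge = c'.toUEdge) :
    ∃ f g : ℝ → ℝ, IsReparam f g ∧ ∀ t ∈ Icc (0 : ℝ) 1, c' t = c (f t) :=
  Quotient.exact h

theorem ends_eq_of_toUEdge_eq {c c' : AnalyticPath EM M} (h : c.toUEdge = c'.toUEdge) :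
    c.ends = c'.ends := by
  obtain ⟨f, g, hfg, hcf⟩ := exists_reparam_of_toUEdge_eq h
  unfold ends
  rw [hcf 0 (by simp), hcf 1 (by simp)]
  rcases hfg.ends with ⟨h0, h1⟩ | ⟨h0, h1⟩
  · rw [h0, h1]
  · rw [h0, h1, pair_comm]

/-- The velocity of a path, as a vector of the model space. -/
noncomputable def vel (c : AnalyticPath EM M) (t : ℝ) : EM := modelDeriv ℝ EM c t 1

theorem hasVelWithinAt (c : AnalyticPath EM M) {t : ℝ} (ht : t ∈ Icc (0 : ℝ) 1) (S : Set ℝ) :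
    HasVelWithinAt c (c.vel t) S t :=
  HasVelWithinAt.of_mdifferentiableAt (c.mdifferentiableAt ht)

end AnalyticPath

namespace PrincipalBundle

variable {EM : Type*} [NormedAddCommGroup EM] [NormedSpace ℝ EM]
    {EG : Type*} [NormedAddCommGroup EG] [NormedSpace ℝ EG]
    {EP : Type*} [NormedAddCommGroup EP] [NormedSpace ℝ EP]
    {M : Type*} [TopologicalSpace M] [ChartedSpace EM M]
    {G : Type*} [TopologicalSpace G] [ChartedSpace EG G] [Group G]
    {P : Type*} [TopologicalSpace P] [ChartedSpace EP P]
    {B : PrincipalBundle EM EG EP M G P}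

namespace Gauge

/-- The identity gauge transformation. -/
noncomputable def refl (B : PrincipalBundle EM EG EP M G P) : B.Gauge where
  toDiffeo := Diffeomorph.refl 𝓘(ℝ, EP) P ∞
  proj_eq _ := rfl
  equivariant _ _ := rfl

/-- The composition of gauge transformations. -/
noncomputable def trans (Φ Ψ : B.Gauge) : B.Gauge where
  toDiffeo := Φ.toDiffeo.trans Ψ.toDiffeo
  proj_eq p := (Ψ.proj_eq _).trans (Φ.proj_eq p)
  equivariant p g := by
    change Ψ.toDiffeo (Φ.toDiffeo (B.act p g)) = B.act (Ψ.toDiffeo (Φ.toDiffeo p)) g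
    rw [Φ.equivariant, Ψ.equivariant]

theorem trans_apply (Φ Ψ : B.Gauge) (p : P) :
    (Φ.trans Ψ).toDiffeo p = Ψ.toDiffeo (Φ.toDiffeo p) := rfl

theorem mdifferentiableAt (Φ : B.Gauge) (p : P) :
    MDifferentiableAt 𝓘(ℝ, EP) 𝓘(ℝ, EP) Φ.toDiffeo p :=
  Φ.toDiffeo.contMDiff.mdifferentiable (by simp) p

theorem modelDeriv_proj (Φ : B.Gauge) (p : P) (v : EP) :
    modelDeriv EP EM B.proj (Φ.toDiffeo p) (modelDeriv EP EP Φ.toDiffeo p v) =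
      modelDeriv EP EM B.proj p v := by
  rw [← modelDeriv_comp (mdifferentiableAt_proj _) (Φ.mdifferentiableAt p)]
  congr 2
  funext q
  exact Φ.proj_eq q

theorem modelDeriv_act (Φ : B.Gauge) (p : P) (g : G) (v : EP) :
    modelDeriv EP EP Φ.toDiffeo (B.act p g) (modelDeriv EP EP (fun q => B.act q g) p v) =
      modelDeriv EP EP (fun q => B.act q g) (Φ.toDiffeo p) (modelDeriv EP EP Φ.toDiffeo p v) := by
  rw [← modelDeriv_comp (Φ.mdifferentiableAt _) (mdifferentiableAt_act_right g p),
    ← modelDeriv_comp (mdifferentiableAt_act_right g _) (Φ.mdifferentiableAt p)]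
  congr 2
  funext q
  exact Φ.equivariant q g

end Gauge

/-- The displacement in the fibres of the gauge transformation given by a function on the base. -/
def gaugeShift (τ : Bundle.Trivialization G B.proj) (κ : M → G) (p : P) : G :=
  (τ p).2⁻¹ * κ (B.proj p) * (τ p).2

/-! ### Gauge transformations supported over a trivialisation. -/

section GaugeShift

variable {τ : Bundle.Trivialization G B.proj} {κ κ' : M → G} {U K : Set M}

/-- This conjugation law makes `p ↦ B.act p (gaugeShift τ κ p)` equivariant. The values of `τ` are
meaningless outside its domain, but `κ = 1` there cancels them. -/
theorem gaugeShift_act (hτ : B.IsSmoothTriv τ) (hκ : ∀ x ∉ τ.baseSet, κ x = 1) (p : P) (g : G) :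
    gaugeShift τ κ (B.act p g) = g⁻¹ * gaugeShift τ κ p * g := by
  unfold gaugeShift
  rw [B.proj_act]
  by_cases hp : B.proj p ∈ τ.baseSet
  · rw [hτ.map_act _ (τ.mem_source.2 hp)]; group
  · rw [hκ _ hp]; group

theorem gaugeShift_cancel (hτ : B.IsSmoothTriv τ) (hκ : ∀ x ∉ τ.baseSet, κ x = 1)
    (h : ∀ x, κ x * κ' x = 1) (p : P) :
    B.act (B.act p (gaugeShift τ κ p)) (gaugeShift τ κ' (B.act p (gaugeShift τ κ p))) = p := by
  have hκ' : ∀ x ∉ τ.baseSet, κ' x = 1 := fun x hx => by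
    have := h x
    rwa [hκ x hx, one_mul] at this
  have h' : κ' (B.proj p) * κ (B.proj p) = 1 := by
    rw [mul_eq_one_iff_eq_inv.1 (h (B.proj p))]; group
  rw [gaugeShift_act hτ hκ', ← B.act_mul]
  have : gaugeShift τ κ p * ((gaugeShift τ κ p)⁻¹ * gaugeShift τ κ' p * gaugeShift τ κ p) = 1 := by
    calc _ = (τ p).2⁻¹ * (κ' (B.proj p) * κ (B.proj p)) * (τ p).2 := by
          unfold gaugeShift; group
      _ = 1 := by rw [h']; group
  rw [this, B.act_one]

variable [LieGroup 𝓘(ℝ, EG) ∞ G]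

theorem contMDiff_gaugeShift (hτ : B.IsSmoothTriv τ) (hU : IsOpen U) (hUτ : U ⊆ τ.baseSet)
    (hK : IsClosed K) (hKU : K ⊆ U) (hκ : ContMDiffOn 𝓘(ℝ, EM) 𝓘(ℝ, EG) ∞ κ U)
    (hκ1 : ∀ x ∉ K, κ x = 1) : ContMDiff 𝓘(ℝ, EP) 𝓘(ℝ, EG) ∞ (gaugeShift τ κ) := by
  intro p
  by_cases hp : B.proj p ∈ K
  · have h1 := hτ.contMDiffAt_snd (hUτ (hKU hp))
    have h2 : ContMDiffAt 𝓘(ℝ, EP) 𝓘(ℝ, EG) ∞ (fun q => κ (B.proj q)) p :=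
      ContMDiffAt.comp (g := κ) p (hκ.contMDiffAt (hU.mem_nhds (hKU hp)))
        B.contMDiff_proj.contMDiffAt
    exact (h1.inv.mul h2).mul h1
  · refine (contMDiffAt_const (c := (1 : G))).congr_of_eventuallyEq ?_
    filter_upwards [(hK.isOpen_compl.preimage B.contMDiff_proj.continuous).mem_nhds hp] with q hq
    unfold gaugeShift
    rw [hκ1 _ hq]; group

/-- The gauge transformation given, in a trivialisation, by a function on the base which is trivial
outside the domain of the trivialisation. -/
theorem exists_gauge (hτ : B.IsSmoothTriv τ) (hU : IsOpen U) (hUτ : U ⊆ τ.baseSet)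
    (hK : IsClosed K) (hKU : K ⊆ U) (hκ : ContMDiffOn 𝓘(ℝ, EM) 𝓘(ℝ, EG) ∞ κ U)
    (hκ1 : ∀ x ∉ K, κ x = 1) :
    ∃ Φ : B.Gauge, ∀ p, Φ.toDiffeo p = B.act p (gaugeShift τ κ p) := by
  have hs : ContMDiff 𝓘(ℝ, EP) 𝓘(ℝ, EP) ∞ (fun p => B.act p (gaugeShift τ κ p)) :=
    B.contMDiff_act.comp (contMDiff_id.prodMk (contMDiff_gaugeShift hτ hU hUτ hK hKU hκ hκ1))
  have hs' : ContMDiff 𝓘(ℝ, EP) 𝓘(ℝ, EP) ∞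
      (fun p => B.act p (gaugeShift τ (fun x => (κ x)⁻¹) p)) :=
    B.contMDiff_act.comp (contMDiff_id.prodMk (contMDiff_gaugeShift hτ hU hUτ hK hKU hκ.inv
      (fun x hx => by rw [hκ1 x hx, inv_one])))
  have hb : ∀ x ∉ τ.baseSet, κ x = 1 := fun x hx => hκ1 x fun h => hx (hUτ (hKU h))
  refine ⟨⟨⟨⟨fun p => B.act p (gaugeShift τ κ p), fun p => B.act p (gaugeShift τ (fun x => (κ x)⁻¹) p),
    fun p => gaugeShift_cancel hτ hb (fun x => mul_inv_cancel _) p,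
    fun p => gaugeShift_cancel hτ (fun x hx => by rw [hb x hx, inv_one])
      (fun x => inv_mul_cancel _) p⟩, hs, hs'⟩, fun p => B.proj_act _ _, fun p g => ?_⟩,
    fun p => rfl⟩
  change B.act (B.act p g) (gaugeShift τ κ (B.act p g)) = B.act (B.act p (gaugeShift τ κ p)) g
  rw [gaugeShift_act hτ hb, ← B.act_mul, ← B.act_mul]
  congr 1
  group

end GaugeShift

section EdgeEquiv

variable [IsManifold 𝓘(ℝ, EP) ∞ P]

/-- Holds by definition; the velocities and differentials become vectors and maps of the model
spaces, which avoids tangent spaces at points that are only provably equal. -/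
theorem edgeEquiv_iff {e : UEdge EM M} {A A' : B.Connection} :
    B.EdgeEquiv e A A' ↔ ∃ Φ : B.Gauge, ∀ c : AnalyticPath EM M, c.toUEdge = e →
      (∀ p, B.proj p ∈ c.ends → Φ.toDiffeo p = p) ∧
      ∀ t ∈ Icc (0 : ℝ) 1, ∀ p : P, B.proj p = c t → ∀ v : EP,
        (∃ r : ℝ, modelDeriv EP EM B.proj p v = r • c.vel t) →
        A'.horL (Φ.toDiffeo p) (modelDeriv EP EP Φ.toDiffeo p v) =
          modelDeriv EP EP Φ.toDiffeo p (A.horL p v) :=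
  Iff.rfl

end EdgeEquiv

/-! ### Gauge equivalence on an edge preserves parallel transport. -/

section TransportOfEdgeEquiv

variable [IsManifold 𝓘(ℝ, EM) ω M] [LieGroup 𝓘(ℝ, EG) ∞ G] [IsManifold 𝓘(ℝ, EP) ∞ P]
  [CompleteSpace EG]

/-- The gauge transformation carries a horizontal lift for `A` to one for `A'`: the velocity of a
lift projects to the velocity of `c`, so it is among the vectors controlled by `EdgeEquiv`. The end
points do not move. -/
theorem transports_of_edgeEquiv {c : AnalyticPath EM M} {A A' : B.Connection}
    (h : B.EdgeEquiv c.toUEdge A A') {p q : P} (hpq : Transports A c.toOEdge p q) :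
    Transports A' c.toOEdge p q := by
  obtain ⟨Φ, hΦ⟩ := edgeEquiv_iff.1 h
  obtain ⟨h1, h2⟩ := hΦ c rfl
  obtain ⟨u, hu, rfl, rfl⟩ := (transports_toOEdge_iff c).1 hpq
  rw [transports_toOEdge_iff]
  refine ⟨fun t => Φ.toDiffeo (u t), ⟨fun t ht => ?_, fun t ht => ?_⟩, ?_, ?_⟩
  · rw [Φ.proj_eq, hu.proj_eq t ht]
  · obtain ⟨α, hα, hαh⟩ := hu.exists_vel t ht
    refine ⟨_, hα.comp (Φ.mdifferentiableAt _), ?_⟩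
    rw [h2 t ht (u t) (hu.proj_eq t ht) α, hαh]
    refine ⟨1, ?_⟩
    rw [one_smul]
    refine (hα.comp (mdifferentiableAt_proj _)).unique
      ((c.hasVelWithinAt ht (Icc 0 1)).congr ?_ (hu.proj_eq t ht)) (uniqueDiffOn_Icc_zero_one t ht)
    filter_upwards [self_mem_nhdsWithin] with q hq using hu.proj_eq q hq
  · exact h1 _ (Or.inl (hu.proj_eq 0 (by simp)))
  · exact h1 _ (Or.inr (hu.proj_eq 1 (by simp)))

theorem transport_eq_of_edgeEquiv {c : AnalyticPath EM M} {A A' : B.Connection}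
    (h : B.EdgeEquiv c.toUEdge A A') : transport A c.toOEdge = transport A' c.toOEdge :=
  (transport_eq_of_forall fun p => transports_of_edgeEquiv h (transports_transport A _ p)).symm

end TransportOfEdgeEquiv

/-! ### Equal parallel transport implies gauge equivalence on an embedded edge. -/

section GaugeAlongEdge

variable [FiniteDimensional ℝ EM] [IsManifold 𝓘(ℝ, EM) ω M] [T2Space M]
  [SecondCountableTopology M] [LieGroup 𝓘(ℝ, EG) ∞ G]

/-- If two lifts of an embedded path agree up to time `s`, a gauge transformation makes them agree
a bit longer. -/
theorem exists_gauge_extend {c : AnalyticPath EM M} (hc : InjOn c (Icc 0 1)) {u v : ℝ → P}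
    (hu : ∀ t ∈ Icc (0 : ℝ) 1, B.proj (u t) = c t) (hv : ∀ t ∈ Icc (0 : ℝ) 1, B.proj (v t) = c t)
    {t₀ : ℝ} (ht₀ : t₀ ∈ Icc (0 : ℝ) 1)
    (hus : ∃ w : ℝ → P, (∀ᶠ t in 𝓝 t₀, ContMDiffAt 𝓘(ℝ, ℝ) 𝓘(ℝ, EP) ∞ w t) ∧
      ∀ᶠ t in 𝓝 t₀, t ∈ Icc (0 : ℝ) 1 → u t = w t)
    (hvs : ∃ w : ℝ → P, (∀ᶠ t in 𝓝 t₀, ContMDiffAt 𝓘(ℝ, ℝ) 𝓘(ℝ, EP) ∞ w t) ∧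
      ∀ᶠ t in 𝓝 t₀, t ∈ Icc (0 : ℝ) 1 → v t = w t) :
    ∃ δ > 0, ∀ s ∈ Ioo (t₀ - δ) (t₀ + δ), ∀ s' ∈ Ioo (t₀ - δ) (t₀ + δ), 0 ≤ s → s ≤ s' → s' ≤ 1 →
      ∀ Φ : B.Gauge, (∀ t ∈ Icc 0 s, Φ.toDiffeo (u t) = v t) →
      ∃ Ψ : B.Gauge, ∀ t ∈ Icc 0 s', Ψ.toDiffeo (u t) = v t := by
  have : IsManifold 𝓘(ℝ, EM) ∞ M := IsManifold.of_le (n := ω) le_top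
  obtain ⟨w, hws, huw⟩ := hus
  obtain ⟨z, hzs, hvz⟩ := hvs
  obtain ⟨τ, hτ0, hτ⟩ := B.exists_smoothTriv (c t₀)
  have hproj : ∀ {w u : ℝ → P}, (∀ t ∈ Icc (0 : ℝ) 1, B.proj (u t) = c t) →
      (∀ᶠ t in 𝓝 t₀, ContMDiffAt 𝓘(ℝ, ℝ) 𝓘(ℝ, EP) ∞ w t) →
      (∀ᶠ t in 𝓝 t₀, t ∈ Icc (0 : ℝ) 1 → u t = w t) →
      ∀ᶠ t in 𝓝 t₀, B.proj (w t) ∈ τ.baseSet := by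
    intro w u hu hws huw
    have h1 : ContinuousAt (fun t => B.proj (w t)) t₀ :=
      B.contMDiff_proj.continuous.continuousAt.comp hws.self_of_nhds.continuousAt
    refine h1 (τ.open_baseSet.mem_nhds ?_)
    change B.proj (w t₀) ∈ _
    rw [← huw.self_of_nhds ht₀, hu _ ht₀]
    exact hτ0
  obtain ⟨ρ, hρ, hball⟩ := Metric.eventually_nhds_iff_ball.1
    ((hws.and huw).and ((hzs.and hvz).and ((hproj hu hws huw).and (hproj hv hzs hvz))))
  rw [Real.ball_eq_Ioo] at hball
  set J := Ioo (t₀ - ρ) (t₀ + ρ) with hJ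
  have ht₀J : t₀ ∈ J := ⟨by linarith, by linarith⟩
  obtain ⟨θ, hθ, hθc⟩ := AnalyticPath.exists_leftInverse_of_injOn hc ht₀
  have hθ0 : θ (c t₀) = t₀ := hθc.self_of_nhds _ ht₀ rfl
  have hθs : ∀ᶠ x in 𝓝 (c t₀), ContMDiffAt 𝓘(ℝ, EM) 𝓘(ℝ, ℝ) ω θ x :=
    (contMDiffAt_iff_contMDiffAt_nhds (by simp)).1 hθ
  have hθJ : ∀ᶠ x in 𝓝 (c t₀), θ x ∈ J :=
    hθ.continuousAt (by rw [hθ0]; exact isOpen_Ioo.mem_nhds ht₀J)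
  obtain ⟨U, hUsub, hU, htU⟩ := eventually_nhds_iff.1
    ((hθs.and hθc).and (hθJ.and (τ.open_baseSet.mem_nhds hτ0)))
  have hcU : ∀ᶠ t in 𝓝 t₀, c t ∈ U := (c.continuousAt ht₀) (hU.mem_nhds htU)
  obtain ⟨δ', hδ', hδU⟩ := Metric.eventually_nhds_iff_ball.1 hcU
  rw [Real.ball_eq_Ioo] at hδU
  refine ⟨min δ' ρ, lt_min hδ' hρ, fun s hs s' hs' hs0 hss' hs1 Φ hΦ => ?_⟩
  have hsub : ∀ r ∈ Ioo (t₀ - min δ' ρ) (t₀ + min δ' ρ), r ∈ J ∧ r ∈ Ioo (t₀ - δ') (t₀ + δ') := by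
    intro r hr
    have h1 := min_le_left δ' ρ
    have h2 := min_le_right δ' ρ
    exact ⟨⟨by linarith [hr.1], by linarith [hr.2]⟩, ⟨by linarith [hr.1], by linarith [hr.2]⟩⟩
  have hsJ := (hsub s hs).1
  have hC : IsClosed (c '' Icc s s') := by
    refine IsCompact.isClosed (isCompact_Icc.image_of_continuousOn (c.continuousOn.mono ?_))
    exact Icc_subset_Icc hs0 hs1
  have hCU : c '' Icc s s' ⊆ U := by
    rintro _ ⟨r, hr, rfl⟩
    exact hδU r ⟨by linarith [(hsub s hs).2.1, hr.1], by linarith [(hsub s' hs').2.2, hr.2]⟩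
  obtain ⟨χ, K, hχ, hK, hKU, hχ1, hχ0, hχI⟩ := exists_contMDiff_cutoff (EM := EM) hC hU hCU
  -- In the trivialisation, left multiplication by `k t` carries `Φ (w t)` to `z t`. It is 1 on the
  -- times in `[0, s]`, where `Φ` already matches the two lifts.
  set k : ℝ → G := fun t => (τ (z t)).2 * (τ (Φ.toDiffeo (w t))).2⁻¹ with hk
  have hks : ContMDiffOn 𝓘(ℝ, ℝ) 𝓘(ℝ, EG) ∞ k J := by
    intro t ht
    obtain ⟨⟨h1, h2⟩, ⟨h3, h4⟩, h5, h6⟩ := hball t ht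
    refine ContMDiffAt.contMDiffWithinAt (ContMDiffAt.mul ?_ (ContMDiffAt.inv ?_))
    · exact ContMDiffAt.comp (g := fun q => (τ q).2) t (hτ.contMDiffAt_snd h6) h3
    · refine ContMDiffAt.comp (g := fun q => (τ q).2) t (hτ.contMDiffAt_snd ?_)
        (ContMDiffAt.comp (g := Φ.toDiffeo) t Φ.toDiffeo.contMDiff.contMDiffAt h1)
      rwa [Φ.proj_eq]
  have hk1 : ∀ t ∈ J, 0 ≤ t → t ≤ s → k t = 1 := by
    intro t ht h0 hts
    have ht1 : t ∈ Icc (0 : ℝ) 1 := ⟨h0, by linarith⟩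
    have e1 := hΦ t ⟨h0, hts⟩
    rw [(hball t ht).1.2 ht1, (hball t ht).2.1.2 ht1] at e1
    simp only [hk]
    rw [e1]; group
  -- `η` deforms the parameter `θ` to the constant `s`. On the arc `c '' Icc s s'` it is the
  -- parameter; outside `K` it is `s`; at a point `c t` of `U` with `t ≤ s` it lies between `t` and
  -- `s`. In the last two cases `k (η x) = 1`, so the correction neither leaves `K` nor disturbs
  -- what is already achieved.
  set η : M → ℝ := fun x => s + χ x * (θ x - s) with hη
  have hηJ : ∀ x ∈ U, η x ∈ J := by
    intro x hx
    have h1 := (hUsub x hx).2.1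
    have h2 := hχI x
    have := (convex_Ioo (t₀ - ρ) (t₀ + ρ)) hsJ h1 (a := 1 - χ x) (b := χ x)
      (by linarith [h2.2]) h2.1 (by ring)
    have e : η x = (1 - χ x) • s + χ x • θ x := by
      simp only [hη, smul_eq_mul]; ring
    rwa [e]
  classical
  set κ : M → G := fun x => if x ∈ U then k (η x) else 1 with hκ
  have hηs : ContMDiffOn 𝓘(ℝ, EM) 𝓘(ℝ, ℝ) ∞ η U := by
    intro x hx
    have h1 : ContMDiffAt 𝓘(ℝ, EM) 𝓘(ℝ, ℝ) ∞ θ x := (hUsub x hx).1.1.of_le le_top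
    exact (contMDiffAt_const.add (hχ.contMDiffAt.mul (h1.sub contMDiffAt_const))).contMDiffWithinAt
  have hκs : ContMDiffOn 𝓘(ℝ, EM) 𝓘(ℝ, EG) ∞ κ U :=
    (hks.comp hηs hηJ).congr fun x hx => if_pos hx
  have hκ1 : ∀ x ∉ K, κ x = 1 := by
    intro x hx
    by_cases hxU : x ∈ U
    · simp only [hκ, hxU, if_true, hη, hχ0 x hx, zero_mul, add_zero]
      exact hk1 s hsJ hs0 le_rfl
    · simp [hκ, hxU]
  obtain ⟨Ψ, hΨ⟩ := exists_gauge hτ hU (fun x hx => (hUsub x hx).2.2) hK hKU hκs hκ1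
  refine ⟨Φ.trans Ψ, fun t ht => ?_⟩
  have ht1 : t ∈ Icc (0 : ℝ) 1 := ⟨ht.1, ht.2.trans hs1⟩
  have hpt : B.proj (Φ.toDiffeo (u t)) = c t := by rw [Φ.proj_eq, hu t ht1]
  rw [Gauge.trans_apply, hΨ]
  by_cases hcU : c t ∈ U
  · have hθt : θ (c t) = t := (hUsub _ hcU).1.2 t ht1 rfl
    have htJ : t ∈ J := hθt ▸ (hUsub _ hcU).2.1
    rcases le_total t s with hts | hts
    · have h1 : κ (c t) = 1 := by
        simp only [hκ, hcU, if_true]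
        refine hk1 _ (hηJ _ hcU) ?_ ?_
        · simp only [hη, hθt]
          nlinarith [(hχI (c t)).1, (hχI (c t)).2, ht.1]
        · simp only [hη, hθt]
          nlinarith [(hχI (c t)).1]
      have : gaugeShift τ κ (Φ.toDiffeo (u t)) = 1 := by
        unfold gaugeShift
        rw [hpt, h1]; group
      rw [this, B.act_one]
      exact hΦ t ⟨ht.1, hts⟩
    · have h1 : κ (c t) = k t := by
        have : χ (c t) = 1 := hχ1 _ ⟨t, ⟨hts, ht.2⟩, rfl⟩
        simp only [hκ, hcU, if_true, hη, hθt, this]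
        congr 1; ring
      have hsrc : Φ.toDiffeo (u t) ∈ τ.source := by
        rw [τ.mem_source, hpt]; exact (hUsub _ hcU).2.2
      refine IsSmoothTriv.eq_of_snd_eq (τ := τ) ?_ ?_ ?_
      · rw [B.proj_act]; exact τ.mem_source.1 hsrc
      · rw [B.proj_act, hpt, hv t ht1]
      · rw [hτ.map_act _ hsrc]
        unfold gaugeShift
        rw [hpt, h1, (hball t htJ).1.2 ht1, (hball t htJ).2.1.2 ht1]
        simp only [hk]
        group
  · have h1 : κ (c t) = 1 := by simp [hκ, hcU]
    have : gaugeShift τ κ (Φ.toDiffeo (u t)) = 1 := by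
      unfold gaugeShift
      rw [hpt, h1]; group
    rw [this, B.act_one]
    refine hΦ t ⟨ht.1, ?_⟩
    by_contra hlt
    exact hcU (hCU ⟨t, ⟨(not_le.1 hlt).le, ht.2⟩, rfl⟩)

/-- Two smooth lifts of an embedded path with the same initial point are related by a gauge
transformation. -/
theorem exists_gauge_map_lift {c : AnalyticPath EM M} (hc : InjOn c (Icc 0 1)) {u v : ℝ → P}
    {ε : ℝ} (hε : 0 < ε)
    (hus : ContMDiffOn 𝓘(ℝ, ℝ) 𝓘(ℝ, EP) ∞ u (Ioo (-ε) (1 + ε)))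
    (hvs : ContMDiffOn 𝓘(ℝ, ℝ) 𝓘(ℝ, EP) ∞ v (Ioo (-ε) (1 + ε)))
    (hu : ∀ t ∈ Icc (0 : ℝ) 1, B.proj (u t) = c t) (hv : ∀ t ∈ Icc (0 : ℝ) 1, B.proj (v t) = c t)
    (h0 : u 0 = v 0) : ∃ Φ : B.Gauge, ∀ t ∈ Icc (0 : ℝ) 1, Φ.toDiffeo (u t) = v t := by
  have hI : ∀ t ∈ Icc (0 : ℝ) 1, Ioo (-ε) (1 + ε) ∈ 𝓝 t := fun t ht =>
    Ioo_mem_nhds (by linarith [ht.1]) (by linarith [ht.2])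
  have hsm : ∀ {w : ℝ → P}, ContMDiffOn 𝓘(ℝ, ℝ) 𝓘(ℝ, EP) ∞ w (Ioo (-ε) (1 + ε)) →
      ∀ t ∈ Icc (0 : ℝ) 1, ∃ w' : ℝ → P,
        (∀ᶠ s in 𝓝 t, ContMDiffAt 𝓘(ℝ, ℝ) 𝓘(ℝ, EP) ∞ w' s) ∧
        ∀ᶠ s in 𝓝 t, s ∈ Icc (0 : ℝ) 1 → w s = w' s := fun {w} hw t ht =>
    ⟨w, by
      filter_upwards [eventually_mem_nhds_iff.2 (hI t ht)] with s hs using hw.contMDiffAt hs,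
      Eventually.of_forall fun s _ => rfl⟩
  choose δ hδ hext using fun t : Icc (0 : ℝ) 1 =>
    exists_gauge_extend hc hu hv t.2 (hsm hus t t.2) (hsm hvs t t.2)
  obtain ⟨t, ht0, htm, ⟨m, hm⟩, hcov⟩ := exists_monotone_Icc_subset_open_cover_Icc
    (zero_le_one (α := ℝ)) (c := fun i : Icc (0 : ℝ) 1 =>
      {s : Icc (0 : ℝ) 1 | (s : ℝ) ∈ Ioo ((i : ℝ) - δ i) (i + δ i)})
    (fun i => isOpen_Ioo.preimage continuous_subtype_val)
    (fun s _ => mem_iUnion.2 ⟨s, by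
      have := hδ s
      exact ⟨by linarith, by linarith⟩⟩)
  -- Starting from the identity, the agreement of the lifts is extended along a subdivision fine
  -- enough for the local step.
  have key : ∀ n, ∃ Φ : B.Gauge, ∀ r ∈ Icc (0 : ℝ) (t n), Φ.toDiffeo (u r) = v r := by
    intro n
    induction n with
    | zero =>
      refine ⟨Gauge.refl B, fun r hr => ?_⟩
      rw [ht0, Icc_self] at hr
      obtain rfl : r = 0 := hr
      exact h0
    | succ n ih =>
      obtain ⟨Φ, hΦ⟩ := ih
      obtain ⟨i, hi⟩ := hcov n
      exact hext i _ (hi ⟨le_rfl, htm n.le_succ⟩) _ (hi ⟨htm n.le_succ, le_rfl⟩) (t n).2.1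
        (htm n.le_succ) (t (n + 1)).2.2 Φ hΦ
  obtain ⟨Φ, hΦ⟩ := key m
  rw [hm m le_rfl] at hΦ
  exact ⟨Φ, hΦ⟩

variable [IsManifold 𝓘(ℝ, EP) ∞ P] [CompleteSpace EG]

/-- Connections with the same parallel transport along an embedded edge are gauge equivalent on
this edge. -/
theorem edgeEquiv_of_transport_eq {c : AnalyticPath EM M} (hc : InjOn c (Icc 0 1))
    {A A' : B.Connection} (h : transport A c.toOEdge = transport A' c.toOEdge) :
    B.EdgeEquiv c.toUEdge A A' := by
  rw [edgeEquiv_iff]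
  obtain ⟨p₀, hp₀⟩ : ∃ p₀, B.proj p₀ = c 0 := by
    obtain ⟨τ, hx, -⟩ := B.exists_smoothTriv (c 0)
    exact ⟨_, τ.proj_symm_apply (x := (c 0, (1 : G))) (τ.mem_target.2 hx)⟩
  obtain ⟨ε₁, hε₁, u, hu, hu0⟩ := exists_isSmoothLiftOn A c hp₀
  obtain ⟨ε₂, hε₂, v, hv, hv0⟩ := exists_isSmoothLiftOn A' c hp₀
  have hI₁ : Icc (0 : ℝ) 1 ⊆ Ioo (-ε₁) (1 + ε₁) := fun t ht =>
    ⟨by linarith [ht.1], by linarith [ht.2]⟩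
  have hI₂ : Icc (0 : ℝ) 1 ⊆ Ioo (-ε₂) (1 + ε₂) := fun t ht =>
    ⟨by linarith [ht.1], by linarith [ht.2]⟩
  have huI := hu.2.mono hI₁
  have hvI := hv.2.mono hI₂
  have hm1 := min_le_left ε₁ ε₂
  have hm2 := min_le_right ε₁ ε₂
  obtain ⟨Φ, hΦ⟩ := exists_gauge_map_lift hc (lt_min hε₁ hε₂)
    (hu.1.mono (Ioo_subset_Ioo (by linarith) (by linarith)))
    (hv.1.mono (Ioo_subset_Ioo (by linarith) (by linarith)))
    huI.proj_eq hvI.proj_eq (hu0.trans hv0.symm)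
  -- Only here is equality of the transports used. Together with `u 0 = v 0` it makes `Φ` fix one
  -- point over each end of the edge, hence by equivariance both end fibres.
  have h1 : u 1 = v 1 := by
    have e1 : Transports A c.toOEdge (u 0) (u 1) :=
      (transports_toOEdge_iff c).2 ⟨u, huI, rfl, rfl⟩
    have e2 : Transports A' c.toOEdge (v 0) (v 1) :=
      (transports_toOEdge_iff c).2 ⟨v, hvI, rfl, rfl⟩
    rw [transports_iff_of_transport_eq h, hu0, ← hv0] at e1
    exact e1.unique e2
  refine ⟨Φ, fun c' hc' => ⟨fun p hp => ?_, fun t ht p hp w hw => ?_⟩⟩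
  · rw [AnalyticPath.ends_eq_of_toUEdge_eq hc'] at hp
    have fix : ∀ t ∈ Icc (0 : ℝ) 1, u t = v t → B.proj p = c t → Φ.toDiffeo p = p := by
      intro t ht huv hpt
      obtain ⟨g, rfl⟩ := exists_act_eq (B := B) (p := u t) (q := p)
        ((huI.proj_eq t ht).trans hpt.symm)
      rw [Φ.equivariant, hΦ t ht, huv]
    rcases hp with hp | hp
    · exact fix 0 (by simp) (hu0.trans hv0.symm) hp
    · exact fix 1 (by simp) h1 hp
  · obtain ⟨f, g, hfg, hcf⟩ := AnalyticPath.exists_reparam_of_toUEdge_eq hc'.symm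
    obtain ⟨r, hr⟩ := hw
    have hft := hfg.mapsTo_fun ht
    -- Another parametrisation of the unoriented edge only rescales the velocity, possibly with a
    -- negative factor.
    have hvel : c'.vel t = deriv f t • c.vel (f t) := by
      have e1 := (c.hasVelWithinAt hft (Icc 0 1)).precomp
        ((hfg.analytic_fun t ht).differentiableAt.hasDerivAt.hasDerivWithinAt (s := Icc 0 1))
        hfg.mapsTo_fun
      refine (c'.hasVelWithinAt ht (Icc 0 1)).unique (e1.congr ?_ (hcf t ht))
        (uniqueDiffOn_Icc_zero_one t ht)
      filter_upwards [self_mem_nhdsWithin] with s hs using hcf s hs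
    set s := f t with hs
    rw [hvel, smul_smul] at hr
    set r' := r * deriv f t with hr'
    obtain ⟨g', rfl⟩ := exists_act_eq (B := B) (p := u s) (q := p)
      ((huI.proj_eq s hft).trans ((hp.trans (hcf t ht)).symm))
    obtain ⟨α, hα, hαh⟩ := huI.exists_vel s hft
    obtain ⟨β, hβ, hβh⟩ := hvI.exists_vel s hft
    have hud := uniqueDiffOn_Icc_zero_one s hft
    have hπ : modelDeriv EP EM B.proj (u s) α = c.vel s := by
      refine (hα.comp (mdifferentiableAt_proj _)).unique
        ((c.hasVelWithinAt hft (Icc 0 1)).congr ?_ (huI.proj_eq s hft)) hud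
      filter_upwards [self_mem_nhdsWithin] with q hq using huI.proj_eq q hq
    have hΦα : modelDeriv EP EP Φ.toDiffeo (u s) α = β := by
      refine (hα.comp (Φ.mdifferentiableAt _)).unique (hβ.congr ?_ (hΦ s hft)) hud
      filter_upwards [self_mem_nhdsWithin] with q hq using hΦ q hq
    -- The base projection of `w` is `r'` times the velocity of `c`, so its horizontal part is `r'`
    -- times the translated velocity of `u`. The same holds for `A'` and `v`, and `Φ` carries the
    -- one to the other.
    have hA : A.horL (B.act (u s) g') w =
        r' • modelDeriv EP EP (fun q => B.act q g') (u s) α := by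
      rw [← hαh, ← A.horL_act, ← map_smul]
      apply A.horL_eq_of_proj_eq
      rw [hr, map_smul, modelDeriv_proj_act, hπ]
    have hA' : A'.horL (Φ.toDiffeo (B.act (u s) g'))
        (modelDeriv EP EP Φ.toDiffeo (B.act (u s) g') w) =
        r' • modelDeriv EP EP (fun q => B.act q g') (v s) β := by
      have e1 : Φ.toDiffeo (B.act (u s) g') = B.act (v s) g' := by rw [Φ.equivariant, hΦ s hft]
      have e2 := Φ.modelDeriv_proj (B.act (u s) g') w
      rw [e1] at e2 ⊢
      rw [← hβh, ← A'.horL_act, ← map_smul]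
      apply A'.horL_eq_of_proj_eq
      rw [e2, hr, map_smul, modelDeriv_proj_act]
      congr 1
      rw [← hΦα, ← hΦ s hft, Φ.modelDeriv_proj, hπ]
    rw [hA', hA, map_smul, Φ.modelDeriv_act, hΦα, hΦ s hft]

/-- The classes of connections on an embedded edge are determined by the parallel transport. -/
theorem quot_mk_eq_iff {c : AnalyticPath EM M} (hc : InjOn c (Icc 0 1)) {A A' : B.Connection} :
    Quot.mk (B.EdgeEquiv c.toUEdge) A = Quot.mk (B.EdgeEquiv c.toUEdge) A' ↔
      transport A c.toOEdge = transport A' c.toOEdge := by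
  refine ⟨fun h => ?_, fun h => Quot.sound (edgeEquiv_of_transport_eq hc h)⟩
  -- Transport is lifted to the quotient, so `EdgeEquiv` need not be shown to be an equivalence
  -- relation.
  exact congrArg (Quot.lift (fun A : B.Connection => transport A c.toOEdge)
    fun _ _ h => transport_eq_of_edgeEquiv h) h

end GaugeAlongEdge

end PrincipalBundle

/-! ## Construction of connections -/

section TangentSmooth

variable {E : Type*} [NormedAddCommGroup E] [NormedSpace ℝ E]
  {N : Type*} [TopologicalSpace N] [ChartedSpace E N] [IsManifold 𝓘(ℝ, E) ∞ N]
  {E' : Type*} [NormedAddCommGroup E'] [NormedSpace ℝ E'] {H' : Type*} [TopologicalSpace H']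
  {J : ModelWithCorners ℝ E' H'}
  {N' : Type*} [TopologicalSpace N'] [ChartedSpace H' N']

/-- In the tangent trivialisation at `b x`, the fibre coordinate over `b y` is a linear map, so it
commutes with finite linear combinations. -/
theorem ContMDiffAt.tangentBundle_sum {ι : Type*} {s : Finset ι} {b : N' → N} {a : ι → N' → ℝ}
    {f : ι → N' → E} {x : N'} (hb : ContMDiffAt J 𝓘(ℝ, E) ∞ b x)
    (ha : ∀ i ∈ s, ContMDiffAt J 𝓘(ℝ, ℝ) ∞ (a i) x)
    (hf : ∀ i ∈ s, ContMDiffAt J 𝓘(ℝ, E).tangent ∞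
      (fun y => (⟨b y, f i y⟩ : TangentBundle 𝓘(ℝ, E) N)) x) :
    ContMDiffAt J 𝓘(ℝ, E).tangent ∞
      (fun y => (⟨b y, ∑ i ∈ s, a i y • f i y⟩ : TangentBundle 𝓘(ℝ, E) N)) x := by
  rw [Bundle.contMDiffAt_totalSpace]
  refine ⟨hb, ?_⟩
  have h : ContMDiffAt J 𝓘(ℝ, E) ∞ (fun y => ∑ i ∈ s, a i y •
      (trivializationAt E (TangentSpace 𝓘(ℝ, E)) (b x)
        (⟨b y, f i y⟩ : TangentBundle 𝓘(ℝ, E) N)).2) x := by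
    refine contMDiffAt_finsetSum fun i hi => (ha i hi).smul ?_
    exact (Bundle.contMDiffAt_totalSpace.1 (hf i hi)).2
  refine h.congr_of_eventuallyEq (Eventually.of_forall fun y => ?_)
  set L : E →L[ℝ] E := (tangentBundleCore 𝓘(ℝ, E) N).coordChange
    (achart E (b y)) (achart E (b x)) (b y) with hL
  have hz : ∀ w : E, (trivializationAt E (TangentSpace 𝓘(ℝ, E)) (b x)
      (⟨b y, w⟩ : TangentBundle 𝓘(ℝ, E) N)).2 = L w := fun w => rfl
  refine (hz _).trans ((map_sum L _ _).trans (Finset.sum_congr rfl fun i _ => ?_))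
  exact (map_smul L _ _).trans (congrArg (a i y • ·) (hz _).symm)

end TangentSmooth

namespace PrincipalBundle

variable {EM : Type*} [NormedAddCommGroup EM] [NormedSpace ℝ EM]
    {EG : Type*} [NormedAddCommGroup EG] [NormedSpace ℝ EG]
    {EP : Type*} [NormedAddCommGroup EP] [NormedSpace ℝ EP]
    {M : Type*} [TopologicalSpace M] [ChartedSpace EM M]
    {G : Type*} [TopologicalSpace G] [ChartedSpace EG G] [Group G]
    {P : Type*} [TopologicalSpace P] [ChartedSpace EP P]
    {B : PrincipalBundle EM EG EP M G P}

/-- A smooth connection on the part of the bundle over `U`, given by its horizontal projection. -/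
structure IsConnectionOn (B : PrincipalBundle EM EG EP M G P) [IsManifold 𝓘(ℝ, EP) ∞ P]
    (h : P → EP →L[ℝ] EP) (U : Set M) : Prop where
  contMDiffAt : ∀ v : TangentBundle 𝓘(ℝ, EP) P, B.proj v.1 ∈ U →
    ContMDiffAt 𝓘(ℝ, EP).tangent 𝓘(ℝ, EP).tangent ∞
      (fun v : TangentBundle 𝓘(ℝ, EP) P => (⟨v.1, h v.1 v.2⟩ : TangentBundle 𝓘(ℝ, EP) P)) v
  proj_eq : ∀ p, B.proj p ∈ U → ∀ v, modelDeriv EP EM B.proj p (h p v) = modelDeriv EP EM B.proj p v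
  vertical : ∀ p, B.proj p ∈ U → ∀ v, modelDeriv EP EM B.proj p v = 0 → h p v = 0
  act : ∀ p, B.proj p ∈ U → ∀ g v, h (B.act p g) (modelDeriv EP EP (fun q => B.act q g) p v) =
    modelDeriv EP EP (fun q => B.act q g) p (h p v)

section Gluing

variable [IsManifold 𝓘(ℝ, EP) ∞ P]

theorem Connection.isConnectionOn (A : B.Connection) (U : Set M) : B.IsConnectionOn A.horL U where
  contMDiffAt v _ := A.contMDiff_hor v
  proj_eq p _ v := A.modelDeriv_proj_horL p v
  vertical _ _ _ h := A.horL_vertical h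
  act p _ g v := A.horL_act p g v

/-- Local connections can be glued with a partition of unity of the base. -/
theorem exists_connection_of_partition {ι : Type*} (ρ : SmoothPartitionOfUnity ι 𝓘(ℝ, EM) M)
    {U : ι → Set M} (hU : ∀ i, tsupport (ρ i) ⊆ U i) {h : ι → P → EP →L[ℝ] EP}
    (hh : ∀ i, B.IsConnectionOn (h i) (U i)) :
    ∃ A : B.Connection, ∀ p, A.horL p =
      ∑ i ∈ ρ.finsupport (B.proj p), ρ i (B.proj p) • h i p := by
  set H : P → EP →L[ℝ] EP := fun p => ∑ i ∈ ρ.finsupport (B.proj p), ρ i (B.proj p) • h i p with hH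
  have hHv : ∀ p v, H p v = ∑ i ∈ ρ.finsupport (B.proj p), ρ i (B.proj p) • h i p v := by
    intro p v
    simp [hH]
  have hmem : ∀ p, ∀ i ∈ ρ.finsupport (B.proj p), B.proj p ∈ U i := fun p i hi =>
    hU i (subset_tsupport _ ((ρ.mem_finsupport _).1 hi))
  have hsm : ContMDiff 𝓘(ℝ, EP).tangent 𝓘(ℝ, EP).tangent ∞
      (fun v : TangentBundle 𝓘(ℝ, EP) P => (⟨v.1, H v.1 v.2⟩ : TangentBundle 𝓘(ℝ, EP) P)) := by
    intro v₀
    have hπ : ContMDiff 𝓘(ℝ, EP).tangent 𝓘(ℝ, EP) ∞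
        (fun v : TangentBundle 𝓘(ℝ, EP) P => v.1) := Bundle.contMDiff_proj _
    have hπ' : ContMDiff 𝓘(ℝ, EP).tangent 𝓘(ℝ, EM) ∞
        (fun v : TangentBundle 𝓘(ℝ, EP) P => B.proj v.1) := B.contMDiff_proj.comp hπ
    -- Near `v₀` the sum may be taken over the fixed finite set of indices whose closed support
    -- contains the base point. Each such `U i` contains that point, so `h i` is smooth there.
    have key := ContMDiffAt.tangentBundle_sum (s := ρ.fintsupport (B.proj v₀.1)) (x := v₀)
      (b := fun v : TangentBundle 𝓘(ℝ, EP) P => v.1) (a := fun i v => ρ i (B.proj v.1))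
      (f := fun i v => h i v.1 v.2) hπ.contMDiffAt
      (fun i _ => (ContMDiff.comp (g := ρ i) (ρ i).contMDiff hπ').contMDiffAt)
      (fun i hi => (hh i).contMDiffAt v₀ (hU i ((ρ.mem_fintsupport_iff _ i).1 hi)))
    refine key.congr_of_eventuallyEq ?_
    filter_upwards [hπ'.continuous.continuousAt
      (ρ.eventually_finsupport_subset (B.proj v₀.1))] with v hv
    congr 1
    refine (hHv v.1 v.2).trans (Finset.sum_subset hv fun i _ hi => ?_)
    have : ρ i (B.proj v.1) = 0 := by
      by_contra hne
      exact hi ((ρ.mem_finsupport _).2 hne)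
    rw [this, zero_smul]
  -- The condition is affine in the horizontal projection, and the weights sum to 1.
  have hproj : ∀ (p : P) (v : EP), modelDeriv EP EM B.proj p (H p v) =
      modelDeriv EP EM B.proj p v := by
    intro p v
    rw [hHv, map_sum, Finset.sum_congr rfl fun i hi => by
      rw [map_smul, (hh i).proj_eq p (hmem p i hi)],
      ← Finset.sum_smul, ρ.sum_finsupport _ (mem_univ _), one_smul]
  have hvert : ∀ (p : P) (v : EP), modelDeriv EP EM B.proj p v = 0 → H p v = 0 := by
    intro p v hv
    rw [hHv]
    exact Finset.sum_eq_zero fun i hi => by rw [(hh i).vertical p (hmem p i hi) v hv, smul_zero]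
  have hact : ∀ (p : P) (g : G) (v : EP),
      H (B.act p g) (modelDeriv EP EP (fun q => B.act q g) p v) =
        modelDeriv EP EP (fun q => B.act q g) p (H p v) := by
    intro p g v
    rw [hHv, hHv, map_sum, B.proj_act]
    exact Finset.sum_congr rfl fun i hi => by rw [(hh i).act p (hmem p i hi), map_smul]
  exact ⟨⟨H, hsm, hproj, hvert, hact⟩, fun p => rfl⟩

/-- Two local connections can be interpolated. -/
theorem exists_connection_interpolation {U K : Set M} {χ : M → ℝ}
    (hχ : ContMDiff 𝓘(ℝ, EM) 𝓘(ℝ, ℝ) ∞ χ) (hK : IsClosed K) (hKU : K ⊆ U)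
    (hχ0 : ∀ x ∉ K, χ x = 0) (hχI : ∀ x, χ x ∈ Icc (0 : ℝ) 1) {h : P → EP →L[ℝ] EP}
    (hh : B.IsConnectionOn h U) (A₀ : B.Connection) :
    ∃ A : B.Connection, ∀ p, A.horL p = χ (B.proj p) • h p + (1 - χ (B.proj p)) • A₀.horL p := by
  classical
  -- The partition of unity consists of `χ`, at `true`, and `1 - χ`, at `false`.
  let ρ : SmoothPartitionOfUnity Bool 𝓘(ℝ, EM) M :=
    { toFun := fun i => if i then ⟨χ, hχ⟩ else ⟨fun x => 1 - χ x, contMDiff_const.sub hχ⟩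
      locallyFinite' := locallyFinite_of_finite _
      nonneg' := by
        rintro (_ | _) x
        · exact sub_nonneg.2 (hχI x).2
        · exact (hχI x).1
      sum_eq_one' := fun x _ => by
        rw [finsum_eq_sum_of_fintype, Fintype.sum_bool]
        exact add_sub_cancel _ _
      sum_le_one' := fun x => by
        rw [finsum_eq_sum_of_fintype, Fintype.sum_bool]
        exact (add_sub_cancel _ _).le }
  obtain ⟨A, hA⟩ := exists_connection_of_partition (B := B) ρ
    (U := fun i => if i then U else univ) (h := fun i => if i then h else A₀.horL) (by
      rintro (_ | _)
      · exact subset_univ _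
      · refine (closure_minimal (fun x hx => ?_) hK).trans hKU
        by_contra hxK
        exact hx (hχ0 x hxK)) (by
      rintro (_ | _)
      · exact A₀.isConnectionOn _
      · exact hh)
  refine ⟨A, fun p => ?_⟩
  refine (hA p).trans ((ρ.sum_finsupport_smul_eq_finsum (B.proj p)
    fun i _ => (if i then h else A₀.horL) p).trans ?_)
  rw [finsum_eq_sum_of_fintype, Fintype.sum_bool]
  rfl

end Gluing

/-! ### Flat connections -/

/-- The flat connection, over the domain of a trivialisation, for which the section with the
coordinate `k` is horizontal. -/
noncomputable def flatHor (τ : Bundle.Trivialization G B.proj) (k : M → G) (p : P) : EP →L[ℝ] EP :=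
  (modelDeriv EM EP (fun x => τ.toOpenPartialHomeomorph.symm
    (x, k x * ((k (B.proj p))⁻¹ * (τ p).2))) (B.proj p)).comp (modelDeriv EP EM B.proj p)

section Flat

variable {τ : Bundle.Trivialization G B.proj} {k : M → G} {U : Set M}

theorem IsSmoothTriv.act_symm (hτ : B.IsSmoothTriv τ) {x : M} (hx : x ∈ τ.baseSet) (g h : G) :
    B.act (τ.toOpenPartialHomeomorph.symm (x, g)) h =
      τ.toOpenPartialHomeomorph.symm (x, g * h) := by
  have ht : ∀ a : G, (x, a) ∈ τ.target := fun a => τ.mem_target.2 hx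
  have hp : ∀ a : G, B.proj (τ.toOpenPartialHomeomorph.symm (x, a)) = x :=
    fun a => τ.proj_symm_apply (ht a)
  have h2 : ∀ a : G, (τ (τ.toOpenPartialHomeomorph.symm (x, a))).2 = a := fun a => by
    rw [τ.apply_symm_apply (ht a)]
  refine IsSmoothTriv.eq_of_snd_eq (τ := τ) ?_ ?_ ?_
  · rwa [B.proj_act, hp]
  · rw [B.proj_act, hp, hp]
  · rw [hτ.map_act _ (τ.mem_source.2 (by rwa [hp])), h2, h2]

/-- The factor `(k (B.proj p))⁻¹ * (τ p).2`, frozen at `p`, selects the right translate of the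
section through `p`; the horizontal space of the flat connection at `p` is tangent to this
translate. -/
theorem section_apply_self {p : P} (hp : B.proj p ∈ τ.baseSet) :
    τ.toOpenPartialHomeomorph.symm
      (B.proj p, k (B.proj p) * ((k (B.proj p))⁻¹ * (τ p).2)) = p := by
  rw [mul_inv_cancel_left]
  exact τ.symm_apply_mk_proj (τ.mem_source.2 hp)

theorem flatHor_apply {p : P} {v : EP} : flatHor τ k p v =
    modelDeriv EM EP (fun x => τ.toOpenPartialHomeomorph.symm
      (x, k x * ((k (B.proj p))⁻¹ * (τ p).2))) (B.proj p) (modelDeriv EP EM B.proj p v) := rfl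

variable [LieGroup 𝓘(ℝ, EG) ∞ G]

theorem contMDiffAt_section (hτ : B.IsSmoothTriv τ) (hU : IsOpen U) (hUτ : U ⊆ τ.baseSet)
    (hk : ContMDiffOn 𝓘(ℝ, EM) 𝓘(ℝ, EG) ∞ k U) {x : M} (hx : x ∈ U) (g : G) :
    ContMDiffAt 𝓘(ℝ, EM) 𝓘(ℝ, EP) ∞
      (fun x => τ.toOpenPartialHomeomorph.symm (x, k x * g)) x :=
  ContMDiffAt.comp (g := τ.toOpenPartialHomeomorph.symm) x (hτ.contMDiffAt_symm (hUτ hx) _)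
    (contMDiffAt_id.prodMk ((hk.contMDiffAt (hU.mem_nhds hx)).mul contMDiffAt_const))

theorem mdifferentiableAt_section (hτ : B.IsSmoothTriv τ) (hU : IsOpen U) (hUτ : U ⊆ τ.baseSet)
    (hk : ContMDiffOn 𝓘(ℝ, EM) 𝓘(ℝ, EG) ∞ k U) {x : M} (hx : x ∈ U) (g : G) :
    MDifferentiableAt 𝓘(ℝ, EM) 𝓘(ℝ, EP)
      (fun x => τ.toOpenPartialHomeomorph.symm (x, k x * g)) x :=
  (contMDiffAt_section hτ hU hUτ hk hx g).mdifferentiableAt (by simp)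

theorem modelDeriv_proj_section (hτ : B.IsSmoothTriv τ) (hU : IsOpen U) (hUτ : U ⊆ τ.baseSet)
    (hk : ContMDiffOn 𝓘(ℝ, EM) 𝓘(ℝ, EG) ∞ k U) {x : M} (hx : x ∈ U) (g : G) (ξ : EM) :
    modelDeriv EP EM B.proj (τ.toOpenPartialHomeomorph.symm (x, k x * g))
      (modelDeriv EM EP (fun x => τ.toOpenPartialHomeomorph.symm (x, k x * g)) x ξ) = ξ := by
  rw [← modelDeriv_comp (f := fun x => τ.toOpenPartialHomeomorph.symm (x, k x * g))
    (mdifferentiableAt_proj _) (mdifferentiableAt_section hτ hU hUτ hk hx g)]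
  rw [modelDeriv_congr (F' := fun y : M => y), modelDeriv_id]
  filter_upwards [hU.mem_nhds hx] with y hy
  exact τ.proj_symm_apply (τ.mem_target.2 (hUτ hy))

/-- The horizontal vector is the image of `(0, dπ v)` under the tangent map of the smooth map `(g,
x) ↦ (x, k x * g)`, read in the trivialisation; this gives smoothness. Right translation permutes
the sections which define the horizontal spaces, which gives equivariance. -/
theorem isConnectionOn_flatHor [IsManifold 𝓘(ℝ, EM) ∞ M] [IsManifold 𝓘(ℝ, EP) ∞ P]
    (hτ : B.IsSmoothTriv τ) (hU : IsOpen U)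
    (hUτ : U ⊆ τ.baseSet) (hk : ContMDiffOn 𝓘(ℝ, EM) 𝓘(ℝ, EG) ∞ k U) :
    B.IsConnectionOn (flatHor τ k) U where
  contMDiffAt v₀ hv₀ := by
    have : IsManifold 𝓘(ℝ, EG) ∞ G := LieGroup.toContMDiffMul.toIsManifold
    have : IsManifold 𝓘(ℝ, EG) 1 G := IsManifold.of_le (n := ∞) (by exact_mod_cast le_top)
    have : IsManifold 𝓘(ℝ, EM) 1 M := IsManifold.of_le (n := ∞) (by exact_mod_cast le_top)
    set F : G × M → P := fun z => τ.toOpenPartialHomeomorph.symm (z.2, k z.2 * z.1) with hF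
    set O : Set (G × M) := univ ×ˢ U with hO
    have hOo : IsOpen O := isOpen_univ.prod hU
    have hFs : ContMDiffOn (𝓘(ℝ, EG).prod 𝓘(ℝ, EM)) 𝓘(ℝ, EP) ∞ F O := by
      intro z hz
      refine (ContMDiffAt.comp (g := τ.toOpenPartialHomeomorph.symm) z
        (hτ.contMDiffAt_symm (hUτ hz.2) _) (contMDiffAt_snd.prodMk
          (ContMDiffAt.mul ?_ contMDiffAt_fst))).contMDiffWithinAt
      exact ContMDiffAt.comp (g := k) z (hk.contMDiffAt (hU.mem_nhds hz.2)) contMDiffAt_snd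
    have hT := hFs.contMDiffOn_tangentMapWithin (m := ∞) (by simp) hOo.uniqueMDiffOn
    have hγ : ContMDiffAt 𝓘(ℝ, EP) 𝓘(ℝ, EG) ∞
        (fun p => (k (B.proj p))⁻¹ * (τ p).2) v₀.1 :=
      (ContMDiffAt.comp (g := k) v₀.1 (hk.contMDiffAt (hU.mem_nhds hv₀))
        B.contMDiff_proj.contMDiffAt).inv.mul (hτ.contMDiffAt_snd (hUτ hv₀))
    have h0 : ContMDiffAt 𝓘(ℝ, EP).tangent 𝓘(ℝ, EG).tangent ∞
        (fun v : TangentBundle 𝓘(ℝ, EP) P =>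
          (⟨(k (B.proj v.1))⁻¹ * (τ v.1).2, (0 : EG)⟩ : TangentBundle 𝓘(ℝ, EG) G)) v₀ := by
      have hz : ContMDiff 𝓘(ℝ, EG) 𝓘(ℝ, EG).tangent ∞
        (Bundle.zeroSection EG (TangentSpace 𝓘(ℝ, EG) : G → Type _)) := Bundle.contMDiff_zeroSection _ _
      refine ContMDiffAt.comp (g := Bundle.zeroSection EG (TangentSpace 𝓘(ℝ, EG) : G → Type _)) v₀
        hz.contMDiffAt (ContMDiffAt.comp (g := fun p => (k (B.proj p))⁻¹ * (τ p).2) v₀ hγ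
          (Bundle.contMDiffAt_proj _))
    have h1 : ContMDiff 𝓘(ℝ, EP).tangent 𝓘(ℝ, EM).tangent ∞
        (tangentMap 𝓘(ℝ, EP) 𝓘(ℝ, EM) B.proj) :=
      B.contMDiff_proj.contMDiff_tangentMap (by simp)
    have h2 := ContMDiffAt.comp (g := (equivTangentBundleProd 𝓘(ℝ, EG) G 𝓘(ℝ, EM) M).symm) v₀
      (contMDiff_equivTangentBundleProd_symm (n := ∞)).contMDiffAt
      (h0.prodMk h1.contMDiffAt)
    have h3 := ContMDiffAt.comp v₀ (hT.contMDiffAt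
      ((hOo.preimage (FiberBundle.continuous_proj _ _)).mem_nhds ⟨mem_univ _, hv₀⟩)) h2
    refine h3.congr_of_eventuallyEq ?_
    have hev : ∀ᶠ v : TangentBundle 𝓘(ℝ, EP) P in 𝓝 v₀, B.proj v.1 ∈ U :=
      ((hU.preimage B.contMDiff_proj.continuous).preimage
        (FiberBundle.continuous_proj EP (TangentSpace 𝓘(ℝ, EP)))).mem_nhds hv₀
    filter_upwards [hev] with v hv
    have hzO : ((k (B.proj v.1))⁻¹ * (τ v.1).2, B.proj v.1) ∈ O := ⟨mem_univ _, hv⟩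
    have hFd : MDifferentiableAt (𝓘(ℝ, EG).prod 𝓘(ℝ, EM)) 𝓘(ℝ, EP) F
        ((k (B.proj v.1))⁻¹ * (τ v.1).2, B.proj v.1) :=
      (hFs.contMDiffAt (hOo.mem_nhds hzO)).mdifferentiableAt (by simp)
    have e1 : tangentMapWithin (𝓘(ℝ, EG).prod 𝓘(ℝ, EM)) 𝓘(ℝ, EP) F O
        ((equivTangentBundleProd 𝓘(ℝ, EG) G 𝓘(ℝ, EM) M).symm
          (⟨(k (B.proj v.1))⁻¹ * (τ v.1).2, (0 : EG)⟩, tangentMap 𝓘(ℝ, EP) 𝓘(ℝ, EM) B.proj v)) =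
        tangentMap (𝓘(ℝ, EG).prod 𝓘(ℝ, EM)) 𝓘(ℝ, EP) F
        ((equivTangentBundleProd 𝓘(ℝ, EG) G 𝓘(ℝ, EM) M).symm
          (⟨(k (B.proj v.1))⁻¹ * (τ v.1).2, (0 : EG)⟩, tangentMap 𝓘(ℝ, EP) 𝓘(ℝ, EM) B.proj v)) :=
      tangentMapWithin_eq_tangentMap (hOo.uniqueMDiffOn _ hzO) hFd
    refine Eq.trans ?_ e1.symm
    have hp : F ((k (B.proj v.1))⁻¹ * (τ v.1).2, B.proj v.1) = v.1 := section_apply_self (hUτ hv)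
    have hd : ∀ w : EP, flatHor τ k v.1 w = (mfderiv (𝓘(ℝ, EG).prod 𝓘(ℝ, EM)) 𝓘(ℝ, EP) F
        ((k (B.proj v.1))⁻¹ * (τ v.1).2, B.proj v.1) : EG × EM →L[ℝ] EP)
        (0, modelDeriv EP EM B.proj v.1 w) := by
      intro w
      rw [flatHor_apply]
      have hc := (HasMFDerivAt.comp (B.proj v.1) hFd.hasMFDerivAt
        ((hasMFDerivAt_const (I := 𝓘(ℝ, EM)) (I' := 𝓘(ℝ, EG)) ((k (B.proj v.1))⁻¹ * (τ v.1).2)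
          (B.proj v.1)).prodMk (hasMFDerivAt_id (I := 𝓘(ℝ, EM)) (B.proj v.1)))).mfderiv
      exact DFunLike.congr_fun (F := EM →L[ℝ] EP) hc (modelDeriv EP EM B.proj v.1 w)
    -- The two points of the tangent bundle have base points equal only through `hp`; the comparison
    -- of vectors takes place in the model space.
    have gen : ∀ (q : P) (w : EP), q = v.1 → w = flatHor τ k v.1 v.2 →
        (⟨v.1, flatHor τ k v.1 v.2⟩ : TangentBundle 𝓘(ℝ, EP) P) = ⟨q, w⟩ := by
      rintro q w rfl rfl; rfl
    exact gen _ _ hp (hd v.2).symm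
  proj_eq p hp v := by
    have h := modelDeriv_proj_section hτ hU hUτ hk hp ((k (B.proj p))⁻¹ * (τ p).2)
      (modelDeriv EP EM B.proj p v)
    rw [section_apply_self (hUτ hp)] at h
    exact h
  vertical p hp v hv := by rw [flatHor_apply, hv, map_zero]
  act p hp g v := by
    rw [flatHor_apply, flatHor_apply, modelDeriv_proj_act, B.proj_act,
      hτ.map_act _ (τ.mem_source.2 (hUτ hp))]
    have h := modelDeriv_comp (F := fun q => B.act q g)
      (f := fun x => τ.toOpenPartialHomeomorph.symm (x, k x * ((k (B.proj p))⁻¹ * (τ p).2)))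
      (mdifferentiableAt_act_right g _)
      (mdifferentiableAt_section hτ hU hUτ hk hp ((k (B.proj p))⁻¹ * (τ p).2))
      (modelDeriv EP EM B.proj p v)
    rw [section_apply_self (hUτ hp)] at h
    rw [← h]
    congr 1
    apply modelDeriv_congr
    filter_upwards [hU.mem_nhds hp] with x hx
    rw [hτ.act_symm (hUτ hx), mul_assoc, mul_assoc]

/-- Principal bundles have connections. -/
theorem exists_connection [IsManifold 𝓘(ℝ, EM) ∞ M] [IsManifold 𝓘(ℝ, EP) ∞ P]
    [FiniteDimensional ℝ EM] [T2Space M] [SecondCountableTopology M] : Nonempty B.Connection := by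
  have : LocallyCompactSpace M := Manifold.locallyCompact_of_finiteDimensional 𝓘(ℝ, EM)
  choose τ hx hτ using B.exists_smoothTriv
  obtain ⟨ρ, hρ⟩ := SmoothPartitionOfUnity.exists_isSubordinate 𝓘(ℝ, EM) isClosed_univ
    (fun x => (τ x).baseSet) (fun x => (τ x).open_baseSet)
    (fun x _ => mem_iUnion.2 ⟨x, hx x⟩)
  obtain ⟨A, -⟩ := exists_connection_of_partition (B := B) ρ hρ
    (h := fun x => flatHor (τ x) fun _ => 1)
    (fun x => isConnectionOn_flatHor (hτ x) (τ x).open_baseSet Subset.rfl contMDiffOn_const)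
  exact ⟨A⟩

end Flat

/-! ### Smooth paths in the structure group -/

/-- In a connected Lie group every element can be reached from the identity by a smooth path which
is constant outside a given interval. -/
theorem exists_contMDiff_path {EG : Type*} [NormedAddCommGroup EG] [NormedSpace ℝ EG]
    {G : Type*} [TopologicalSpace G] [ChartedSpace EG G] [Group G] [LieGroup 𝓘(ℝ, EG) ∞ G]
    [ConnectedSpace G] {a b : ℝ} (hab : a < b) (h : G) :
    ∃ σ : ℝ → G, ContMDiff 𝓘(ℝ, ℝ) 𝓘(ℝ, EG) ∞ σ ∧ (∀ t ≤ a, σ t = 1) ∧ ∀ t, b ≤ t → σ t = h := by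
  have : IsTopologicalGroup G := topologicalGroup_of_lieGroup 𝓘(ℝ, EG) ∞
  have : IsManifold 𝓘(ℝ, EG) ∞ G := LieGroup.toContMDiffMul.toIsManifold
  -- The reachable elements form a subgroup, by pointwise products and inverses of paths. It
  -- contains a neighbourhood of 1, where segments in a chart are run through with a smooth
  -- transition function; so it is open and closed, and equals the connected group `G`.
  let S : Subgroup G :=
    { carrier := {h | ∃ σ : ℝ → G, ContMDiff 𝓘(ℝ, ℝ) 𝓘(ℝ, EG) ∞ σ ∧ (∀ t ≤ a, σ t = 1) ∧
        ∀ t, b ≤ t → σ t = h}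
      one_mem' := ⟨fun _ => 1, contMDiff_const, fun _ _ => rfl, fun _ _ => rfl⟩
      mul_mem' := by
        rintro g h ⟨σ, h1, h2, h3⟩ ⟨σ', h1', h2', h3'⟩
        exact ⟨fun t => σ t * σ' t, h1.mul h1', fun t ht => by simp [h2 t ht, h2' t ht],
          fun t ht => by simp [h3 t ht, h3' t ht]⟩
      inv_mem' := by
        rintro g ⟨σ, h1, h2, h3⟩
        exact ⟨fun t => (σ t)⁻¹, h1.inv, fun t ht => by simp [h2 t ht],
          fun t ht => by simp [h3 t ht]⟩ }
  have hS : (S : Set G) ∈ 𝓝 (1 : G) := by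
    set φ := extChartAt 𝓘(ℝ, EG) (1 : G) with hφ
    obtain ⟨r, hr, hball⟩ := Metric.isOpen_iff.1 (isOpen_extChartAt_target (I := 𝓘(ℝ, EG)) (1 : G)) (φ 1)
      (mem_extChartAt_target _)
    have h1 : ∀ᶠ h in 𝓝 (1 : G), φ h ∈ Metric.ball (φ 1) r :=
      (continuousAt_extChartAt (1 : G)) (Metric.ball_mem_nhds _ hr)
    filter_upwards [h1, extChartAt_source_mem_nhds (I := 𝓘(ℝ, EG)) (1 : G)] with h hh hs
    set ψ : ℝ → ℝ := fun t => Real.smoothTransition ((t - a) / (b - a)) with hψ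
    have hψs : ContDiff ℝ ∞ ψ := Real.smoothTransition.contDiff.comp (by fun_prop)
    refine ⟨fun t => φ.symm (φ 1 + ψ t • (φ h - φ 1)), ?_, fun t ht => ?_, fun t ht => ?_⟩
    · have hm : ∀ t, φ 1 + ψ t • (φ h - φ 1) ∈ φ.target := by
        intro t
        apply hball
        have := (convex_ball (φ 1) r) (Metric.mem_ball_self hr) hh (a := 1 - ψ t) (b := ψ t)
          (sub_nonneg.2 (Real.smoothTransition.le_one _)) (Real.smoothTransition.nonneg _) (by ring)
        convert this using 1
        module
      have hs : ContMDiff 𝓘(ℝ, ℝ) 𝓘(ℝ, EG) ∞ (fun t => φ 1 + ψ t • (φ h - φ 1)) :=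
        (contDiff_const.add (hψs.smul contDiff_const)).contMDiff
      intro t
      exact ContMDiffAt.comp (g := φ.symm) t ((contMDiffOn_extChartAt_symm (1 : G)).contMDiffAt
        ((isOpen_extChartAt_target (1 : G)).mem_nhds (hm t))) hs.contMDiffAt
    · have : ψ t = 0 := Real.smoothTransition.zero_of_nonpos
        (div_nonpos_of_nonpos_of_nonneg (by linarith) (by linarith))
      simp only [this, zero_smul, add_zero]
      exact φ.left_inv (mem_extChartAt_source _)
    · have : ψ t = 1 := Real.smoothTransition.one_of_one_le
        ((one_le_div (by linarith)).2 (by linarith))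
      simp only [this, one_smul, add_sub_cancel]
      exact φ.left_inv hs
  have hSo : IsOpen (S : Set G) := S.isOpen_of_mem_nhds hS
  have hSc : IsClosed (S : Set G) := Subgroup.isClosed_of_isOpen S hSo
  have : (S : Set G) = univ := IsClopen.eq_univ ⟨hSc, hSo⟩ ⟨1, S.one_mem⟩
  exact (this ▸ mem_univ h : h ∈ (S : Set G))

end PrincipalBundle

/-! ## Connections with prescribed parallel transports -/

section Orientation

variable {EM : Type*} [NormedAddCommGroup EM] [NormedSpace ℝ EM]
  {M : Type*} [TopologicalSpace M] [ChartedSpace EM M]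

theorem isReparam_reverse : IsReparam (fun t => 1 - t) (fun t => 1 - t) where
  analytic_fun _ _ := analyticAt_const.sub analyticAt_id
  analytic_inv _ _ := analyticAt_const.sub analyticAt_id
  mapsTo_fun t ht := ⟨by linarith [ht.2], by linarith [ht.1]⟩
  mapsTo_inv t ht := ⟨by linarith [ht.2], by linarith [ht.1]⟩
  left_inv t _ := by ring
  right_inv t _ := by ring

theorem IsReparam.monotoneOn_or_antitoneOn {f g : ℝ → ℝ} (h : IsReparam f g) :
    MonotoneOn f (Icc 0 1) ∨ AntitoneOn f (Icc 0 1) := by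
  have hc : ContinuousOn f (Icc 0 1) := fun t ht =>
    (h.analytic_fun t ht).continuousAt.continuousWithinAt
  have hi : InjOn f (Icc 0 1) := fun s hs t ht hst => by
    rw [← h.left_inv s hs, hst, h.left_inv t ht]
  exact (hc.strictMonoOn_of_injOn_Icc' zero_le_one hi).imp StrictMonoOn.monotoneOn
    StrictAntiOn.antitoneOn

/-- A reparametrisation of `[0,1]` is monotone or antitone; in the second case, composing with `t ↦
1 - t` makes it monotone. -/
theorem AnalyticPath.toOEdge_eq_or {c c' : AnalyticPath EM M} (h : c.toUEdge = c'.toUEdge) :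
    c'.toOEdge = c.toOEdge ∨ c'.toOEdge = c.reverse.toOEdge := by
  obtain ⟨f, g, hfg, hcf⟩ := exists_reparam_of_toUEdge_eq h
  rcases hfg.monotoneOn_or_antitoneOn with hm | hm
  · exact Or.inl (Quotient.sound ⟨f, g, hfg, hm, hcf⟩ : c.toOEdge = c'.toOEdge).symm
  · refine Or.inr (Quotient.sound ?_ : c.reverse.toOEdge = c'.toOEdge).symm
    refine ⟨_, _, isReparam_reverse.comp hfg, fun s hs t ht hst => ?_, fun t ht => ?_⟩
    · exact sub_le_sub_left (hm hs ht hst) 1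
    · change c' t = c (1 + -1 * (1 - f t))
      rw [hcf t ht]
      congr 1; ring

theorem AnalyticPath.toOEdge_eq_or_isInverse {c c' : AnalyticPath EM M}
    (h : c.toUEdge = c'.toUEdge) : c'.toOEdge = c.toOEdge ∨ c.toOEdge.IsInverse c'.toOEdge :=
  (toOEdge_eq_or h).imp_right fun h => ⟨c, rfl, h⟩

end Orientation

namespace PrincipalBundle

variable {EM : Type*} [NormedAddCommGroup EM] [NormedSpace ℝ EM]
    {EG : Type*} [NormedAddCommGroup EG] [NormedSpace ℝ EG]
    {EP : Type*} [NormedAddCommGroup EP] [NormedSpace ℝ EP]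
    {M : Type*} [TopologicalSpace M] [ChartedSpace EM M]
    {G : Type*} [TopologicalSpace G] [ChartedSpace EG G] [Group G]
    {P : Type*} [TopologicalSpace P] [ChartedSpace EP P]
    {B : PrincipalBundle EM EG EP M G P}

theorem exists_proj_eq (x : M) : ∃ p, B.proj p = x := by
  obtain ⟨τ, hx, -⟩ := B.exists_smoothTriv x
  exact ⟨_, τ.proj_symm_apply (x := (x, (1 : G))) (τ.mem_target.2 hx)⟩

/-- A fibre is a single orbit of the structure group, so one value determines an equivariant map. -/
theorem FibreIso.ext_of_apply_eq {x y : M} {F F' : B.FibreIso x y} (p : B.Fibre x)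
    (h : F.toEquiv p = F'.toEquiv p) : F = F' := by
  refine FibreIso.ext' fun q => ?_
  obtain ⟨g, hg⟩ := exists_act_eq (B := B) (p.2.trans q.2.symm)
  obtain rfl : B.fibreAct p g = q := Subtype.ext hg
  rw [F.equivariant, F'.equivariant, h]

theorem GenTransport.iso_eq_of_isInverse {I J : B.GenTransport} {e e' : OEdge EM M}
    (he : e.IsInverse e') (h : I.iso e = J.iso e) : I.iso e' = J.iso e' := by
  have hs : e'.source = e.target := by
    obtain ⟨c, rfl, rfl⟩ := he
    change c (1 + -1 * 0) = c 1
    simp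
  refine FibreIso.ext' fun q => Subtype.ext ?_
  set q' : B.Fibre e.target := ⟨q.1, q.2.trans hs⟩ with hq'
  have h1 := I.iso_inverse e e' he ((I.iso e).toEquiv.symm q') q (by rw [Equiv.apply_symm_apply])
  have h2 := J.iso_inverse e e' he ((I.iso e).toEquiv.symm q') q
    (by rw [← h, Equiv.apply_symm_apply])
  rw [h1, h2]

/-! ### Horizontal sections of flat connections along a path. -/

section Flat

variable [LieGroup 𝓘(ℝ, EG) ∞ G] {τ : Bundle.Trivialization G B.proj} {k : M → G} {U : Set M}

/-- The sections with the coordinate `k g` are horizontal for the flat connection of `k`. -/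
theorem isLiftOn_of_eq_flatHor [IsManifold 𝓘(ℝ, EP) ∞ P] (hτ : B.IsSmoothTriv τ) (hU : IsOpen U)
    (hUτ : U ⊆ τ.baseSet) (hk : ContMDiffOn 𝓘(ℝ, EM) 𝓘(ℝ, EG) ∞ k U) {A : B.Connection}
    {c : AnalyticPath EM M} {S : Set ℝ} (hS : S ⊆ Icc 0 1) (hSU : ∀ t ∈ S, c t ∈ U)
    (hA : ∀ t ∈ S, ∀ p, B.proj p = c t → A.horL p = flatHor τ k p) (g : G) :
    IsLiftOn A c (fun t => τ.toOpenPartialHomeomorph.symm (c t, k (c t) * g)) S where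
  proj_eq t ht := τ.proj_symm_apply (τ.mem_target.2 (hUτ (hSU t ht)))
  exists_vel t ht := by
    have ht' := τ.mem_target (x := (c t, k (c t) * g)).2 (hUτ (hSU t ht))
    refine ⟨_, (c.hasVelWithinAt (hS ht) S).comp
      (F := fun x => τ.toOpenPartialHomeomorph.symm (x, k x * g))
      (mdifferentiableAt_section hτ hU hUτ hk (hSU t ht) g), ?_⟩
    have hp : B.proj (τ.toOpenPartialHomeomorph.symm (c t, k (c t) * g)) = c t :=
      τ.proj_symm_apply ht'
    rw [hA t ht _ hp, flatHor_apply, modelDeriv_proj_section hτ hU hUτ hk (hSU t ht) g, hp,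
      τ.apply_symm_apply ht', inv_mul_cancel_left]

/-- Along a path on which `k` is constant, the flat connection of `k` is the one of the
trivialisation. -/
theorem flatHor_eq_of_eventually_eq (hτ : B.IsSmoothTriv τ) (hU : IsOpen U) (hUτ : U ⊆ τ.baseSet)
    (hk : ContMDiffOn 𝓘(ℝ, EM) 𝓘(ℝ, EG) ∞ k U) {c : AnalyticPath EM M} {t : ℝ}
    (ht : t ∈ Icc (0 : ℝ) 1) (hcU : c t ∈ U) {k₀ : G}
    (hk₀ : ∀ᶠ r in 𝓝[Icc 0 1] t, k (c r) = k₀) {p : P} (hp : B.proj p = c t) {v : EP}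
    (hv : modelDeriv EP EM B.proj p v = c.vel t) :
    flatHor τ k p v = flatHor τ (fun _ => 1) p v := by
  have hkt : k (c t) = k₀ := hk₀.self_of_nhdsWithin ht
  rw [flatHor_apply, flatHor_apply, hv, hp]
  -- Both sections trace the same curve over `c` near `t`, because the constant value of `k`
  -- cancels; its velocity at `t` is unique.
  refine HasVelWithinAt.unique ((c.hasVelWithinAt ht (Icc 0 1)).comp
    (mdifferentiableAt_section hτ hU hUτ hk hcU _)) (HasVelWithinAt.congr
      ((c.hasVelWithinAt ht (Icc 0 1)).comp
    (mdifferentiableAt_section (k := fun _ => 1) hτ hU hUτ contMDiffOn_const hcU _)) ?_ ?_)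
    (uniqueDiffOn_Icc_zero_one t ht)
  · filter_upwards [hk₀] with r hr
    rw [hr, hkt]; group
  · rw [hkt]; group

end Flat

section TransportCongr

variable [IsManifold 𝓘(ℝ, EM) ω M] [LieGroup 𝓘(ℝ, EG) ∞ G] [IsManifold 𝓘(ℝ, EP) ∞ P]
  [CompleteSpace EG]

theorem transport_eq_of_horL_eq {c : AnalyticPath EM M} {A A' : B.Connection}
    (h : ∀ p, B.proj p ∈ c.image → A.horL p = A'.horL p) :
    transport A c.toOEdge = transport A' c.toOEdge := by
  refine transport_eq_of_forall fun p => ?_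
  obtain ⟨u, hu, h0, h1⟩ := (transports_toOEdge_iff c).1 (transports_transport A' c.toOEdge p)
  refine (transports_toOEdge_iff c).2 ⟨u, ⟨hu.proj_eq, fun t ht => ?_⟩, h0, h1⟩
  obtain ⟨w, hw, hwh⟩ := hu.exists_vel t ht
  exact ⟨w, hw, by rw [h _ ⟨t, ht, (hu.proj_eq t ht).symm⟩, hwh]⟩

end TransportCongr

/-! ### Prescribing the transports along the edges of a graph. -/

section Prescribe

variable [FiniteDimensional ℝ EM] [IsManifold 𝓘(ℝ, EM) ω M] [T2Space M]
  [SecondCountableTopology M] [LieGroup 𝓘(ℝ, EG) ∞ G] [IsManifold 𝓘(ℝ, EP) ∞ P] [CompleteSpace EG]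

/-- A connection can be modified near the middle of an embedded edge, so that the parallel
transport along this edge becomes a given one. -/
theorem exists_connection_transport_eq [ConnectedSpace G] {c : AnalyticPath EM M}
    (hc : InjOn c (Icc 0 1)) {C : Set M} (hC : IsClosed C) (hcC : c (1 / 2) ∉ C)
    (A₀ : B.Connection) (F : B.FibreIso c.toOEdge.source c.toOEdge.target) :
    ∃ A : B.Connection, (∀ p, B.proj p ∈ C → A.horL p = A₀.horL p) ∧
      transport A c.toOEdge = F := by
  have : IsManifold 𝓘(ℝ, EM) ∞ M := IsManifold.of_le (n := ω) le_top
  have hmid : (1 / 2 : ℝ) ∈ Icc (0 : ℝ) 1 := by norm_num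
  obtain ⟨τ, hτ0, hτ⟩ := B.exists_smoothTriv (c (1 / 2))
  obtain ⟨θ, hθ, hθc⟩ := AnalyticPath.exists_leftInverse_of_injOn hc hmid
  have hθs : ∀ᶠ x in 𝓝 (c (1 / 2)), ContMDiffAt 𝓘(ℝ, EM) 𝓘(ℝ, ℝ) ω θ x :=
    (contMDiffAt_iff_contMDiffAt_nhds (by simp)).1 hθ
  have hCe : ∀ᶠ x in 𝓝 (c (1 / 2)), x ∉ C := hC.isOpen_compl.mem_nhds hcC
  obtain ⟨U, hUsub, hU, hcU⟩ := eventually_nhds_iff.1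
    ((hθs.and hθc).and (hCe.and (τ.open_baseSet.mem_nhds hτ0)))
  have hUτ : U ⊆ τ.baseSet := fun x hx => (hUsub x hx).2.2
  obtain ⟨ρ, hρ, hball⟩ := Metric.eventually_nhds_iff_ball.1
    ((c.continuousAt hmid) (hU.mem_nhds hcU))
  rw [Real.ball_eq_Ioo] at hball
  obtain ⟨δ, hδ, hδρ, hδ2⟩ : ∃ δ > 0, δ < ρ ∧ δ < 1 / 2 := by
    refine ⟨min ρ (1 / 2) / 2, by positivity, ?_, ?_⟩
    · linarith [min_le_left ρ (1 / 2)]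
    · linarith [min_le_right ρ (1 / 2), (by positivity : 0 < min ρ (1 / 2))]
  have hJI : Icc (1 / 2 - δ) (1 / 2 + δ) ⊆ Icc (0 : ℝ) 1 := Icc_subset_Icc (by linarith) (by linarith)
  have hJU : ∀ t ∈ Icc (1 / 2 - δ) (1 / 2 + δ), c t ∈ U := fun t ht =>
    hball t ⟨by linarith [ht.1], by linarith [ht.2]⟩
  obtain ⟨χ, K, hχ, hK, hKU, hχ1, hχ0, hχI⟩ := exists_contMDiff_cutoff (EM := EM)
    (isCompact_Icc.image_of_continuousOn (c.continuousOn.mono hJI)).isClosed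
    hU (image_subset_iff.2 hJU)
  have mod : ∀ k : M → G, ContMDiffOn 𝓘(ℝ, EM) 𝓘(ℝ, EG) ∞ k U → ∃ A : B.Connection, ∀ p,
      A.horL p = χ (B.proj p) • flatHor τ k p + (1 - χ (B.proj p)) • A₀.horL p := fun k hk =>
    exists_connection_interpolation hχ hK hKU hχ0 hχI (isConnectionOn_flatHor hτ hU hUτ hk) A₀
  have modJ : ∀ (k : M → G) (A : B.Connection),
      (∀ p, A.horL p = χ (B.proj p) • flatHor τ k p + (1 - χ (B.proj p)) • A₀.horL p) →
      ∀ t ∈ Icc (1 / 2 - δ) (1 / 2 + δ), ∀ p, B.proj p = c t → A.horL p = flatHor τ k p := by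
    intro k A hA t ht p hp
    rw [hA, hp, hχ1 _ ⟨t, ht, rfl⟩, one_smul, sub_self, zero_smul, add_zero]
  -- `A₁` is a reference connection, flat with constant section on the arc around the middle. It
  -- differs from the final `A` only by the function `k`.
  obtain ⟨A₁, hA₁⟩ := mod (fun _ => 1) contMDiffOn_const
  obtain ⟨p₀, hp₀⟩ := B.exists_proj_eq (c 0)
  obtain ⟨q₁, hq₁⟩ := exists_transports A₁ c.toOEdge hp₀
  obtain ⟨u, hu, hu0, hu1⟩ := (transports_toOEdge_iff c).1 hq₁
  -- `κ` measures by how much the transport of `A₁` misses `F`.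
  obtain ⟨κ, hκ⟩ := exists_act_eq (B := B)
    (hq₁.proj_right.trans (F.toEquiv ⟨p₀, hp₀⟩).2.symm)
  set g : G := (τ (u (1 / 2))).2 with hg
  -- The target is conjugated by the group coordinate `g` of `u` in the middle, since `k` multiplies
  -- on the left in the trivialisation while `κ` acts on the right. The path varies only in the
  -- inner half of the flat arc.
  obtain ⟨σ, hσ, hσ1, hσh⟩ := exists_contMDiff_path (EG := EG)
    (show 1 / 2 - δ / 2 < 1 / 2 + δ / 2 by linarith) (g * κ * g⁻¹)
  set k : M → G := fun x => σ (θ x) with hk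
  have hks : ContMDiffOn 𝓘(ℝ, EM) 𝓘(ℝ, EG) ∞ k U := fun x hx =>
    (ContMDiffAt.comp (g := σ) x hσ.contMDiffAt
      ((hUsub x hx).1.1.of_le le_top)).contMDiffWithinAt
  have hkc : ∀ t ∈ Icc (0 : ℝ) 1, c t ∈ U → k (c t) = σ t := fun t ht hcU => by
    simp only [hk]; rw [(hUsub _ hcU).1.2 t ht rfl]
  obtain ⟨A, hA⟩ := mod k hks
  have hIJ : Ioo (1 / 2 - δ) (1 / 2 + δ) ⊆ Icc (1 / 2 - δ) (1 / 2 + δ) := Ioo_subset_Icc_self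
  have heq : EqOn u (fun t => τ.toOpenPartialHomeomorph.symm (c t, 1 * g))
      (Ioo (1 / 2 - δ) (1 / 2 + δ)) := by
    refine IsLiftOn.eqOn (convex_Ioo _ _) isOpen_Ioo.uniqueDiffOn (hu.mono (hIJ.trans hJI))
      (isLiftOn_of_eq_flatHor (k := fun _ => 1) hτ hU hUτ contMDiffOn_const (hIJ.trans hJI)
        (fun t ht => hJU t (hIJ ht)) (fun t ht => modJ _ A₁ hA₁ t (hIJ ht)) g)
      (t := 1 / 2) ⟨by linarith, by linarith⟩ ?_
    rw [one_mul, hg, ← hu.proj_eq _ hmid]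
    exact (τ.symm_apply_mk_proj (τ.mem_source.2 (by rwa [hu.proj_eq _ hmid]))).symm
  -- This is to be the lift for `A`. Its group coordinate on the flat arc is `σ t * g`, the section
  -- horizontal for `k`; it starts at `u 0` and ends at `u 1` translated by `κ`.
  set w : ℝ → P := fun t => B.act (u t) (g⁻¹ * σ t * g) with hw
  have hwJ : EqOn w (fun t => τ.toOpenPartialHomeomorph.symm (c t, k (c t) * g))
      (Ioo (1 / 2 - δ) (1 / 2 + δ)) := by
    intro t ht
    have hcU := hJU t (hIJ ht)
    simp only [hw]
    rw [heq ht, hkc t (hJI (hIJ ht)) hcU, hτ.act_symm (hUτ hcU)]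
    congr 2; group
  have hwl := (isLiftOn_of_eq_flatHor hτ hU hUτ hks (hIJ.trans hJI)
        (fun t ht => hJU t (hIJ ht)) (fun t ht => modJ _ A hA t (hIJ ht)) g).congr hwJ
  have hlift : IsLiftOn A c w (Icc 0 1) := by
    refine ⟨fun t ht => (B.proj_act _ _).trans (hu.proj_eq t ht), fun t ht => ?_⟩
    by_cases htJ : t ∈ Ioo (1 / 2 - δ) (1 / 2 + δ)
    · obtain ⟨v, hv, hvh⟩ := hwl.exists_vel t htJ
      exact ⟨v, hv.mono_of_mem (mem_nhdsWithin_of_mem_nhds (isOpen_Ioo.mem_nhds htJ)), hvh⟩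
    -- Off the open middle interval `σ` is locally constant, so `w` is locally a constant translate
    -- of `u`, and `A` and `A₁` have the same horizontal part on the velocity of `u`.
    · obtain ⟨k₀, hk₀⟩ : ∃ k₀, ∀ᶠ r in 𝓝 t, σ r = k₀ := by
        rcases le_or_gt t (1 / 2 - δ) with h | h
        · exact ⟨1, (gt_mem_nhds (show t < 1 / 2 - δ / 2 by linarith)).mono
            fun r hr => hσ1 r hr.le⟩
        · have h2 : 1 / 2 + δ ≤ t := by
            by_contra hlt
            exact htJ ⟨h, not_le.1 hlt⟩
          exact ⟨_, (lt_mem_nhds (show 1 / 2 + δ / 2 < t by linarith)).mono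
            fun r hr => hσh r (le_of_lt hr)⟩
      obtain ⟨α, hα, hαh⟩ := hu.exists_vel t ht
      have hπ : modelDeriv EP EM B.proj (u t) α = c.vel t := by
        refine (hα.comp (mdifferentiableAt_proj _)).unique
          ((c.hasVelWithinAt ht (Icc 0 1)).congr ?_ (hu.proj_eq t ht))
          (uniqueDiffOn_Icc_zero_one t ht)
        filter_upwards [self_mem_nhdsWithin] with q hq using hu.proj_eq q hq
      have hsame : A.horL (u t) α = α := by
        refine Eq.trans ?_ hαh
        rw [hA, hA₁, hu.proj_eq t ht]
        by_cases hcU : c t ∈ U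
        · have hev : ∀ᶠ r in 𝓝[Icc 0 1] t, k (c r) = k₀ := by
            filter_upwards [self_mem_nhdsWithin, mem_nhdsWithin_of_mem_nhds hk₀,
              mem_nhdsWithin_of_mem_nhds ((c.continuousAt ht) (hU.mem_nhds hcU))] with r h1 h2 h3
            rw [hkc r h1 h3]; exact h2
          have := flatHor_eq_of_eventually_eq hτ hU hUτ hks ht hcU hev (hu.proj_eq t ht) hπ
          simp only [add_apply, smul_apply, this]
        · rw [hχ0 _ fun h => hcU (hKU h)]
          simp
      have hσt : σ t = k₀ := hk₀.self_of_nhds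
      refine ⟨_, HasVelWithinAt.congr (hα.comp (mdifferentiableAt_act_right (B := B) (g⁻¹ * k₀ * g) _))
        ?_ ?_, ?_⟩
      · filter_upwards [mem_nhdsWithin_of_mem_nhds hk₀] with r hr
        have hr' : σ r = k₀ := hr
        simp only [hw, hr']
      · simp only [hw, hσt]
      · simp only [hw, hσt]
        rw [A.horL_act, hsame]
  refine ⟨A, fun p hp => ?_, ?_⟩
  · have : B.proj p ∉ K := fun h => (hUsub _ (hKU h)).2.1 hp
    rw [hA, hχ0 _ this, zero_smul, sub_zero, one_smul, zero_add]
  · refine FibreIso.ext_of_apply_eq ⟨p₀, hp₀⟩ (Subtype.ext ?_)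
    refine (transports_transport A c.toOEdge ⟨p₀, hp₀⟩).unique
      ((transports_toOEdge_iff c).2 ⟨w, hlift, ?_, ?_⟩)
    · simp only [hw]
      rw [hσ1 0 (by linarith), hu0, mul_one, inv_mul_cancel, B.act_one]
    · simp only [hw]
      rw [hσh 1 (by linarith), hu1, ← hκ]
      congr 1; group

/-- The parallel transports along representatives of the edges of a graph can be prescribed. -/
theorem exists_connection_transport_rep [ConnectedSpace G] (γ : AnalyticGraph EM M)
    {rep : UEdge EM M → AnalyticPath EM M} (hrep : ∀ e, (rep e).toUEdge = e)
    (F : ∀ e, B.FibreIso (rep e).toOEdge.source (rep e).toOEdge.target) :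
    ∃ A : B.Connection, ∀ e ∈ γ.edges, transport A (rep e).toOEdge = F e := by
  have : IsManifold 𝓘(ℝ, EM) ∞ M := IsManifold.of_le (n := ω) le_top
  have key : ∀ T : Set (UEdge EM M), T.Finite → T ⊆ γ.edges → ∃ A : B.Connection, ∀ e ∈ T,
      transport A (rep e).toOEdge = F e := by
    intro T hT
    induction T, hT using Set.Finite.induction_on with
    | empty =>
      intro _
      obtain ⟨A⟩ := B.exists_connection
      exact ⟨A, fun e he => absurd he (notMem_empty e)⟩
    | @insert e T heT hT ih =>
      intro hsub
      obtain ⟨A₀, hA₀⟩ := ih ((subset_insert _ _).trans hsub)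
      have hinj : InjOn (rep e) (Icc 0 1) :=
        γ.embedded _ (by rw [hrep]; exact hsub (mem_insert _ _))
      have hC : IsClosed (⋃ d ∈ T, (rep d).image) :=
        hT.isClosed_biUnion fun d _ => (rep d).isCompact_image.isClosed
      -- The middle of an embedded edge is not an end point, and different edges of the graph meet
      -- only in end points.
      have hmem : rep e (1 / 2) ∉ ⋃ d ∈ T, (rep d).image := by
        intro h
        obtain ⟨d, hd, hm⟩ := mem_iUnion₂.1 h
        have hne : (rep e).toUEdge ≠ (rep d).toUEdge := by
          rw [hrep, hrep]; rintro rfl; exact heT hd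
        have h2 := γ.inter_subset (rep e) (rep d) (by rw [hrep]; exact hsub (mem_insert _ _))
          (by rw [hrep]; exact hsub (mem_insert_of_mem _ hd)) hne
          ⟨AnalyticPath.mem_image (by norm_num), hm⟩
        rcases h2.1 with h3 | h3
        · have := hinj (by norm_num) (by norm_num) h3; norm_num at this
        · have := hinj (by norm_num) (by norm_num) h3; norm_num at this
      obtain ⟨A, hAC, hA⟩ := exists_connection_transport_eq hinj hC hmem A₀ (F e)
      refine ⟨A, fun d hd => ?_⟩
      rcases hd with rfl | hd
      · exact hA
      · rw [← hA₀ d hd]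
        exact transport_eq_of_horL_eq fun p hp => hAC p (mem_iUnion₂.2 ⟨d, hd, hp⟩)
  exact key γ.edges γ.finite Subset.rfl

/-- A connection can be chosen with given generalised parallel transports along the edges of a
graph. -/
theorem exists_connection_of_graph [ConnectedSpace G] (γ : AnalyticGraph EM M)
    (I : B.GenTransport) :
    ∃ A : B.Connection, ∀ c : AnalyticPath EM M, c.toUEdge ∈ γ.edges →
      transport A c.toOEdge = I.iso c.toOEdge := by
  obtain ⟨rep, hrep⟩ : ∃ rep : UEdge EM M → AnalyticPath EM M, ∀ e, (rep e).toUEdge = e :=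
    ⟨Quotient.out, Quotient.out_eq⟩
  obtain ⟨A, hA⟩ := exists_connection_transport_rep γ hrep fun e => I.iso (rep e).toOEdge
  refine ⟨A, fun c hc => ?_⟩
  rcases AnalyticPath.toOEdge_eq_or_isInverse (hrep c.toUEdge) with h | h
  · rw [h]; exact hA _ hc
  · exact GenTransport.iso_eq_of_isInverse (I := A.genTransport) h (hA _ hc)

end Prescribe

end PrincipalBundle

/-! ## Graphs containing given edges -/

section Products

variable {EM : Type*} [NormedAddCommGroup EM] [NormedSpace ℝ EM]
  {M : Type*} [TopologicalSpace M] [ChartedSpace EM M]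

theorem AnalyticPath.ext_fun {c c' : AnalyticPath EM M} (h : ∀ t, c t = c' t) : c = c' := by
  obtain ⟨f, h1, h2⟩ := c
  obtain ⟨f', h1', h2'⟩ := c'
  obtain rfl : f = f' := funext h
  rfl

namespace OEdge

theorem IsProduct.trans {S T : Set (OEdge EM M)} {e : OEdge EM M} (h : IsProduct S e)
    (hST : ∀ e ∈ S, IsProduct T e) : IsProduct T e := by
  induction h with
  | of_mem e he => exact hST e he
  | comp e₁ e₂ e _ _ h ih₁ ih₂ => exact .comp e₁ e₂ e ih₁ ih₂ h

theorem IsProduct.mono {S T : Set (OEdge EM M)} {e : OEdge EM M} (h : IsProduct S e)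
    (hST : S ⊆ T) : IsProduct T e :=
  h.trans fun e he => .of_mem e (hST he)

theorem IsComposition.source_eq {e₁ e₂ e : OEdge EM M} (h : IsComposition e₁ e₂ e) :
    e.source = e₁.source := by
  obtain ⟨c, s, hs, rfl, rfl, rfl⟩ := h
  change c 0 = c (0 + s * 0)
  congr 1; ring

theorem IsComposition.target_eq {e₁ e₂ e : OEdge EM M} (h : IsComposition e₁ e₂ e) :
    e.target = e₂.target := by
  obtain ⟨c, s, hs, rfl, rfl, rfl⟩ := h
  change c 1 = c (s + (1 - s) * 1)
  congr 1; ring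

theorem IsComposition.target_source {e₁ e₂ e : OEdge EM M} (h : IsComposition e₁ e₂ e) :
    e₂.source = e₁.target := by
  obtain ⟨c, s, hs, rfl, rfl, rfl⟩ := h
  change c (s + (1 - s) * 0) = c (0 + s * 1)
  congr 1; ring

end OEdge

/-! ### Subpaths and subdivisions. -/

namespace AnalyticPath

theorem image_eq_of_toUEdge_eq {c c' : AnalyticPath EM M} (h : c.toUEdge = c'.toUEdge) :
    c.image = c'.image := by
  have key : ∀ {c c' : AnalyticPath EM M}, c.toUEdge = c'.toUEdge → c'.image ⊆ c.image := by
    rintro c c' h _ ⟨t, ht, rfl⟩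
    obtain ⟨f, g, hfg, hcf⟩ := exists_reparam_of_toUEdge_eq h
    rw [hcf t ht]
    exact mem_image (hfg.mapsTo_fun ht)
  exact (key h.symm).antisymm (key h)

theorem injOn_of_toUEdge_eq {c c' : AnalyticPath EM M} (h : c.toUEdge = c'.toUEdge)
    (hc : InjOn c (Icc 0 1)) : InjOn c' (Icc 0 1) := by
  obtain ⟨f, g, hfg, hcf⟩ := exists_reparam_of_toUEdge_eq h
  intro s hs t ht hst
  rw [hcf s hs, hcf t ht] at hst
  rw [← hfg.left_inv s hs, hc (hfg.mapsTo_fun hs) (hfg.mapsTo_fun ht) hst, hfg.left_inv t ht]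

/-- `p` is the part of `c` over `[a, b]`, rescaled to `[0, 1]`. -/
structure IsSubpath (p c : AnalyticPath EM M) (a b : ℝ) : Prop where
  nonneg : 0 ≤ a
  lt : a < b
  le_one : b ≤ 1
  apply : ∀ t, p t = c (a + (b - a) * t)

theorem exists_isSubpath (c : AnalyticPath EM M) {a b : ℝ} (ha : 0 ≤ a) (hab : a < b)
    (hb : b ≤ 1) : ∃ p : AnalyticPath EM M, p.IsSubpath c a b :=
  ⟨c.affine a (b - a) (sub_ne_zero.2 hab.ne') fun t ht =>
    ⟨by nlinarith [ht.1, ht.2], by nlinarith [ht.1, ht.2]⟩, ha, hab, hb, fun _ => rfl⟩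

theorem isSubpath_self (c : AnalyticPath EM M) : c.IsSubpath c 0 1 :=
  ⟨le_rfl, one_pos, le_rfl, fun t => by congr 1; ring⟩

namespace IsSubpath

variable {p q r c : AnalyticPath EM M} {a b m : ℝ}

theorem unique (hp : p.IsSubpath c a b) (hq : q.IsSubpath c a b) : p = q :=
  ext_fun fun t => by rw [hp.apply, hq.apply]

theorem Icc_subset (hp : p.IsSubpath c a b) : Icc a b ⊆ Icc 0 1 :=
  Icc_subset_Icc hp.nonneg hp.le_one

theorem mapsTo (hp : p.IsSubpath c a b) {t : ℝ} (ht : t ∈ Icc (0 : ℝ) 1) :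
    a + (b - a) * t ∈ Icc a b :=
  ⟨by nlinarith [ht.1, hp.lt], by nlinarith [ht.2, hp.lt]⟩

theorem exists_apply_eq (hp : p.IsSubpath c a b) {s : ℝ} (hs : s ∈ Icc a b) :
    ∃ t ∈ Icc (0 : ℝ) 1, a + (b - a) * t = s ∧ p t = c s := by
  have h0 : 0 < b - a := sub_pos.2 hp.lt
  have h : a + (b - a) * ((s - a) / (b - a)) = s := by field_simp; ring
  refine ⟨(s - a) / (b - a), ⟨div_nonneg (by linarith [hs.1]) h0.le,
    (div_le_one h0).2 (by linarith [hs.2])⟩, h, ?_⟩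
  rw [hp.apply, h]

theorem image_eq (hp : p.IsSubpath c a b) : p.image = c '' Icc a b := by
  ext x
  constructor
  · rintro ⟨t, ht, rfl⟩
    exact ⟨_, hp.mapsTo ht, (hp.apply t).symm⟩
  · rintro ⟨s, hs, rfl⟩
    obtain ⟨t, ht, -, h⟩ := hp.exists_apply_eq hs
    exact ⟨t, ht, h⟩

theorem ends_eq (hp : p.IsSubpath c a b) : p.ends = {c a, c b} := by
  unfold ends
  rw [hp.apply, hp.apply]
  congr 3 <;> ring

theorem injOn (hp : p.IsSubpath c a b) (hc : InjOn c (Icc a b)) : InjOn p (Icc 0 1) := by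
  intro s hs t ht hst
  rw [hp.apply, hp.apply] at hst
  have h := hc (hp.mapsTo hs) (hp.mapsTo ht) hst
  have h0 : b - a ≠ 0 := (sub_pos.2 hp.lt).ne'
  exact mul_left_cancel₀ h0 (add_left_cancel h)

theorem isComposition (hp : p.IsSubpath c a m) (hq : q.IsSubpath c m b) (hr : r.IsSubpath c a b) :
    OEdge.IsComposition p.toOEdge q.toOEdge r.toOEdge := by
  have h1 := hp.lt
  have h2 := hq.lt
  have h0 : 0 < b - a := by linarith
  refine ⟨r, (m - a) / (b - a), ⟨div_pos (by linarith) h0, (div_lt_one h0).2 (by linarith)⟩,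
    rfl, congrArg _ (ext_fun fun t => ?_), congrArg _ (ext_fun fun t => ?_)⟩
  · refine (hp.apply t).trans (Eq.trans ?_ (hr.apply _).symm)
    congr 1; field_simp; ring
  · refine (hq.apply t).trans (Eq.trans ?_ (hr.apply _).symm)
    congr 1; field_simp; ring

end IsSubpath

/-- A path is the product of the parts into which it is divided by finitely many points. -/
theorem isProduct_of_subdivision {c : AnalyticPath EM M} {F : Set ℝ} (hF : F.Finite)
    {S : Set (OEdge EM M)} (hS : ∀ a ∈ F, ∀ b ∈ F, ∀ p : AnalyticPath EM M, p.IsSubpath c a b →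
      (∀ t ∈ Ioo a b, t ∉ F) → p.toOEdge ∈ S) {a b : ℝ} (ha : a ∈ F) (hb : b ∈ F)
    {p : AnalyticPath EM M} (hp : p.IsSubpath c a b) : OEdge.IsProduct S p.toOEdge := by
  induction hn : (F ∩ Ioo a b).ncard using Nat.strong_induction_on generalizing a b p with
  | _ n ih =>
    by_cases h : ∀ t ∈ Ioo a b, t ∉ F
    · exact .of_mem _ (hS a ha b hb p hp h)
    · push Not at h
      obtain ⟨m, hm, hmF⟩ := h
      have lt : ∀ a' b', Ioo a' b' ⊆ Ioo a b → m ∉ Ioo a' b' → (F ∩ Ioo a' b').ncard < n := by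
        intro a' b' hsub hm'
        rw [← hn]
        exact ncard_lt_ncard ⟨inter_subset_inter_right F hsub, fun h => hm' (h ⟨hmF, hm⟩).2⟩
          (hF.inter_of_left _)
      obtain ⟨p₁, hp₁⟩ := c.exists_isSubpath hp.nonneg hm.1 (hm.2.le.trans hp.le_one)
      obtain ⟨p₂, hp₂⟩ := c.exists_isSubpath (hp.nonneg.trans hm.1.le) hm.2 hp.le_one
      exact .comp _ _ _
        (ih _ (lt a m (Ioo_subset_Ioo le_rfl hm.2.le) fun h => lt_irrefl _ h.2) ha hmF hp₁ rfl)
        (ih _ (lt m b (Ioo_subset_Ioo hm.1.le le_rfl) fun h => lt_irrefl _ h.1) hmF hb hp₂ rfl)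
        (hp₁.isComposition hp₂ hp)

variable [IsManifold 𝓘(ℝ, EM) ω M]

/-- A path is a finite product of embedded paths. -/
theorem exists_isProduct_injOn (c : AnalyticPath EM M) :
    ∃ C : Set (AnalyticPath EM M), C.Finite ∧ (∀ p ∈ C, InjOn p (Icc 0 1)) ∧
      OEdge.IsProduct (toOEdge '' C) c.toOEdge := by
  choose r hr hinj using fun t : Icc (0 : ℝ) 1 => c.exists_injOn_nhds t.2
  -- `δ` is a Lebesgue number for local injectivity: a piece of length less than `δ` is embedded.
  -- Repeated halving reduces every subpath to such pieces.
  obtain ⟨δ, hδ, hball⟩ := lebesgue_number_lemma_of_metric (isCompact_Icc (a := (0 : ℝ)) (b := 1))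
    (c := fun t : Icc (0 : ℝ) 1 => Metric.ball (t : ℝ) (r t)) (fun _ => Metric.isOpen_ball)
    (fun t ht => mem_iUnion.2 ⟨⟨t, ht⟩, Metric.mem_ball_self (hr _)⟩)
  have key : ∀ (n : ℕ) (a b : ℝ) (p : AnalyticPath EM M), p.IsSubpath c a b → b - a < δ * 2 ^ n →
      ∃ C : Set (AnalyticPath EM M), C.Finite ∧ (∀ p ∈ C, InjOn p (Icc 0 1)) ∧
        OEdge.IsProduct (toOEdge '' C) p.toOEdge := by
    intro n
    induction n with
    | zero =>
      intro a b p hp hab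
      obtain ⟨i, hi⟩ := hball a (hp.Icc_subset (left_mem_Icc.2 hp.lt.le))
      refine ⟨{p}, finite_singleton p, ?_, .of_mem _ ⟨p, rfl, rfl⟩⟩
      rintro _ rfl
      refine hp.injOn ((hinj i).mono fun t ht => hi ?_)
      rw [Metric.mem_ball, Real.dist_eq, abs_lt]
      constructor <;> linarith [ht.1, ht.2]
    | succ n ih =>
      intro a b p hp hab
      have h1 : a < (a + b) / 2 := by linarith [hp.lt]
      have h2 : (a + b) / 2 < b := by linarith [hp.lt]
      obtain ⟨p₁, hp₁⟩ := c.exists_isSubpath hp.nonneg h1 (h2.le.trans hp.le_one)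
      obtain ⟨p₂, hp₂⟩ := c.exists_isSubpath (hp.nonneg.trans h1.le) h2 hp.le_one
      rw [pow_succ] at hab
      obtain ⟨C₁, hC₁, hi₁, he₁⟩ := ih _ _ p₁ hp₁ (by linarith)
      obtain ⟨C₂, hC₂, hi₂, he₂⟩ := ih _ _ p₂ hp₂ (by linarith)
      refine ⟨C₁ ∪ C₂, hC₁.union hC₂, fun q hq => hq.elim (hi₁ q) (hi₂ q), .comp _ _ _
        (he₁.mono (image_mono subset_union_left)) (he₂.mono (image_mono subset_union_right))
        (hp₁.isComposition hp₂ hp)⟩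
  obtain ⟨n, hn⟩ := pow_unbounded_of_one_lt (1 / δ) (one_lt_two)
  refine key n 0 1 c c.isSubpath_self ?_
  rw [div_lt_iff₀ hδ] at hn
  linarith

/-- If two pieces of embedded paths, cut at a set of points which contains the frontier of their
intersection, meet at an interior point, then the first is contained in the second. -/
theorem image_subset_of_mem [T2Space M] {c d p q : AnalyticPath EM M} {a b a' b' : ℝ} {V : Set M}
    (hd : InjOn d (Icc 0 1))
    (hV : ∀ s ∈ Icc (0 : ℝ) 1, s ∈ frontier {s | c s ∈ d.image} → c s ∈ V)
    (hp : p.IsSubpath c a b) (hq : q.IsSubpath d a' b') (hpV : ∀ t ∈ Ioo a b, c t ∉ V)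
    (ha' : d a' ∈ V) (hb' : d b' ∈ V) {s s' : ℝ} (hs : s ∈ Ioo a b) (hs' : s' ∈ Ioo a' b')
    (hss : c s = d s') : p.image ⊆ q.image := by
  set T : Set ℝ := {s | c s ∈ d.image} with hT
  -- No time in `Ioo a b` is a frontier point of `T`, and `s` belongs to `T`; by connectedness the
  -- whole interval lies in the interior.
  have hI : Ioo a b ⊆ interior T := by
    refine (isPreconnected_Ioo (a := a) (b := b)).subset_left_of_subset_union isOpen_interior
      (isClosed_closure (s := T)).isOpen_compl ?_ (fun t ht => ?_) ⟨s, hs, ?_⟩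
    · exact disjoint_compl_right.mono_left (interior_subset.trans subset_closure)
    · by_contra h
      simp only [mem_union, mem_compl_iff, not_or, not_not] at h
      exact hpV t ht (hV t (hp.Icc_subset (Ioo_subset_Icc_self ht)) ⟨h.2, h.1⟩)
    · by_contra h
      have hsT : s ∈ T := ⟨s', hq.Icc_subset (Ioo_subset_Icc_self hs'), hss.symm⟩
      exact hpV s hs (hV s (hp.Icc_subset (Ioo_subset_Icc_self hs)) ⟨subset_closure hsT, h⟩)
  have hsub : p.image ⊆ d.image := by
    rw [hp.image_eq]
    rintro _ ⟨t, ht, rfl⟩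
    have h1 : MapsTo c (Ioo a b) d.image := fun t ht =>
      (interior_subset (hI ht) : t ∈ T)
    have h2 := h1.closure_of_continuousOn (by
      rw [closure_Ioo hp.lt.ne]; exact c.continuousOn.mono hp.Icc_subset)
    rw [closure_Ioo hp.lt.ne, d.isCompact_image.isClosed.closure_eq] at h2
    exact h2 ht
  obtain ⟨f, hf, hfm, hpf⟩ := exists_analytic_lift hd hsub
  have hfc : ContinuousOn f (Icc 0 1) := fun t ht => (hf t ht).continuousAt.continuousWithinAt
  have hpre : IsPreconnected (f '' Ioo 0 1) :=
    isPreconnected_Ioo.image f (hfc.mono Ioo_subset_Icc_self)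
  have hVf : ∀ x ∈ f '' Ioo 0 1, d x ∉ V := by
    rintro _ ⟨t, ht, rfl⟩
    rw [← hpf t (Ioo_subset_Icc_self ht), hp.apply]
    have := hp.lt
    exact hpV _ ⟨by nlinarith [ht.1], by nlinarith [ht.2]⟩
  have hs'f : s' ∈ f '' Ioo 0 1 := by
    obtain ⟨t, ht, hts, hpt⟩ := hp.exists_apply_eq (Ioo_subset_Icc_self hs)
    refine ⟨t, ⟨ht.1.lt_of_ne ?_, ht.2.lt_of_ne ?_⟩, ?_⟩
    · rintro rfl
      rw [mul_zero, add_zero] at hts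
      exact hs.1.ne hts
    · rintro rfl
      rw [mul_one] at hts
      exact hs.2.ne (by linarith)
    · exact hd (hfm ht) (hq.Icc_subset (Ioo_subset_Icc_self hs')) (by rw [← hpf t ht, hpt, hss])
  -- The connected set `f '' Ioo 0 1` contains `s'` and avoids `a'` and `b'`, whose images under `d`
  -- are cut points, so it stays between them.
  have hmaps : MapsTo f (Ioo 0 1) (Ioo a' b') := by
    intro t ht
    constructor
    · by_contra h
      exact hVf a' (hpre.Icc_subset ⟨t, ht, rfl⟩ hs'f ⟨not_lt.1 h, hs'.1.le⟩) ha'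
    · by_contra h
      exact hVf b' (hpre.Icc_subset hs'f ⟨t, ht, rfl⟩ ⟨hs'.2.le, not_lt.1 h⟩) hb'
  have hmaps' := hmaps.closure_of_continuousOn (by rwa [closure_Ioo zero_ne_one])
  rw [closure_Ioo zero_ne_one, closure_Ioo hq.lt.ne] at hmaps'
  rintro _ ⟨t, ht, rfl⟩
  rw [hq.image_eq]
  exact ⟨f t, hmaps' ht, (hpf t ht).symm⟩

end AnalyticPath

/-- A finite set of embedded edges which meet only in common end points. -/
structure IsPregraph (S : Set (UEdge EM M)) : Prop where
  finite : S.Finite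
  embedded : ∀ c : AnalyticPath EM M, c.toUEdge ∈ S → InjOn c (Icc 0 1)
  inter_subset : ∀ c c' : AnalyticPath EM M, c.toUEdge ∈ S → c'.toUEdge ∈ S →
    c.toUEdge ≠ c'.toUEdge → c.image ∩ c'.image ⊆ c.ends ∩ c'.ends

/-- Every finite set of edges can be decomposed into embedded edges which meet only in end
points. -/
theorem exists_isPregraph [IsManifold 𝓘(ℝ, EM) ω M] [T2Space M] {E : Set (OEdge EM M)}
    (hE : E.Finite) : ∃ S : Set (UEdge EM M), IsPregraph S ∧ ∀ e ∈ E,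
      OEdge.IsProduct {e | ∃ c : AnalyticPath EM M, c.toUEdge ∈ S ∧ e = c.toOEdge} e := by
  have hdec : ∀ e : OEdge EM M, ∃ C : Set (AnalyticPath EM M), C.Finite ∧
      (∀ p ∈ C, InjOn p (Icc 0 1)) ∧ OEdge.IsProduct (AnalyticPath.toOEdge '' C) e := by
    intro e
    obtain ⟨c, rfl⟩ : ∃ c : AnalyticPath EM M, c.toOEdge = e := Quotient.exists_rep e
    exact c.exists_isProduct_injOn
  choose C hC hCi hCe using hdec
  set D : Set (AnalyticPath EM M) := ⋃ e ∈ E, C e with hD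
  have hDf : D.Finite := hE.biUnion fun e _ => hC e
  have hDi : ∀ c ∈ D, InjOn c (Icc 0 1) := by
    intro c hc
    obtain ⟨e, -, hce⟩ := mem_iUnion₂.1 hc
    exact hCi e c hce
  -- The cut points: all end points of the embedded pieces, and all points where some piece may
  -- begin or cease to run inside another one.
  set V : Set M := ⋃ c ∈ D, (c.ends ∪ ⋃ d ∈ D, c '' (frontier {s | c s ∈ d.image} ∩ Icc 0 1)) with hV
  have hVf : V.Finite := by
    refine hDf.biUnion fun c _ => ?_
    have : c.ends.Finite := by unfold AnalyticPath.ends; exact toFinite _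
    exact this.union (hDf.biUnion fun d hd => (c.finite_frontier (hDi d hd)).image _)
  have hends : ∀ c ∈ D, c.ends ⊆ V := fun c hc x hx => mem_iUnion₂.2 ⟨c, hc, Or.inl hx⟩
  have hfr : ∀ c ∈ D, ∀ d ∈ D, ∀ s ∈ Icc (0 : ℝ) 1, s ∈ frontier {s | c s ∈ d.image} → c s ∈ V :=
    fun c hc d hd s hs hsf =>
      mem_iUnion₂.2 ⟨c, hc, Or.inr (mem_iUnion₂.2 ⟨d, hd, ⟨s, ⟨hsf, hs⟩, rfl⟩⟩)⟩
  set F : AnalyticPath EM M → Set ℝ := fun c => {t ∈ Icc (0 : ℝ) 1 | c t ∈ V} with hF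
  have hFf : ∀ c ∈ D, (F c).Finite := by
    intro c hc
    refine Set.Finite.of_finite_image (f := c) (hVf.subset ?_) ((hDi c hc).mono fun t ht => ht.1)
    rintro _ ⟨t, ht, rfl⟩
    exact ht.2
  -- The new edges are the parts between consecutive cut points.
  set Q : Set (AnalyticPath EM M) := {p | ∃ c ∈ D, ∃ a ∈ F c, ∃ b ∈ F c, p.IsSubpath c a b ∧
    ∀ t ∈ Ioo a b, t ∉ F c} with hQ
  have hQf : Q.Finite := by
    have : Q ⊆ ⋃ c ∈ D, ⋃ a ∈ F c, ⋃ b ∈ F c, {p : AnalyticPath EM M | p.IsSubpath c a b} := by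
      rintro p ⟨c, hc, a, ha, b, hb, hp, -⟩
      simp only [mem_iUnion]
      exact ⟨c, hc, a, ha, b, hb, hp⟩
    refine (hDf.biUnion fun c hc => (hFf c hc).biUnion fun a _ => (hFf c hc).biUnion fun b _ =>
      Set.Subsingleton.finite ?_).subset this
    intro p hp q hq
    exact AnalyticPath.IsSubpath.unique hp hq
  have hQi : ∀ p ∈ Q, InjOn p (Icc 0 1) := by
    rintro p ⟨c, hc, a, ha, b, hb, hp, -⟩
    exact hp.injOn ((hDi c hc).mono hp.Icc_subset)
  have hQm : ∀ p ∈ Q, ∀ q ∈ Q, p.toUEdge ≠ q.toUEdge → p.image ∩ q.image ⊆ p.ends ∩ q.ends := by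
    have interior : ∀ p c : AnalyticPath EM M, ∀ a ∈ F c, ∀ b ∈ F c, p.IsSubpath c a b →
        (∀ t ∈ Ioo a b, t ∉ F c) → ∀ x ∈ p.image,
          x ∈ p.ends ∨ (x ∉ V ∧ ∃ s ∈ Ioo a b, c s = x) := by
      intro p c a ha b hb hp hab x hx
      rw [hp.image_eq] at hx
      rw [hp.ends_eq]
      obtain ⟨s, hs, rfl⟩ := hx
      rcases hs.1.eq_or_lt with rfl | h1
      · exact Or.inl (Or.inl rfl)
      rcases hs.2.eq_or_lt with rfl | h2
      · exact Or.inl (Or.inr rfl)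
      exact Or.inr ⟨fun h => hab s ⟨h1, h2⟩ ⟨hp.Icc_subset hs, h⟩, s, ⟨h1, h2⟩, rfl⟩
    rintro p hpQ q hqQ hne x ⟨hxp, hxq⟩
    obtain ⟨c, hc, a, ha, b, hb, hp, hab⟩ := id hpQ
    obtain ⟨d, hd, a', ha', b', hb', hq, hab'⟩ := id hqQ
    have endsV : ∀ p c : AnalyticPath EM M, ∀ a ∈ F c, ∀ b ∈ F c, p.IsSubpath c a b →
        p.ends ⊆ V := by
      rintro p c a ha b hb hp x hx
      rw [hp.ends_eq] at hx
      rcases hx with rfl | rfl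
      exacts [ha.2, hb.2]
    rcases interior p c a ha b hb hp hab x hxp with h1 | ⟨h1, s, hs, hsx⟩ <;>
    rcases interior q d a' ha' b' hb' hq hab' x hxq with h2 | ⟨h2, s', hs', hsx'⟩
    · exact ⟨h1, h2⟩
    · exact absurd (endsV p c a ha b hb hp h1) h2
    · exact absurd (endsV q d a' ha' b' hb' hq h2) h1
    -- A meeting point interior to both parts forces each image to contain the other, hence the same
    -- unoriented edge. The mixed cases were excluded because ends lie in `V` and interior points do
    -- not.
    · refine absurd (AnalyticPath.toUEdge_eq_of_image_eq (hQi p hpQ) (hQi q hqQ) ?_) hne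
      refine Subset.antisymm ?_ ?_
      · exact AnalyticPath.image_subset_of_mem (hDi d hd) (hfr c hc d hd) hp hq
          (fun t ht h => hab t ht ⟨hp.Icc_subset (Ioo_subset_Icc_self ht), h⟩) ha'.2 hb'.2 hs hs'
          (hsx.trans hsx'.symm)
      · exact AnalyticPath.image_subset_of_mem (hDi c hc) (hfr d hd c hc) hq hp
          (fun t ht h => hab' t ht ⟨hq.Icc_subset (Ioo_subset_Icc_self ht), h⟩) ha.2 hb.2 hs' hs
          (hsx'.trans hsx.symm)
  refine ⟨AnalyticPath.toUEdge '' Q, ⟨hQf.image _, ?_, ?_⟩, fun e he => ?_⟩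
  · rintro c ⟨p, hp, hpc⟩
    exact AnalyticPath.injOn_of_toUEdge_eq hpc (hQi p hp)
  · rintro c c' ⟨p, hp, hpc⟩ ⟨q, hq, hqc⟩ hne
    rw [← AnalyticPath.image_eq_of_toUEdge_eq hpc, ← AnalyticPath.image_eq_of_toUEdge_eq hqc,
      ← AnalyticPath.ends_eq_of_toUEdge_eq hpc, ← AnalyticPath.ends_eq_of_toUEdge_eq hqc]
    exact hQm p hp q hq (by rwa [hpc, hqc])
  · refine (hCe e).trans ?_
    rintro _ ⟨c, hc, rfl⟩
    have hcD : c ∈ D := mem_iUnion₂.2 ⟨e, he, hc⟩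
    refine AnalyticPath.isProduct_of_subdivision (hFf c hcD) (fun a ha b hb p hp hab => ?_)
      (⟨by simp, hends c hcD (Or.inl rfl)⟩ : (0 : ℝ) ∈ F c)
      (⟨by simp, hends c hcD (Or.inr rfl)⟩ : (1 : ℝ) ∈ F c) c.isSubpath_self
    exact ⟨p, ⟨p, ⟨c, hcD, a, ha, b, hb, hp, hab⟩, rfl⟩, rfl⟩

end Products

/-! ## Closing up a graph -/

section Bigons

variable {EM : Type*} [NormedAddCommGroup EM] [NormedSpace ℝ EM]
  {M : Type*} [TopologicalSpace M] [ChartedSpace EM M]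

/-- The filter `𝓝[>] 0 ×ˢ 𝓝 u` describes short thin cones with apex `y` about the direction `u`: the
pair `z` stands for the point `y + z.1 • z.2`. -/
theorem tendsto_cone {E : Type*} [NormedAddCommGroup E] [NormedSpace ℝ E] (y u : E) :
    Tendsto (fun z : ℝ × E => y + z.1 • z.2) (𝓝[>] 0 ×ˢ 𝓝 u) (𝓝 y) := by
  have h1 : Tendsto (fun z : ℝ × E => z.1) (𝓝[>] 0 ×ˢ 𝓝 u) (𝓝 0) :=
    tendsto_fst.mono_right nhdsWithin_le_nhds
  have h2 : Tendsto (fun z : ℝ × E => z.2) (𝓝[>] 0 ×ˢ 𝓝 u) (𝓝 u) := tendsto_snd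
  simpa using tendsto_const_nhds.add (h1.smul h2)

theorem eventually_extChartAt_cone_mem (v : M) (u : EM) :
    ∀ᶠ z : ℝ × EM in 𝓝[>] 0 ×ˢ 𝓝 u,
      extChartAt 𝓘(ℝ, EM) v v + z.1 • z.2 ∈ (extChartAt 𝓘(ℝ, EM) v).target :=
  tendsto_cone _ u ((isOpen_extChartAt_target v).mem_nhds (mem_extChartAt_target v))

theorem tendsto_extChartAt_symm_cone (v : M) (u : EM) :
    Tendsto (fun z : ℝ × EM => (extChartAt 𝓘(ℝ, EM) v).symm
      (extChartAt 𝓘(ℝ, EM) v v + z.1 • z.2)) (𝓝[>] 0 ×ˢ 𝓝 u) (𝓝 v) := by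
  have h := (continuousAt_extChartAt_symm (I := 𝓘(ℝ, EM)) v).tendsto
  rw [extChartAt_to_inv] at h
  exact h.comp (tendsto_cone _ u)

/-- The vertices which are an end point of one edge only. -/
def freeVertices (S : Set (UEdge EM M)) : Set M :=
  {v | ∃ c : AnalyticPath EM M, c.toUEdge ∈ S ∧ v ∈ c.ends ∧
    ∀ c' : AnalyticPath EM M, c'.toUEdge ∈ S → v ∈ c'.ends → c'.toUEdge = c.toUEdge}

theorem finite_freeVertices {S : Set (UEdge EM M)} (hS : S.Finite) : (freeVertices S).Finite := by
  obtain ⟨rep, hrep⟩ : ∃ rep : UEdge EM M → AnalyticPath EM M, ∀ e, (rep e).toUEdge = e :=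
    ⟨Quotient.out, Quotient.out_eq⟩
  have : (⋃ e ∈ S, (rep e).ends).Finite :=
    hS.biUnion fun e _ => by unfold AnalyticPath.ends; exact toFinite _
  refine this.subset ?_
  rintro v ⟨c, hc, hv, -⟩
  refine mem_iUnion₂.2 ⟨_, hc, ?_⟩
  rwa [AnalyticPath.ends_eq_of_toUEdge_eq (hrep c.toUEdge)]

variable [IsManifold 𝓘(ℝ, EM) ω M]

namespace AnalyticPath

/-- An embedded edge avoids a thin cone about every direction which is not tangent to it. -/
theorem eventually_notMem_image [T2Space M] {c : AnalyticPath EM M} (hc : InjOn c (Icc 0 1))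
    (v : M) : ∃ ξ : EM, ∀ u : EM, (∀ r : ℝ, r • ξ ≠ u) → ∀ᶠ z : ℝ × EM in 𝓝[>] 0 ×ˢ 𝓝 u,
      (extChartAt 𝓘(ℝ, EM) v).symm (extChartAt 𝓘(ℝ, EM) v v + z.1 • z.2) ∉ c.image := by
  by_cases hv : v ∈ c.image
  swap
  · exact ⟨0, fun u _ =>
      tendsto_extChartAt_symm_cone v u (c.isCompact_image.isClosed.isOpen_compl.mem_nhds hv)⟩
  obtain ⟨t, ht, rfl⟩ := hv
  obtain ⟨θ, hθ, hev⟩ := exists_leftInverse_of_injOn hc ht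
  obtain ⟨ξ, -, hξ⟩ := c.exists_hasDerivAt_chart ht
  have hθt : θ (c t) = t := hev.self_of_nhds t ht rfl
  refine ⟨ξ, fun u hu => ?_⟩
  set φ := extChartAt 𝓘(ℝ, EM) (c t) with hφ
  have hφt : φ.symm (φ (c t)) = c t := extChartAt_to_inv _
  set Θ : EM → ℝ := fun y => θ (φ.symm y) with hΘ
  have hΘd : DifferentiableAt ℝ Θ (φ (c t)) := by
    have h1 : ContMDiffAt 𝓘(ℝ, EM) 𝓘(ℝ, EM) ω φ.symm (φ (c t)) :=
      (contMDiffOn_extChartAt_symm (c t)).contMDiffAt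
        ((isOpen_extChartAt_target (c t)).mem_nhds (mem_extChartAt_target (c t)))
    have h2 : ContMDiffAt 𝓘(ℝ, EM) 𝓘(ℝ, ℝ) ω Θ (φ (c t)) :=
      ContMDiffAt.comp (g := θ) _ (by rw [hφt]; exact hθ) h1
    exact (contMDiffAt_iff_contDiffAt.1 h2).differentiableAt (by simp)
  have hΘt : Θ (φ (c t)) = t := by simp only [hΘ, hφt, hθt]
  -- This map fixes nearby points of the edge, and its derivative at the vertex has values in the
  -- line spanned by `ξ`.
  have hΨ : HasFDerivAt (fun y => φ (c (Θ y)))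
      ((ContinuousLinearMap.toSpanSingleton ℝ ξ).comp (fderiv ℝ Θ (φ (c t)))) (φ (c t)) := by
    refine HasFDerivAt.comp (g := fun s => φ (c s)) _ ?_ hΘd.hasFDerivAt
    rw [hΘt]
    exact hξ.hasFDerivAt
  by_contra hnot
  have hfreq : ∃ᶠ z : ℝ × EM in 𝓝[>] 0 ×ˢ 𝓝 u, φ.symm (φ (c t) + z.1 • z.2) ∈ c.image := by
    intro h; exact hnot h
  have hpos : ∀ᶠ z : ℝ × EM in 𝓝[>] 0 ×ˢ 𝓝 u, 0 < z.1 :=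
    tendsto_fst.eventually self_mem_nhdsWithin
  -- If edge points occurred in arbitrarily thin cones, `z.2` would frequently equal the difference
  -- quotient of that map. In the limit `u` equals its derivative at `u`, a multiple of `ξ`,
  -- contrary to assumption.
  have heq : ∃ᶠ z : ℝ × EM in 𝓝[>] 0 ×ˢ 𝓝 u,
      z.2 = z.1⁻¹ • (φ (c (Θ (φ (c t) + z.1 • z.2))) - φ (c (Θ (φ (c t))))) := by
    refine (hfreq.and_eventually ((eventually_extChartAt_cone_mem (c t) u).and
      (hpos.and (tendsto_extChartAt_symm_cone (c t) u hev)))).mono ?_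
    rintro z ⟨⟨s, hs, hsz⟩, h1, h2, h3⟩
    have h4 : Θ (φ (c t) + z.1 • z.2) = s := h3 s hs hsz
    rw [hΘt, h4, hsz, φ.right_inv h1, add_sub_cancel_left, smul_smul, inv_mul_cancel₀ h2.ne',
      one_smul]
  have hd : Tendsto (fun z : ℝ × EM => z.1 • z.2) (𝓝[>] 0 ×ˢ 𝓝 u) (𝓝 0) := by
    simpa using tendsto_cone (0 : EM) u
  have hcd : Tendsto (fun z : ℝ × EM => z.1⁻¹ • z.1 • z.2) (𝓝[>] 0 ×ˢ 𝓝 u) (𝓝 u) := by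
    refine Tendsto.congr' ?_ (tendsto_snd : Tendsto Prod.snd (𝓝[>] (0 : ℝ) ×ˢ 𝓝 u) (𝓝 u))
    filter_upwards [hpos] with z hz
    rw [smul_smul, inv_mul_cancel₀ hz.ne', one_smul]
  have hlim := hΨ.hasFDerivWithinAt (s := univ) |>.lim hd (Eventually.of_forall fun _ => mem_univ _)
    hcd
  have := tendsto_nhds_unique_of_frequently_eq
    (tendsto_snd : Tendsto Prod.snd (𝓝[>] (0 : ℝ) ×ˢ 𝓝 u) (𝓝 u)) hlim heq
  rw [ContinuousLinearMap.comp_apply, ContinuousLinearMap.toSpanSingleton_apply] at this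
  exact hu _ this.symm

/-- Paths given in a chart. -/
theorem exists_of_chart (v : M) {y y' : ℝ → EM} (hy : ContDiff ℝ ω y)
    (hm : ∀ t ∈ Icc (0 : ℝ) 1, y t ∈ (extChartAt 𝓘(ℝ, EM) v).target)
    (hd : ∀ t ∈ Icc (0 : ℝ) 1, HasDerivAt y (y' t) t) (hne : ∀ t ∈ Icc (0 : ℝ) 1, y' t ≠ 0) :
    ∃ c : AnalyticPath EM M, ∀ t, c t = (extChartAt 𝓘(ℝ, EM) v).symm (y t) := by
  have : IsManifold 𝓘(ℝ, EM) 1 M := IsManifold.of_le (n := ω) le_top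
  set φ := extChartAt 𝓘(ℝ, EM) v with hφ
  have hs : ∀ t ∈ Icc (0 : ℝ) 1, ContMDiffAt 𝓘(ℝ, ℝ) 𝓘(ℝ, EM) ω (fun t => φ.symm (y t)) t :=
    fun t ht => ContMDiffAt.comp (g := φ.symm) t ((contMDiffOn_extChartAt_symm v).contMDiffAt
      ((isOpen_extChartAt_target v).mem_nhds (hm t ht))) hy.contMDiff.contMDiffAt
  refine ⟨⟨fun t => φ.symm (y t), hs, fun t ht h0 => hne t ht ?_⟩, fun t => rfl⟩
  have h1 : HasVelWithinAt (fun t => φ.symm (y t))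
      (modelDeriv ℝ EM (fun t => φ.symm (y t)) t 1) univ t :=
    HasVelWithinAt.of_mdifferentiableAt ((hs t ht).mdifferentiableAt (by simp))
  have hsrc : φ.symm (y t) ∈ (chartAt EM v).source := by
    rw [← extChartAt_source 𝓘(ℝ, EM)]; exact φ.map_target (hm t ht)
  have h2 := h1.comp (mdifferentiableAt_extChartAt (I := 𝓘(ℝ, EM)) hsrc)
  have h00 : modelDeriv ℝ EM (fun t => φ.symm (y t)) t 1 = 0 := h0
  rw [h00, map_zero] at h2
  have h3 : HasVelWithinAt y (y' t) univ t :=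
    HasVelWithinAt.iff_hasDerivWithinAt.2 (hd t ht).hasDerivWithinAt
  refine h3.unique (h2.congr ?_ (φ.right_inv (hm t ht)).symm) uniqueDiffWithinAt_univ
  rw [nhdsWithin_univ]
  filter_upwards [hy.continuous.continuousAt ((isOpen_extChartAt_target v).mem_nhds (hm t ht))]
    with r hr using (φ.right_inv hr).symm

end AnalyticPath

theorem span_singleton_ne_top_of_two_le_finrank {E : Type*} [NormedAddCommGroup E]
    [NormedSpace ℝ E] (h : 2 ≤ Module.finrank ℝ E) (ξ : E) : Submodule.span ℝ {ξ} ≠ ⊤ := by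
  intro htop
  have h1 := finrank_span_le_card (R := ℝ) ({ξ} : Set E)
  rw [htop, finrank_top, toFinset_singleton, Finset.card_singleton] at h1
  omega

variable [T2Space M]

/-- At every vertex one can attach two arcs which have the same end points, but meet neither each
other nor the given edges elsewhere. -/
theorem IsPregraph.exists_bigon (hdim : 2 ≤ Module.finrank ℝ EM) {S : Set (UEdge EM M)}
    (hS : IsPregraph S) (v : M) : ∃ p q : AnalyticPath EM M, InjOn p (Icc 0 1) ∧
      InjOn q (Icc 0 1) ∧ p 0 = v ∧ q 0 = v ∧ p 1 = q 1 ∧ p.image ∩ q.image ⊆ {v, p 1} ∧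
      ∀ c : AnalyticPath EM M, c.toUEdge ∈ S →
        p.image ∩ c.image ⊆ {v} ∧ q.image ∩ c.image ⊆ {v} := by
  obtain ⟨rep, hrep⟩ : ∃ rep : UEdge EM M → AnalyticPath EM M, ∀ e, (rep e).toUEdge = e :=
    ⟨Quotient.out, Quotient.out_eq⟩
  choose ξ hξ using fun e : S => AnalyticPath.eventually_notMem_image
    (hS.embedded (rep e) (by rw [hrep]; exact e.2)) v
  have : Finite S := hS.finite
  -- A real vector space is not a finite union of proper subspaces, so some direction `d` avoids all
  -- tangent lines at `v`. The index `none` contributes the zero subspace, which ensures `d ≠ 0`.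
  obtain ⟨d, hd⟩ := Submodule.exists_forall_notMem_of_forall_ne_top (K := ℝ)
    (fun e : Option S => Submodule.span ℝ {e.elim 0 ξ})
    (fun e => span_singleton_ne_top_of_two_le_finrank hdim _)
  have hd0 : d ≠ 0 := fun h => hd none (by rw [h]; exact Submodule.zero_mem _)
  obtain ⟨b, -, hb⟩ := SetLike.exists_of_lt
    (span_singleton_ne_top_of_two_le_finrank hdim d).lt_top
  have hind : ∀ x y : ℝ, x • d + y • b = 0 → x = 0 ∧ y = 0 := by
    intro x y hxy
    have hy : y = 0 := by
      by_contra hy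
      refine hb (Submodule.mem_span_singleton.2 ⟨-(y⁻¹ * x), ?_⟩)
      have : b = -(y⁻¹ • (x • d)) := by
        rw [eq_neg_of_add_eq_zero_left hxy, smul_neg, neg_neg, smul_smul, inv_mul_cancel₀ hy,
          one_smul]
      rw [this, smul_smul, neg_smul]
    rw [hy, zero_smul, add_zero] at hxy
    exact ⟨(smul_eq_zero.1 hxy).resolve_right hd0, hy⟩
  set φ := extChartAt 𝓘(ℝ, EM) v with hφ
  have hev : ∀ᶠ z : ℝ × EM in 𝓝[>] 0 ×ˢ 𝓝 d, φ v + z.1 • z.2 ∈ φ.target ∧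
      ∀ e : S, φ.symm (φ v + z.1 • z.2) ∉ (rep e).image :=
    (eventually_extChartAt_cone_mem v d).and (eventually_all.2 fun e =>
      hξ e d fun r hr => hd (some e) (Submodule.mem_span_singleton.2 ⟨r, hr⟩))
  obtain ⟨⟨ε, δ⟩, ⟨hε, hδ⟩, hsub⟩ :=
    ((nhdsGT_basis (0 : ℝ)).prod (Metric.nhds_basis_ball (x := d))).eventually_iff.1 hev
  dsimp only at hε hδ hsub
  -- Small enough that the directions `d + (κ * (1 - s)) • b` stay within `δ` of `d`.
  set κ₀ : ℝ := δ / (‖b‖ + 1) with hκ₀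
  have hb1 : 0 < ‖b‖ + 1 := by positivity
  have hκ₀p : 0 < κ₀ := div_pos hδ hb1
  set η : ℝ := ε / 2 with hη
  have hηp : 0 < η := by positivity
  -- In the chart the two arcs are a segment, for `κ = 0`, and an arc of a parabola, for `κ = κ₀`.
  -- Both run from the vertex to the same point, inside the cone.
  set y : ℝ → ℝ → EM := fun κ s => φ v + ((η * s) • d + (η * κ * (s - s * s)) • b) with hy
  have hcone : ∀ κ s, y κ s = φ v + (η * s) • (d + (κ * (1 - s)) • b) := by
    intro κ s
    simp only [hy]
    module
  have hmem : ∀ κ ∈ Icc 0 κ₀, ∀ s ∈ Ioc (0 : ℝ) 1, y κ s ∈ φ.target ∧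
      ∀ e : S, φ.symm (y κ s) ∉ (rep e).image := by
    intro κ hκ s hs
    rw [hcone]
    refine hsub (x := (η * s, d + (κ * (1 - s)) • b)) ⟨⟨mul_pos hηp hs.1, ?_⟩, ?_⟩
    · nlinarith [hs.2]
    · rw [mem_ball_iff_norm, add_sub_cancel_left, norm_smul, Real.norm_eq_abs, abs_of_nonneg
        (mul_nonneg hκ.1 (by linarith [hs.2]))]
      have h1 : κ * (1 - s) ≤ κ₀ := by nlinarith [hκ.1, hκ.2, hs.1]
      calc κ * (1 - s) * ‖b‖ ≤ κ₀ * ‖b‖ := by gcongr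
        _ < κ₀ * (‖b‖ + 1) := by nlinarith
        _ = δ := div_mul_cancel₀ _ hb1.ne'
  have hy0 : ∀ κ, y κ 0 = φ v := fun κ => by simp [hy]
  have htarget : ∀ κ ∈ Icc 0 κ₀, ∀ s ∈ Icc (0 : ℝ) 1, y κ s ∈ φ.target := by
    intro κ hκ s hs
    rcases hs.1.eq_or_lt with rfl | h
    · rw [hy0]; exact mem_extChartAt_target v
    · exact (hmem κ hκ s ⟨h, hs.2⟩).1
  have hderiv : ∀ κ s, HasDerivAt (y κ) (η • d + (η * κ * (1 - 2 * s)) • b) s := by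
    intro κ s
    have h1 : HasDerivAt (fun s : ℝ => η * s) η s := by
      simpa using (hasDerivAt_id s).const_mul η
    have h2 : HasDerivAt (fun s : ℝ => η * κ * (s - s * s)) (η * κ * (1 - 2 * s)) s := by
      have h := ((hasDerivAt_id s).sub ((hasDerivAt_id s).mul (hasDerivAt_id s))).const_mul (η * κ)
      refine h.congr_deriv ?_
      simp only [id_eq]
      ring
    exact ((h1.smul_const d).add (h2.smul_const b)).const_add _
  have hpath : ∀ κ ∈ Icc 0 κ₀, ∃ p : AnalyticPath EM M, ∀ t, p t = φ.symm (y κ t) := by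
    intro κ hκ
    refine AnalyticPath.exists_of_chart v (by fun_prop) (htarget κ hκ) (fun t _ => hderiv κ t)
      fun t _ h => hηp.ne' (hind _ _ h).1
  -- Comparing the coefficients of the independent vectors `d` and `b` yields embeddedness of each
  -- arc as well as the intersection of the two.
  have hinj : ∀ κ ∈ Icc 0 κ₀, ∀ κ' ∈ Icc 0 κ₀, ∀ s ∈ Icc (0 : ℝ) 1, ∀ s' ∈ Icc (0 : ℝ) 1,
      φ.symm (y κ s) = φ.symm (y κ' s') → s = s' ∧ κ * (s - s * s) = κ' * (s - s * s) := by
    intro κ hκ κ' hκ' s hs s' hs' h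
    have h1 := φ.symm.injOn (htarget κ hκ s hs) (htarget κ' hκ' s' hs') h
    have h2 : (η * (s - s')) • d + (η * (κ * (s - s * s) - κ' * (s' - s' * s'))) • b = 0 := by
      have h3 : y κ s - y κ' s' = 0 := sub_eq_zero.2 h1
      simp only [hy] at h3
      rw [← h3]
      module
    obtain ⟨h3, h4⟩ := hind _ _ h2
    obtain rfl : s = s' := sub_eq_zero.1 ((mul_eq_zero.1 h3).resolve_left hηp.ne')
    exact ⟨rfl, sub_eq_zero.1 ((mul_eq_zero.1 h4).resolve_left hηp.ne')⟩
  have h0 : (0 : ℝ) ∈ Icc 0 κ₀ := ⟨le_rfl, hκ₀p.le⟩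
  have h1 : κ₀ ∈ Icc 0 κ₀ := ⟨hκ₀p.le, le_rfl⟩
  obtain ⟨p, hp⟩ := hpath 0 h0
  obtain ⟨q, hq⟩ := hpath κ₀ h1
  have hφv : φ.symm (φ v) = v := extChartAt_to_inv v
  have hS' : ∀ κ ∈ Icc 0 κ₀, ∀ p : AnalyticPath EM M, (∀ t, p t = φ.symm (y κ t)) →
      ∀ c : AnalyticPath EM M, c.toUEdge ∈ S → p.image ∩ c.image ⊆ {v} := by
    rintro κ hκ p hp c hc _ ⟨⟨t, ht, rfl⟩, hx⟩
    rcases ht.1.eq_or_lt with rfl | h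
    · rw [hp, hy0, hφv]; rfl
    · rw [hp] at hx
      rw [← AnalyticPath.image_eq_of_toUEdge_eq (hrep c.toUEdge)] at hx
      exact absurd hx ((hmem κ hκ t ⟨h, ht.2⟩).2 ⟨_, hc⟩)
  refine ⟨p, q, fun s hs t ht hst => ?_, fun s hs t ht hst => ?_, ?_, ?_, ?_, ?_,
    fun c hc => ⟨hS' 0 h0 p hp c hc, hS' κ₀ h1 q hq c hc⟩⟩
  · rw [hp, hp] at hst
    exact (hinj 0 h0 0 h0 s hs t ht hst).1
  · rw [hq, hq] at hst
    exact (hinj κ₀ h1 κ₀ h1 s hs t ht hst).1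
  · rw [hp, hy0, hφv]
  · rw [hq, hy0, hφv]
  · rw [hp, hq]
    simp [hy]
  · rintro _ ⟨⟨s, hs, rfl⟩, ⟨s', hs', hss'⟩⟩
    rw [hp, hq] at hss'
    obtain ⟨rfl, h⟩ := hinj κ₀ h1 0 h0 s' hs' s hs hss'
    rw [zero_mul] at h
    have h2 : s' * (1 - s') = 0 := by
      linear_combination (mul_eq_zero.1 h).resolve_left hκ₀p.ne'
    rcases mul_eq_zero.1 h2 with rfl | h3
    · exact Or.inl (by rw [hp, hy0, hφv])
    · obtain rfl : s' = 1 := (sub_eq_zero.1 h3).symm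
      exact Or.inr rfl

/-- A free vertex can be removed by adding edges. -/
theorem IsPregraph.exists_freeVertices_ssubset (hdim : 2 ≤ Module.finrank ℝ EM)
    {S : Set (UEdge EM M)} (hS : IsPregraph S) {v : M} (hv : v ∈ freeVertices S) :
    ∃ S', IsPregraph S' ∧ S ⊆ S' ∧ freeVertices S' ⊂ freeVertices S := by
  obtain ⟨p, q, hpi, hqi, hp0, hq0, hpq1, hpq, hpqS⟩ := hS.exists_bigon hdim v
  obtain ⟨c₀, hc₀, hvc₀, -⟩ := id hv
  have hmid : ∀ {p : AnalyticPath EM M}, InjOn p (Icc 0 1) → p (1 / 2) ∉ p.ends := by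
    rintro p hp (h | h)
    · have := hp (by norm_num) (by norm_num) h; norm_num at this
    · have := hp (by norm_num) (by norm_num) h; norm_num at this
  have hpe : p.ends = {v, p 1} := by unfold AnalyticPath.ends; rw [hp0]
  have hqe : q.ends = {v, p 1} := by unfold AnalyticPath.ends; rw [hq0, hpq1]
  have hmi : ∀ p : AnalyticPath EM M, p (1 / 2) ∈ p.image :=
    fun p => AnalyticPath.mem_image (by norm_num)
  have hne : p.toUEdge ≠ q.toUEdge := by
    intro h
    refine hmid hpi (hpe ▸ hpq ⟨hmi p, ?_⟩)
    rw [← AnalyticPath.image_eq_of_toUEdge_eq h]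
    exact hmi p
  have hpS : p.toUEdge ∉ S := by
    intro h
    refine hmid hpi (hpe ▸ Or.inl ((hpqS p h).1 ⟨hmi p, hmi p⟩))
  have hqS : q.toUEdge ∉ S := by
    intro h
    refine hmid hqi (hqe ▸ Or.inl ((hpqS q h).2 ⟨hmi q, hmi q⟩))
  -- Since `v` is an end point of an edge of `S`, no edge runs through it in its interior; the arcs
  -- are attached only at end points.
  have hvc : ∀ c : AnalyticPath EM M, c.toUEdge ∈ S → v ∈ c.image → v ∈ c.ends := by
    intro c hc hvi
    by_cases h : c.toUEdge = c₀.toUEdge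
    · rwa [AnalyticPath.ends_eq_of_toUEdge_eq h]
    · refine (hS.inter_subset c c₀ hc hc₀ h ⟨hvi, ?_⟩).1
      rcases hvc₀ with h | h <;> rw [h] <;> exact AnalyticPath.mem_image (by norm_num)
  set Good : AnalyticPath EM M → AnalyticPath EM M → Prop := fun c c' =>
    c.image ∩ c'.image ⊆ c.ends ∩ c'.ends with hGood
  have hsymm : ∀ {c c'}, Good c c' → Good c' c := fun {c c'} h => by
    simp only [hGood] at h ⊢
    rw [inter_comm, inter_comm c'.ends]
    exact h
  have hcongr : ∀ {c c' d d'}, c.toUEdge = c'.toUEdge → d.toUEdge = d'.toUEdge → Good c' d' →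
      Good c d := by
    intro c c' d d' h h' hg
    simp only [hGood] at hg ⊢
    rwa [AnalyticPath.image_eq_of_toUEdge_eq h, AnalyticPath.image_eq_of_toUEdge_eq h',
      AnalyticPath.ends_eq_of_toUEdge_eq h, AnalyticPath.ends_eq_of_toUEdge_eq h']
  have gpq : Good p q := fun x hx => ⟨hpe ▸ hpq hx, hqe ▸ hpq hx⟩
  have gp : ∀ c, c.toUEdge ∈ S → Good p c := by
    intro c hc x hx
    obtain rfl : x = v := (hpqS c hc).1 hx
    exact ⟨hpe ▸ Or.inl rfl, hvc c hc hx.2⟩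
  have gq : ∀ c, c.toUEdge ∈ S → Good q c := by
    intro c hc x hx
    obtain rfl : x = v := (hpqS c hc).2 hx
    exact ⟨hqe ▸ Or.inl rfl, hvc c hc hx.2⟩
  refine ⟨insert p.toUEdge (insert q.toUEdge S), ⟨(hS.finite.insert _).insert _, ?_, ?_⟩,
    (subset_insert _ _).trans (subset_insert _ _), ?_, fun hsub => ?_⟩
  · rintro c (h | h | h)
    · exact AnalyticPath.injOn_of_toUEdge_eq h.symm hpi
    · exact AnalyticPath.injOn_of_toUEdge_eq h.symm hqi
    · exact hS.embedded c h
  · rintro c c' (h | h | h) (h' | h' | h') hcc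
    · exact absurd (h.trans h'.symm) hcc
    · exact hcongr h h' gpq
    · exact hcongr h rfl (gp c' h')
    · exact hcongr h h' (hsymm gpq)
    · exact absurd (h.trans h'.symm) hcc
    · exact hcongr h rfl (gq c' h')
    · exact hcongr rfl h' (hsymm (gp c h))
    · exact hcongr rfl h' (hsymm (gq c h))
    · exact hS.inter_subset c c' h h' hcc
  -- The two arcs share both end points, so neither of these is free. A free vertex of the new set
  -- is thus an end of an old edge, and it was free before.
  · rintro x ⟨c, hc, hxc, huniq⟩
    have hpm : p.toUEdge ∈ insert p.toUEdge (insert q.toUEdge S) := Or.inl rfl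
    have hqm : q.toUEdge ∈ insert p.toUEdge (insert q.toUEdge S) := Or.inr (Or.inl rfl)
    have hno : x ∉ p.ends := fun hx => hne ((huniq p hpm hx).trans
      (huniq q hqm (by rwa [hqe, ← hpe])).symm)
    rcases hc with h | h | h
    · rw [AnalyticPath.ends_eq_of_toUEdge_eq h] at hxc
      exact absurd hxc hno
    · rw [AnalyticPath.ends_eq_of_toUEdge_eq h, hqe, ← hpe] at hxc
      exact absurd hxc hno
    · exact ⟨c, h, hxc, fun c' hc' hx => huniq c' (Or.inr (Or.inr hc')) hx⟩
  · obtain ⟨c, hc, hvc', huniq⟩ := hsub hv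
    have h1 := huniq p (Or.inl rfl) (hpe ▸ Or.inl rfl)
    have h2 := huniq q (Or.inr (Or.inl rfl)) (hqe ▸ Or.inl rfl)
    exact hne (h1.trans h2.symm)

/-- Induction on the number of free vertices; closedness of a graph is exactly their absence. -/
theorem IsPregraph.exists_graph (hdim : 2 ≤ Module.finrank ℝ EM) {S : Set (UEdge EM M)}
    (hS : IsPregraph S) : ∃ γ : AnalyticGraph EM M, S ⊆ γ.edges := by
  induction hn : (freeVertices S).ncard using Nat.strong_induction_on generalizing S with
  | _ n ih =>
    by_cases hfree : (freeVertices S).Nonempty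
    · obtain ⟨v, hv⟩ := hfree
      obtain ⟨S', hS', hSS', hlt⟩ := hS.exists_freeVertices_ssubset hdim hv
      obtain ⟨γ, hγ⟩ := ih _ (hn ▸ ncard_lt_ncard hlt (finite_freeVertices hS.finite)) hS' rfl
      exact ⟨γ, hSS'.trans hγ⟩
    · refine ⟨⟨S, hS.finite, hS.embedded, hS.inter_subset, fun c hc v hv => ?_⟩, Subset.rfl⟩
      by_contra! hno
      refine hfree ⟨v, c, hc, hv, fun c' hc' hvc' => ?_⟩
      by_contra hne
      exact hno c' hc' hne hvc'

/-- Every finite set of edges is contained in a graph. -/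
theorem exists_graph_contains (hdim : 2 ≤ Module.finrank ℝ EM) {E : Set (OEdge EM M)}
    (hE : E.Finite) : ∃ γ : AnalyticGraph EM M, ∀ e ∈ E, γ.Contains e := by
  obtain ⟨S, hS, hSE⟩ := exists_isPregraph hE
  obtain ⟨γ, hγ⟩ := hS.exists_graph hdim
  refine ⟨γ, fun e he => (hSE e he).mono ?_⟩
  rintro _ ⟨c, hc, rfl⟩
  exact ⟨c, hγ hc, rfl⟩

end Bigons

/-! ## The projective limit -/

namespace AnalyticGraph

variable {EM : Type*} [NormedAddCommGroup EM] [NormedSpace ℝ EM]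
  {M : Type*} [TopologicalSpace M] [ChartedSpace EM M]

theorem finite_orientedEdges (γ : AnalyticGraph EM M) : γ.orientedEdges.Finite := by
  obtain ⟨rep, hrep⟩ : ∃ rep : UEdge EM M → AnalyticPath EM M, ∀ e, (rep e).toUEdge = e :=
    ⟨Quotient.out, Quotient.out_eq⟩
  refine (γ.finite.biUnion fun e _ =>
    toFinite {(rep e).toOEdge, (rep e).reverse.toOEdge}).subset ?_
  rintro _ ⟨c, hc, rfl⟩
  exact mem_iUnion₂.2 ⟨_, hc, AnalyticPath.toOEdge_eq_or (hrep c.toUEdge)⟩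

theorem Contains.source_target_mem {γ : AnalyticGraph EM M} {e : OEdge EM M} (h : γ.Contains e) :
    e.source ∈ γ.vertices ∧ e.target ∈ γ.vertices := by
  induction h with
  | of_mem e he =>
    obtain ⟨c, hc, rfl⟩ := he
    exact ⟨⟨c, hc, Or.inl rfl⟩, ⟨c, hc, Or.inr rfl⟩⟩
  | comp e₁ e₂ e _ _ h ih₁ ih₂ =>
    exact ⟨h.source_eq ▸ ih₁.1, h.target_eq ▸ ih₂.2⟩

/-- The condition on vertices is automatic, because the end points of a product are end points of
factors. -/
theorem le_of_forall_contains {γ γ' : AnalyticGraph EM M}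
    (h : ∀ e ∈ γ.orientedEdges, γ'.Contains e) : γ ≤ γ' := by
  refine ⟨h, ?_⟩
  rintro v ⟨c, hc, hv⟩
  obtain ⟨h1, h2⟩ := (h _ ⟨c, hc, rfl⟩).source_target_mem
  rcases hv with rfl | rfl
  exacts [h1, h2]

variable [IsManifold 𝓘(ℝ, EM) ω M] [T2Space M]

theorem exists_le_and_le (hdim : 2 ≤ Module.finrank ℝ EM) (γ γ' : AnalyticGraph EM M) :
    ∃ γ'' : AnalyticGraph EM M, γ ≤ γ'' ∧ γ' ≤ γ'' := by
  obtain ⟨γ'', h⟩ := exists_graph_contains hdim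
    (γ.finite_orientedEdges.union γ'.finite_orientedEdges)
  exact ⟨γ'', le_of_forall_contains fun e he => h e (Or.inl he),
    le_of_forall_contains fun e he => h e (Or.inr he)⟩

end AnalyticGraph

namespace PrincipalBundle

variable {EM : Type*} [NormedAddCommGroup EM] [NormedSpace ℝ EM]
    {EG : Type*} [NormedAddCommGroup EG] [NormedSpace ℝ EG]
    {EP : Type*} [NormedAddCommGroup EP] [NormedSpace ℝ EP]
    {M : Type*} [TopologicalSpace M] [ChartedSpace EM M]
    {G : Type*} [TopologicalSpace G] [ChartedSpace EG G] [Group G]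
    {P : Type*} [TopologicalSpace P] [ChartedSpace EP P]
    {B : PrincipalBundle EM EG EP M G P}

theorem GenTransport.ext_iso [IsManifold 𝓘(ℝ, EP) ∞ P] {I J : B.GenTransport}
    (h : ∀ e, I.iso e = J.iso e) : I = J := by
  obtain ⟨f, h1, h2⟩ := I
  obtain ⟨f', h1', h2'⟩ := J
  obtain rfl : f = f' := funext h
  rfl

/-- Generalised parallel transports which agree on the factors of an edge agree on the edge. -/
theorem GenTransport.iso_eq_of_isProduct [IsManifold 𝓘(ℝ, EP) ∞ P] {I J : B.GenTransport}
    {S : Set (OEdge EM M)} {e : OEdge EM M} (he : OEdge.IsProduct S e)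
    (h : ∀ e ∈ S, I.iso e = J.iso e) : I.iso e = J.iso e := by
  induction he with
  | of_mem e he => exact h e he
  | comp e₁ e₂ e _ _ hc ih₁ ih₂ =>
    refine FibreIso.ext' fun p => Subtype.ext ?_
    set p₁ : B.Fibre e₁.source := ⟨p.1, p.2.trans hc.source_eq⟩
    set p₂ : B.Fibre e₂.source := ⟨((I.iso e₁).toEquiv p₁).1,
      ((I.iso e₁).toEquiv p₁).2.trans hc.target_source.symm⟩
    rw [I.iso_comp e₁ e₂ e hc p₁ p₂ p rfl rfl, J.iso_comp e₁ e₂ e hc p₁ p₂ p rfl (by rw [← ih₁]),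
      ih₂]

theorem ProjLimit.toGraphConn_eq_of_le [IsManifold 𝓘(ℝ, EP) ∞ P]
    {γ γ' : AnalyticGraph EM M} {A : B.Connection} (x : B.ProjLimit) (h : γ ≤ γ')
    (hA : B.toGraphConn γ' A = x.1 γ') : B.toGraphConn γ A = x.1 γ := by
  obtain ⟨p, hp, hpx⟩ := x.2 γ γ' h
  rw [hp A, hA, hpx]

/-! ### Points of the projective limit as generalised parallel transports. -/

section ProjectiveLimit

variable [FiniteDimensional ℝ EM] [IsManifold 𝓘(ℝ, EM) ω M] [T2Space M]
  [SecondCountableTopology M] [LieGroup 𝓘(ℝ, EG) ∞ G] [IsManifold 𝓘(ℝ, EP) ∞ P] [CompleteSpace EG]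
  {γ γ' : AnalyticGraph EM M} {A A' : B.Connection}

/-- The edges of a graph are embedded, so on each of them the class of a connection and its
transport determine each other. -/
theorem toGraphConn_eq_iff : B.toGraphConn γ A = B.toGraphConn γ A' ↔
    ∀ c : AnalyticPath EM M, c.toUEdge ∈ γ.edges →
      transport A c.toOEdge = transport A' c.toOEdge := by
  constructor
  · intro h c hc
    exact (quot_mk_eq_iff (γ.embedded c hc)).1 (congrFun h ⟨c.toUEdge, hc⟩)
  · intro h
    funext ⟨e, he⟩
    obtain ⟨c, rfl⟩ : ∃ c : AnalyticPath EM M, c.toUEdge = e := Quotient.exists_rep e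
    exact (quot_mk_eq_iff (γ.embedded c he)).2 (h c he)

theorem transport_eq_of_toGraphConn_eq (h : B.toGraphConn γ A = B.toGraphConn γ A')
    {e : OEdge EM M} (he : γ.Contains e) : transport A e = transport A' e := by
  refine GenTransport.iso_eq_of_isProduct (I := A.genTransport) (J := A'.genTransport) he ?_
  rintro _ ⟨c, hc, rfl⟩
  exact toGraphConn_eq_iff.1 h c hc

theorem toGraphConn_eq_of_le (h : γ ≤ γ') (hA : B.toGraphConn γ' A = B.toGraphConn γ' A') :
    B.toGraphConn γ A = B.toGraphConn γ A' :=
  toGraphConn_eq_iff.2 fun c hc => transport_eq_of_toGraphConn_eq hA (h.1 _ ⟨c, hc, rfl⟩)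

variable [ConnectedSpace G]

/-- Every point of `𝒜_γ` is represented by a connection. -/
theorem toGraphConn_surjective (γ : AnalyticGraph EM M) :
    Function.Surjective (B.toGraphConn γ) := by
  intro x
  choose a ha using fun e : γ.edges => Quot.exists_rep (x e)
  obtain ⟨rep, hrep⟩ : ∃ rep : UEdge EM M → AnalyticPath EM M, ∀ e, (rep e).toUEdge = e :=
    ⟨Quotient.out, Quotient.out_eq⟩
  obtain ⟨A₀⟩ := B.exists_connection
  classical
  -- The components of `x` have unrelated representatives `a e`; one connection is made to reproduce
  -- their transports simultaneously. `A₀` only fills in values for edges outside `γ`.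
  obtain ⟨A, hA⟩ := exists_connection_transport_rep (B := B) γ hrep fun e =>
    transport (if h : e ∈ γ.edges then a ⟨e, h⟩ else A₀) (rep e).toOEdge
  refine ⟨A, funext fun ⟨e, he⟩ => ?_⟩
  have h := hA e he
  rw [dif_pos he] at h
  have key : ∀ (c : AnalyticPath EM M) (e : UEdge EM M), c.toUEdge = e → InjOn c (Icc 0 1) →
      ∀ A A' : B.Connection, transport A c.toOEdge = transport A' c.toOEdge →
        Quot.mk (B.EdgeEquiv e) A = Quot.mk (B.EdgeEquiv e) A' := by
    rintro c _ rfl hc A A' h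
    exact (quot_mk_eq_iff hc).2 h
  refine (key (rep e) e (hrep e) (γ.embedded _ (by rwa [hrep])) A _ h).trans (ha ⟨e, he⟩)

/-- Any choice of representing connections defines a projection, since equality over `γ'` implies
equality over `γ`; surjectivity of the map from connections to `B.GraphConn γ'` leaves no other. -/
theorem existsUnique_isProjection (h : γ ≤ γ') : ∃! p, B.IsProjection γ γ' p := by
  choose A hA using toGraphConn_surjective (B := B) γ'
  refine ⟨fun y => B.toGraphConn γ (A y), fun A' => toGraphConn_eq_of_le h (hA _).symm,
    fun p hp => funext fun y => ?_⟩
  rw [hp (A y), hA]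

/-- Both connections are compared with one which represents the point over a common upper bound of
the two graphs. -/
theorem ProjLimit.transport_eq (hdim : 2 ≤ Module.finrank ℝ EM) (x : B.ProjLimit)
    (hA : B.toGraphConn γ A = x.1 γ) (hA' : B.toGraphConn γ' A' = x.1 γ') {e : OEdge EM M}
    (he : γ.Contains e) (he' : γ'.Contains e) : transport A e = transport A' e := by
  obtain ⟨γ'', h, h'⟩ := AnalyticGraph.exists_le_and_le hdim γ γ'
  obtain ⟨A'', hA''⟩ := toGraphConn_surjective γ'' (x.1 γ'')
  rw [transport_eq_of_toGraphConn_eq (hA.trans (x.toGraphConn_eq_of_le h hA'').symm) he,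
    transport_eq_of_toGraphConn_eq (hA'.trans (x.toGraphConn_eq_of_le h' hA'').symm) he']

/-- The generalised parallel transport defined by a point of the projective limit. -/
theorem ProjLimit.exists_genTransport (hdim : 2 ≤ Module.finrank ℝ EM) (x : B.ProjLimit) :
    ∃ I : B.GenTransport, ∀ (γ : AnalyticGraph EM M) (A : B.Connection) (e : OEdge EM M),
      γ.Contains e → B.toGraphConn γ A = x.1 γ → transport A e = I.iso e := by
  have hex : ∀ e : OEdge EM M, ∃ (γ : AnalyticGraph EM M) (A : B.Connection),
      γ.Contains e ∧ B.toGraphConn γ A = x.1 γ := by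
    intro e
    obtain ⟨γ, hγ⟩ := exists_graph_contains hdim (finite_singleton e)
    obtain ⟨A, hA⟩ := toGraphConn_surjective γ (x.1 γ)
    exact ⟨γ, A, hγ e rfl, hA⟩
  choose δ D hδ hD using hex
  have key : ∀ (γ : AnalyticGraph EM M) (A : B.Connection) (e : OEdge EM M),
      γ.Contains e → B.toGraphConn γ A = x.1 γ → transport A e = transport (D e) e :=
    fun γ A e he hA => x.transport_eq hdim hA (hD e) he (hδ e)
  refine ⟨⟨fun e => transport (D e) e, fun e e' he p q hq => ?_,
    fun e₁ e₂ e he p₁ p₂ p hp hp₂ => ?_⟩, key⟩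
  -- One graph contains all edges in the law, so the law is inherited from a single genuine
  -- connection. The law for compositions is treated likewise.
  · obtain ⟨γ, hγ⟩ := exists_graph_contains hdim (toFinite {e, e'})
    obtain ⟨A, hA⟩ := toGraphConn_surjective γ (x.1 γ)
    rw [← key γ A e (hγ e (by simp)) hA] at hq
    rw [← key γ A e' (hγ e' (by simp)) hA]
    exact A.genTransport.iso_inverse e e' he p q hq
  · obtain ⟨γ, hγ⟩ := exists_graph_contains hdim (toFinite {e₁, e₂, e})
    obtain ⟨A, hA⟩ := toGraphConn_surjective γ (x.1 γ)
    rw [← key γ A e₁ (hγ e₁ (by simp)) hA] at hp₂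
    rw [← key γ A e₂ (hγ e₂ (by simp)) hA, ← key γ A e (hγ e (by simp)) hA]
    exact A.genTransport.iso_comp e₁ e₂ e he p₁ p₂ p hp hp₂

/-- Every generalised parallel transport comes from a point of the projective limit. -/
theorem GenTransport.exists_projLimit (I : B.GenTransport) : ∃ x : B.ProjLimit,
    ∀ γ : AnalyticGraph EM M, ∃ A : B.Connection, B.toGraphConn γ A = x.1 γ ∧
      ∀ e, γ.Contains e → transport A e = I.iso e := by
  choose A hA using fun γ : AnalyticGraph EM M => exists_connection_of_graph γ I
  have hAe : ∀ (γ : AnalyticGraph EM M) (e : OEdge EM M), γ.Contains e →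
      transport (A γ) e = I.iso e := by
    intro γ e he
    refine GenTransport.iso_eq_of_isProduct (I := (A γ).genTransport) he ?_
    rintro _ ⟨c, hc, rfl⟩
    exact hA γ c hc
  refine ⟨⟨fun γ => B.toGraphConn γ (A γ), fun γ γ' h => ?_⟩, fun γ => ⟨A γ, rfl, hAe γ⟩⟩
  obtain ⟨p, hp, -⟩ := existsUnique_isProjection (B := B) h
  refine ⟨p, hp, ?_⟩
  change p (B.toGraphConn γ' (A γ')) = B.toGraphConn γ (A γ)
  rw [← hp (A γ')]
  -- Compatibility: along the edges of `γ`, the connections chosen for `γ` and for `γ'` both have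
  -- the transports of `I`.
  refine toGraphConn_eq_iff.2 fun c hc => ?_
  rw [hA γ c hc]
  exact hAe γ' _ (h.1 _ ⟨c, hc, rfl⟩)

end ProjectiveLimit

end PrincipalBundle

theorem proposition2
    {EM : Type*} [NormedAddCommGroup EM] [NormedSpace ℝ EM] [FiniteDimensional ℝ EM]
    {EG : Type*} [NormedAddCommGroup EG] [NormedSpace ℝ EG] [FiniteDimensional ℝ EG]
    {EP : Type*} [NormedAddCommGroup EP] [NormedSpace ℝ EP] [FiniteDimensional ℝ EP]
    {M : Type*} [TopologicalSpace M] [ChartedSpace EM M] [IsManifold 𝓘(ℝ, EM) ω M]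
    [T2Space M] [SecondCountableTopology M]
    {G : Type*} [TopologicalSpace G] [ChartedSpace EG G] [Group G] [LieGroup 𝓘(ℝ, EG) ∞ G]
    [T2Space G] [CompactSpace G] [ConnectedSpace G]
    {P : Type*} [TopologicalSpace P] [ChartedSpace EP P] [IsManifold 𝓘(ℝ, EP) ∞ P]
    (B : PrincipalBundle EM EG EP M G P)
    (hdim : 2 ≤ Module.finrank ℝ EM) :
    -- the projections of the projective family are well defined
    (∀ γ γ' : AnalyticGraph EM M, γ ≤ γ' → ∃! p, B.IsProjection γ γ' p) ∧
    -- every oriented edge is contained in some graph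
    (∀ e : OEdge EM M, ∃ γ : AnalyticGraph EM M, γ.Contains e) ∧
    -- the map from the projective limit is well defined and a bijection
    ∃ Φ : B.ProjLimit → B.GenTransport,
      (∀ (x : B.ProjLimit) (e : OEdge EM M) (γ : AnalyticGraph EM M), γ.Contains e →
        B.IsGraphTransport (x.1 γ) e ((Φ x).iso e)) ∧
      Function.Bijective Φ := by
  have : CompleteSpace EG := FiniteDimensional.complete ℝ EG
  refine ⟨fun γ γ' h => PrincipalBundle.existsUnique_isProjection h, fun e => ?_, ?_⟩
  · obtain ⟨γ, hγ⟩ := exists_graph_contains hdim (finite_singleton e)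
    exact ⟨γ, hγ e rfl⟩
  choose Φ hΦ using fun x : B.ProjLimit => x.exists_genTransport hdim
  refine ⟨Φ, fun x e γ he => ⟨PrincipalBundle.toGraphConn_surjective γ _, fun A hA p => ?_⟩,
    fun x y hxy => ?_, fun I => ?_⟩
  · rw [← hΦ x γ A e he hA]
    exact PrincipalBundle.transports_transport A e p
  -- Injectivity: over each graph the point is determined by the transports along its edges, which
  -- the image under `Φ` records.
  · refine Subtype.ext (funext fun γ => ?_)
    obtain ⟨A, hA⟩ := PrincipalBundle.toGraphConn_surjective γ (x.1 γ)
    obtain ⟨A', hA'⟩ := PrincipalBundle.toGraphConn_surjective γ (y.1 γ)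
    rw [← hA, ← hA']
    refine PrincipalBundle.toGraphConn_eq_iff.2 fun c hc => ?_
    have hγ : γ.Contains c.toOEdge := .of_mem _ ⟨c, hc, rfl⟩
    rw [hΦ x γ A _ hγ hA, hΦ y γ A' _ hγ hA', hxy]
  · obtain ⟨x, hx⟩ := I.exists_projLimit
    refine ⟨x, PrincipalBundle.GenTransport.ext_iso fun e => ?_⟩
    obtain ⟨γ, hγ⟩ := exists_graph_contains hdim (finite_singleton e)
    obtain ⟨A, hA, hAI⟩ := hx γ
    rw [← hΦ x γ A e (hγ e rfl) hA, hAI e (hγ e rfl)]
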